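/- Notation. For $\operatorname{Im}\mu>0$ let $\theta_1(v|\mu)=-i\sum_{k\in\mathbb Z}(-1)^k e^{(k+\frac12)^2\pi i\mu}e^{(2k+1)\pi i v}$, $\theta_2(v|\mu)=\sum_{k} e^{(k+\frac12)^2\pi i\mu}e^{(2k+1)\pi i v}$, $\theta_3(v|\mu)=\sum_{k} e^{k^2\pi i\mu}e^{2k\pi i v}$, $\theta_4(v|\mu)=\sum_{k} (-1)^k e^{k^2\pi i\mu}e^{2k\pi i v}$, and $\vartheta_j(\mu)=\theta_j(0|\mu)$. Let $\wp(z|i)$ be the Weierstrass function with half-periods $1$ and $i$ (period lattice $\Lambda=2\mathbb Z+2i\mathbb Z$), let $\mathbb H$ be the open upper half-plane, and let $\{f,\tau\}=\frac{f'''}{f'}-\frac32\left(\frac{f''}{f'}\right)^2$. Proposition. For every $\tau_0\in\mathbb H$ with $|\vartheta_3^4(\tau_0)/\vartheta_2^4(\tau_0)|<1$ (such $\tau_0$ exist), the function $$u(\tau)=\frac{2}{\pi}\,\frac{\vartheta_3(\tau)}{\vartheta_2^2(i)\,\vartheta_2(\tau)}\;{}_2F_1\!\left(\tfrac12,\tfrac14;\tfrac54\,\Big|\,\frac{\vartheta_3^4(\tau)}{\vartheta_2^4(\tau)}\right),$$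 defined near $\tau_0$ by the hypergeometric series, extends uniquely to a single-valued holomorphic function $u$ on $\mathbb H$. Put $s(\tau)=u\!\left(\frac{\tau-1}{\tau+1}\right)$. Then: (a) $u$ and $s$ are additively automorphic: for each $f\in\{u,s\}$ there is a subgroup $\Gamma$ of finite index in $SL(2,\mathbb Z)$ such that for every $\gamma\in\Gamma$ there is $c_\gamma\in\Lambda$ with $f(\gamma\tau)=f(\tau)+c_\gamma$ for all $\tau\in\mathbb H$. (b) For each $f\in\{u,s\}$ and every $\tau\in\mathbb H$ one has $2f(\tau)\notin\Lambda$, $\dot f(\tau)\ne0$ and $\{f,\tau\}=-2\,\wp(2f|i)\,\dot f^{\,2}$. (c) For one of the two choices of the sign, constant in $\tau$, the relation $$\pm 8\,\frac{\theta_2\theta_3^2\theta_4}{\theta_1^4}\!\left(\tfrac12 u\,\Big|\,i\right)=\frac{\theta_1^4}{\theta_2\theta_3^2\theta_4}\!\left(\tfrac12 s\,\Big|\,i\right)\qquad(*)$$ holds for $u=u(\tau)$, $s=s(\tau)$ and all $\tau\in\mathbb H$ (with nonzero denominators). Moreover, for either sign, $(*)$ is an automorphism of the equation $\psi''(z)=-\wp(2z|i)\psi(z)$: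 if $s=S(u)$ is a holomorphic function on an open set $U$, satisfying $(*)$, with $2u\notin\Lambda$ and $2S(u)\notin\Lambda$ on $U$, then $S'\neq0$ on $U$, and for every solution $\psi(s)$ of the equation, holomorphic on an open set containing $S(U)$, and every holomorphic $r$ on $U$ with $r^2S'=1$, the function $r(u)\psi(S(u))$ is a solution of the equation on $U$. -/

import Mathlib

open Complex Topology

noncomputable section

/-! Jacobi theta functions `θ₁, …, θ₄` of the variable `u` with modulus `μ`. -/

/-- `θ₁(u|μ)`. -/
def theta1 (u μ : ℂ) : ℂ :=
  -I * ∑' k : ℤ, (-1 : ℂ) ^ k * exp (((k : ℂ) + 1 / 2) ^ 2 * Real.pi * I * μ) *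
    exp ((2 * (k : ℂ) + 1) * Real.pi * I * u)

/-- `θ₂(u|μ)`. -/
def theta2 (u μ : ℂ) : ℂ :=
  ∑' k : ℤ, exp (((k : ℂ) + 1 / 2) ^ 2 * Real.pi * I * μ) *
    exp ((2 * (k : ℂ) + 1) * Real.pi * I * u)

/-- `θ₃(u|μ)`. -/
def theta3 (u μ : ℂ) : ℂ :=
  ∑' k : ℤ, exp ((k : ℂ) ^ 2 * Real.pi * I * μ) * exp (2 * (k : ℂ) * Real.pi * I * u)

/-- `θ₄(u|μ)`. -/
def theta4 (u μ : ℂ) : ℂ :=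
  ∑' k : ℤ, (-1 : ℂ) ^ k * exp ((k : ℂ) ^ 2 * Real.pi * I * μ) *
    exp (2 * (k : ℂ) * Real.pi * I * u)

/-- The theta constant `ϑ₂(τ) = ∑ exp((k + 1/2)² π i τ)`. -/
def thetaConst2 (τ : ℂ) : ℂ :=
  ∑' k : ℤ, exp (((k : ℂ) + 1 / 2) ^ 2 * Real.pi * I * τ)

/-- The theta constant `ϑ₃(τ) = ∑ exp(k² π i τ)`. -/
def thetaConst3 (τ : ℂ) : ℂ := jacobiTheta τ

/-- The square period lattice `2ℤ + 2iℤ`, that is, half-periods `1` and `i`. -/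
def squarePeriods : PeriodPair where
  ω₁ := 2
  ω₂ := 2 * I
  indep := by
    rw [LinearIndependent.pair_iff]
    intro s t h
    have h1 := congrArg Complex.re h
    have h2 := congrArg Complex.im h
    simp at h1 h2
    exact ⟨h1, h2⟩

/-- Weierstrass' function `℘(z|i)`, with half-periods `1` and `i`. -/
def wpI (z : ℂ) : ℂ := squarePeriods.weierstrassP z

/-- The points `u` with `2u` in the period lattice: the poles of `℘(2u|i)`. -/
def punctures : Set ℂ := {u | 2 * u ∈ squarePeriods.lattice}

/-- The Schwarzian derivative `{f, z}`. -/
def schwarzian (f : ℂ → ℂ) (z : ℂ) : ℂ :=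
  iteratedDeriv 3 f z / deriv f z - 3 / 2 * (iteratedDeriv 2 f z / deriv f z) ^ 2

/-- The open upper half-plane. -/
def upperHalf : Set ℂ := {τ | 0 < τ.im}

/-- `f` is locally uniformizing and satisfies the autonomous equation
`{f, τ} = -2 ℘(2f|i) (df/dτ)²` at every point of the upper half-plane, all terms being finite. -/
def SatisfiesSchwarzODE (f : ℂ → ℂ) : Prop :=
  ∀ τ ∈ upperHalf, f τ ∉ punctures ∧ deriv f τ ≠ 0 ∧
    schwarzian f τ = -2 * wpI (2 * f τ) * deriv f τ ^ 2

/-- `f` is additively automorphic, with additive periods in the lattice `2ℤ + 2iℤ`: there is a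
subgroup `Γ` of finite index in `SL(2, ℤ)` each element of which changes `f` by a constant
lying in the lattice. -/
def IsAdditivelyAutomorphic (f : ℂ → ℂ) : Prop :=
  DifferentiableOn ℂ f upperHalf ∧
  ∃ Γ : Subgroup (Matrix.SpecialLinearGroup (Fin 2) ℤ), Γ.FiniteIndex ∧
    ∀ γ ∈ Γ, ∃ c ∈ squarePeriods.lattice, ∀ τ : UpperHalfPlane,
      f ((γ • τ : UpperHalfPlane) : ℂ) = f (τ : ℂ) + c

/-- The expression `(2/π) ϑ₂(i)⁻² (ϑ₃(τ)/ϑ₂(τ)) ₂F₁(1/2, 1/4; 5/4 | ϑ₃(τ)⁴/ϑ₂(τ)⁴)`, in which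
`₂F₁` is the sum of the hypergeometric series (meaningful where the argument has modulus `< 1`). -/
def hypergeometricFormula (τ : ℂ) : ℂ :=
  2 / Real.pi * (thetaConst3 τ / (thetaConst2 I ^ 2 * thetaConst2 τ)) *
    ₂F₁ (1 / 2 : ℂ) (1 / 4 : ℂ) (5 / 4 : ℂ) (thetaConst3 τ ^ 4 / thetaConst2 τ ^ 4)

/-- `u` is the single-valued analytic function on the upper half-plane continuing the
hypergeometric formula from a neighbourhood of `τ₀`. -/
def ContinuesFormula (τ₀ : ℂ) (u : ℂ → ℂ) : Prop :=
  DifferentiableOn ℂ u upperHalf ∧ u =ᶠ[𝓝 τ₀] hypergeometricFormula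

/-- The relation `ε · 8 (θ₂ θ₃² θ₄ / θ₁⁴)(u/2|i) = (θ₁⁴ / (θ₂ θ₃² θ₄))(s/2|i)` between `u` and `s`,
with nonzero denominators. -/
def ThetaRelation (ε u s : ℂ) : Prop :=
  theta1 (u / 2) I ≠ 0 ∧ theta2 (s / 2) I * theta3 (s / 2) I ^ 2 * theta4 (s / 2) I ≠ 0 ∧
  ε * 8 * (theta2 (u / 2) I * theta3 (u / 2) I ^ 2 * theta4 (u / 2) I / theta1 (u / 2) I ^ 4) =
    theta1 (s / 2) I ^ 4 / (theta2 (s / 2) I * theta3 (s / 2) I ^ 2 * theta4 (s / 2) I)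

/-- `ψ` is a holomorphic solution of `ψ'' = -℘(2z|i) ψ` on `V`. -/
def SolvesTorusEquation (ψ : ℂ → ℂ) (V : Set ℂ) : Prop :=
  DifferentiableOn ℂ ψ V ∧ ∀ z ∈ V, iteratedDeriv 2 ψ z = -wpI (2 * z) * ψ z

/-- The relation `R(u, s)` is an automorphism of the equation `ψ'' = -℘(2z|i) ψ`: each holomorphic
branch `s = S(u)` of it, away from the punctures, is a change of variable (`S' ≠ 0`) which together
with the multiplier `(ds/du)^(-1/2)` carries solutions in `s` to solutions in `u`. -/
def IsTorusEquationAutomorphism (R : ℂ → ℂ → Prop) : Prop :=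
  ∀ (U : Set ℂ) (S : ℂ → ℂ), IsOpen U → DifferentiableOn ℂ S U →
    (∀ u ∈ U, u ∉ punctures ∧ S u ∉ punctures ∧ R u (S u)) →
    (∀ u ∈ U, deriv S u ≠ 0) ∧
    ∀ (V : Set ℂ) (ψ r : ℂ → ℂ), IsOpen V → Set.MapsTo S U V → SolvesTorusEquation ψ V →
      DifferentiableOn ℂ r U → (∀ u ∈ U, r u ^ 2 * deriv S u = 1) →
      SolvesTorusEquation (fun u => r u * ψ (S u)) U

end

/-! Everything is uniformised by the lemniscate function. On the square lattice, y(u) =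
±θ₁(u/2|i)/θ₃(u/2|i) satisfies y'² = c²(1 - y⁴) with y(0) = 0 and c = (π/2)ϑ₂(i)². Its local inverse
is arcsl(w)/c, where arcsl(w) = w ₂F₁(1/2, 1/4; 5/4 | w⁴). The hypergeometric formula is therefore
arcsl(ϑ₃/ϑ₂)/c, that is, a local solution of y(u(τ)) = ϑ₃(τ)/ϑ₂(τ).

Differentiating this equation shows that u' is a constant multiple of ϑ₂ϑ₃ϑ₄², which has no zero and
no singularity on the upper half-plane. So u continues as a primitive, and the identity y(u) =
ϑ₃/ϑ₂, cleared of denominators, continues with it (`exists_isUniformizer`). Since ϑ₂, ϑ₃, ϑ₄ do not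
vanish, y(u) avoids 0, ∞ and the fourth roots of unity, hence u avoids the punctures.

The Schwarzian equation compares two explicit expressions. The left side follows from the Halphen
system for the logarithmic derivatives of ϑ₂, ϑ₃, ϑ₄ (`hasDerivAt_logDeriv2`,
`hasDerivAt_logDeriv3`, `hasDerivAt_logDeriv4`). The right side follows from the expression of
℘(2u|i) through y (`wpI_two_mul`). The function s inherits the equation because a Möbius map has
zero Schwarzian.

For additive automorphy, y(u) and y'(u) are, up to constants, a theta ratio and the square of one.
Such ratios with arguments τ, 2τ, τ/2, (τ+1)/2 form a finite set stable under SL(2, ℤ), so both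
functions are invariant under a subgroup of finite index. Equal y and y' give equal derivatives of
u∘γ and u. The difference is then a constant, which is a period of y and lies in the lattice.

The relation between u and s says that 8W(u)W(s) is 1 or -1, where W = θ₂θ₃²θ₄/θ₁⁴. With λ = ϑ₂⁴/ϑ₃⁴
one has 2W(u)² = λ(λ-1), and the doubling formulas give the product 1/16 for the values of λ(λ-1) at
τ and at its Möbius image (`modularLambda_mobius`). A continuous function with square 1 on a
connected set is constant.

For the automorphism property the relation is squared to 16(1-y⁴)(1-Y⁴) = y⁸Y⁸ with Y = y(S(u)).
Differentiation yields 4S'²(1-y⁴) = y⁶Y² (`deriv_sq_of_relation`), hence S' ≠ 0 and a formula for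
S''/S'. An algebraic identity (`potential_identity`) then shows that the Schwarzian of S is what
carries one potential to the other (`solves_of_schwarzian`).

The classical theta identities used on the way come from one principle: quasi-periodic entire
functions of degree k are determined by k consecutive Fourier coefficients. -/

open Complex Topology

noncomputable section

/-! ### Theta series: majorants and derivatives in both variables -/

/-- The summand of the `m`-th `v`-derivative of the theta series with characteristic `a`. -/
def thetaDerivTerm (m : ℕ) (a : ℝ) (k : ℤ) (v τ : ℂ) : ℂ :=
  (2 * Real.pi * I * (k + a)) ^ m *
    exp (Real.pi * I * (k + a) ^ 2 * τ + 2 * Real.pi * I * (k + a) * v)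

/-- The `m`-th `v`-derivative of the theta series `∑ exp(πi(k+a)²τ + 2πi(k+a)v)`. -/
def thetaDeriv (m : ℕ) (a : ℝ) (v τ : ℂ) : ℂ := ∑' k : ℤ, thetaDerivTerm m a k v τ

/-- A summable majorant of `thetaDerivTerm` on `|Im v| ≤ S`, `Im τ ≥ T`. -/
def thetaDerivBound (m : ℕ) (a S T : ℝ) (k : ℤ) : ℝ :=
  ((2 * Real.pi) ^ m * Real.exp (2 * Real.pi * S ^ 2 / T)) *
    HurwitzKernelBounds.f_int m a (T / 2) k

lemma norm_thetaDerivTerm_le (m : ℕ) (a : ℝ) {S T : ℝ} (hT : 0 < T) {v τ : ℂ}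
    (hv : |v.im| ≤ S) (hτ : T ≤ τ.im) (k : ℤ) :
    ‖thetaDerivTerm m a k v τ‖ ≤ thetaDerivBound m a S T k := by
  have hx : ((k : ℂ) + a) = (((k : ℝ) + a : ℝ) : ℂ) := by push_cast; ring
  rw [thetaDerivTerm, hx, thetaDerivBound, HurwitzKernelBounds.f_int]
  set x : ℝ := (k : ℝ) + a
  rw [norm_mul, norm_pow, norm_exp]
  have h1 : ‖2 * (Real.pi : ℂ) * I * (x : ℂ)‖ = 2 * Real.pi * |x| := by
    simp [abs_of_pos Real.pi_pos]
  have h2 : ((Real.pi : ℂ) * I * (x : ℂ) ^ 2 * τ + 2 * Real.pi * I * x * v).re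
      = -Real.pi * x ^ 2 * τ.im - 2 * Real.pi * x * v.im := by
    have : (Real.pi : ℂ) * I * (x : ℂ) ^ 2 * τ + 2 * Real.pi * I * x * v
      = ((Real.pi * x ^ 2 : ℝ) : ℂ) * (τ * I) + ((2 * Real.pi * x : ℝ) : ℂ) * (v * I) := by
      push_cast; ring
    rw [this, add_re, re_ofReal_mul, re_ofReal_mul, mul_I_re, mul_I_re]; ring
  rw [h1, h2, mul_pow, mul_mul_mul_comm ((2 * Real.pi) ^ m), ← Real.exp_add]
  gcongr
  have h3 : -(x * v.im) ≤ |x| * S := by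
    calc -(x * v.im) ≤ |x * v.im| := neg_le_abs _
      _ = |x| * |v.im| := abs_mul _ _
      _ ≤ |x| * S := by gcongr
  have h4 : x ^ 2 * T ≤ x ^ 2 * τ.im := by gcongr
  -- Completing the square: the term linear in x is absorbed by half of the Gaussian decay. This is
  -- why the majorant has T/2 in the exponent and the constant exp(2πS²/T) in front.
  have h5 : 2 * |x| * S ≤ 2 * S ^ 2 / T + x ^ 2 * T / 2 := by
    have : 2 * S ^ 2 / T + x ^ 2 * T / 2 - 2 * |x| * S = (2 * S - |x| * T) ^ 2 / (2 * T) := by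
      rw [← sq_abs x]; field_simp; ring
    have h6 : 0 ≤ (2 * S - |x| * T) ^ 2 / (2 * T) := by positivity
    linarith
  have h7 : -Real.pi * x ^ 2 * τ.im - 2 * Real.pi * x * v.im
      = Real.pi * (-(x ^ 2 * τ.im) + 2 * (-(x * v.im))) := by ring
  have h8 : 2 * Real.pi * S ^ 2 / T + -Real.pi * x ^ 2 * (T / 2)
      = Real.pi * (2 * S ^ 2 / T - x ^ 2 * T / 2) := by ring
  rw [h7, h8]
  gcongr
  linarith

lemma summable_thetaDerivBound (m : ℕ) (a S : ℝ) {T : ℝ} (hT : 0 < T) :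
    Summable (thetaDerivBound m a S T) :=
  (HurwitzKernelBounds.summable_f_int m a (half_pos hT)).mul_left _

lemma summable_thetaDerivTerm (m : ℕ) (a : ℝ) (v : ℂ) {τ : ℂ} (hτ : 0 < τ.im) :
    Summable fun k : ℤ => thetaDerivTerm m a k v τ :=
  .of_norm_bounded (summable_thetaDerivBound m a _ hτ)
    (norm_thetaDerivTerm_le m a hτ le_rfl le_rfl)

lemma summable_norm_thetaDerivTerm (m : ℕ) (a : ℝ) (v : ℂ) {τ : ℂ} (hτ : 0 < τ.im) :
    Summable fun k : ℤ => ‖thetaDerivTerm m a k v τ‖ :=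
  (summable_thetaDerivTerm m a v hτ).norm

lemma hasDerivAt_thetaDeriv_fst (m : ℕ) (a : ℝ) (v : ℂ) {τ : ℂ} (hτ : 0 < τ.im) :
    HasDerivAt (fun v => thetaDeriv m a v τ) (thetaDeriv (m + 1) a v τ) v := by
  set t : Set ℂ := im ⁻¹' Metric.ball (0 : ℝ) (|v.im| + 1)
  have ht : IsOpen t := Metric.isOpen_ball.preimage continuous_im
  have ht' : IsPreconnected t :=
    ((convex_ball (0 : ℝ) _).is_linear_preimage imLm.isLinear).isPreconnected
  have hv : v ∈ t := by simp [t]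
  refine hasDerivAt_tsum_of_isPreconnected
    (g := fun k v => thetaDerivTerm m a k v τ) (g' := fun k v => thetaDerivTerm (m + 1) a k v τ)
    (u := thetaDerivBound (m + 1) a (|v.im| + 1) τ.im) (summable_thetaDerivBound _ _ _ hτ) ht ht' (fun k y _ => ?_) (fun k y hy => ?_) hv
    (summable_thetaDerivTerm m a v hτ) hv
  · have h : HasDerivAt (fun y : ℂ => (Real.pi : ℂ) * I * (k + a) ^ 2 * τ +
        2 * Real.pi * I * (k + a) * y) (2 * Real.pi * I * (k + a)) y := by
      simpa using ((hasDerivAt_id y).const_mul (2 * (Real.pi : ℂ) * I * (k + a))).const_add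
        ((Real.pi : ℂ) * I * (k + a) ^ 2 * τ)
    refine (h.cexp.const_mul ((2 * (Real.pi : ℂ) * I * (k + a)) ^ m)).congr_deriv ?_
    simp only [thetaDerivTerm]; ring
  · refine norm_thetaDerivTerm_le (m + 1) a hτ (S := |v.im| + 1) ?_ le_rfl k
    have : |y.im| < |v.im| + 1 := by simpa [t] using hy
    exact this.le

/-- The heat equation: in each summand a τ-derivative brings down πi(k+a)², which is (2πi(k+a))²
divided by 4πi. -/
lemma hasDerivAt_thetaDeriv_snd (m : ℕ) (a : ℝ) (v : ℂ) {τ : ℂ} (hτ : 0 < τ.im) :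
    HasDerivAt (fun τ => thetaDeriv m a v τ)
      (thetaDeriv (m + 2) a v τ / (4 * Real.pi * I)) τ := by
  set t : Set ℂ := {z | τ.im / 2 < z.im}
  have ht : IsOpen t := isOpen_lt continuous_const continuous_im
  have ht' : IsPreconnected t := (convex_halfSpace_im_gt (τ.im / 2)).isPreconnected
  have hv : τ ∈ t := by simp [t, hτ]
  rw [thetaDeriv, ← tsum_div_const]
  refine hasDerivAt_tsum_of_isPreconnected
    (g := fun k τ => thetaDerivTerm m a k v τ)
    (g' := fun k τ => thetaDerivTerm (m + 2) a k v τ / (4 * Real.pi * I))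
    (u := fun k => thetaDerivBound (m + 2) a |v.im| (τ.im / 2) k / (4 * Real.pi))
    ((summable_thetaDerivBound (m + 2) a _ (half_pos hτ)).div_const _) ht ht'
    (fun k y _ => ?_) (fun k y hy => ?_) hv (summable_thetaDerivTerm m a v hτ) hv
  · have h : HasDerivAt (fun y : ℂ => (Real.pi : ℂ) * I * (k + a) ^ 2 * y +
        2 * Real.pi * I * (k + a) * v) (Real.pi * I * (k + a) ^ 2) y := by
      simpa using ((hasDerivAt_id y).const_mul ((Real.pi : ℂ) * I * (k + a) ^ 2)).add_const
        (2 * (Real.pi : ℂ) * I * (k + a) * v)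
    refine (h.cexp.const_mul ((2 * (Real.pi : ℂ) * I * (k + a)) ^ m)).congr_deriv ?_
    have hpi : (Real.pi : ℂ) ≠ 0 := by exact_mod_cast Real.pi_ne_zero
    simp only [thetaDerivTerm]; field_simp [I_ne_zero]; ring
  · rw [norm_div, show ‖4 * (Real.pi : ℂ) * I‖ = 4 * Real.pi by simp [abs_of_pos Real.pi_pos]]
    have hy' : τ.im / 2 ≤ y.im := le_of_lt hy
    gcongr
    exact norm_thetaDerivTerm_le (m + 2) a (half_pos hτ) le_rfl hy' k

/-- The reflection k ↦ -n - k turns k + a into its negative exactly because n = 2a. -/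
lemma thetaDeriv_neg (m : ℕ) (a : ℝ) (n : ℤ) (ha : 2 * a = n) (v τ : ℂ) :
    thetaDeriv m a (-v) τ = (-1) ^ m * thetaDeriv m a v τ := by
  have ha' : 2 * (a : ℂ) = n := by exact_mod_cast ha
  rw [thetaDeriv, thetaDeriv, ← tsum_mul_left, ← (Equiv.subLeft (-n)).tsum_eq]
  refine tsum_congr fun k => ?_
  have h : (((-n - k : ℤ) : ℂ) + a) = -((k : ℂ) + a) := by push_cast; rw [← ha']; ring
  simp only [thetaDerivTerm, Equiv.subLeft_apply, h]
  rw [show 2 * (Real.pi : ℂ) * I * -((k : ℂ) + a) = (-1) * (2 * Real.pi * I * (k + a)) by ring,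
    mul_pow, mul_assoc]
  ring_nf

/-! ### The four theta functions: half-period shifts, parity, quasi-periods -/

lemma theta2_eq_thetaDeriv (v τ : ℂ) : theta2 v τ = thetaDeriv 0 (1 / 2) v τ := by
  refine tsum_congr fun k => ?_
  rw [thetaDerivTerm, ← exp_add, pow_zero, one_mul]
  push_cast; ring_nf

lemma theta3_eq_thetaDeriv (v τ : ℂ) : theta3 v τ = thetaDeriv 0 0 v τ := by
  refine tsum_congr fun k => ?_
  rw [thetaDerivTerm, ← exp_add, pow_zero, one_mul]
  push_cast; ring_nf

lemma exp_int_mul_pi_mul_I (k : ℤ) : exp (k * (Real.pi * I)) = (-1) ^ k := by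
  rw [exp_int_mul, exp_pi_mul_I]

lemma exp_pi_mul_I_div_two : exp (Real.pi * I / 2) = I := by
  rw [show (Real.pi : ℂ) * I / 2 = (Real.pi / 2 : ℂ) * I by ring, exp_mul_I]
  simp

lemma theta3_add_half (v τ : ℂ) : theta3 (v + 1 / 2) τ = theta4 v τ := by
  refine tsum_congr fun k => ?_
  rw [← exp_int_mul_pi_mul_I, ← exp_add, ← exp_add, ← exp_add]
  ring_nf

lemma theta2_add_half (v τ : ℂ) : theta2 (v + 1 / 2) τ = -theta1 v τ := by
  rw [theta1, neg_mul, neg_neg, ← tsum_mul_left]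
  refine tsum_congr fun k => ?_
  have : I = exp (Real.pi * I / 2) := exp_pi_mul_I_div_two.symm
  rw [← exp_int_mul_pi_mul_I]
  conv_rhs => rw [show ∀ x : ℂ, I * x = exp (Real.pi * I / 2) * x by intro x; rw [← this]]
  rw [← exp_add, ← exp_add, ← exp_add, ← exp_add]
  ring_nf

lemma theta3_add_one (v τ : ℂ) : theta3 (v + 1) τ = theta3 v τ := by
  refine tsum_congr fun k => ?_
  rw [show 2 * (k : ℂ) * Real.pi * I * (v + 1) = 2 * k * Real.pi * I * v + k * (2 * Real.pi * I)
    by ring, exp_add _ ((k : ℂ) * _), exp_int_mul, exp_two_pi_mul_I, one_zpow, mul_one]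

lemma theta2_add_one (v τ : ℂ) : theta2 (v + 1) τ = -theta2 v τ := by
  rw [theta2, theta2, ← tsum_neg]
  refine tsum_congr fun k => ?_
  rw [show (2 * (k : ℂ) + 1) * Real.pi * I * (v + 1)
      = (2 * k + 1) * Real.pi * I * v + (k * (2 * Real.pi * I) + Real.pi * I) by ring,
    exp_add _ ((k : ℂ) * _ + _), exp_add, exp_int_mul, exp_two_pi_mul_I, one_zpow, exp_pi_mul_I]
  ring

lemma theta1_add_half (v τ : ℂ) : theta1 (v + 1 / 2) τ = theta2 v τ := by
  have h := theta2_add_half (v + 1 / 2) τ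
  rw [add_assoc, add_halves, theta2_add_one] at h
  exact (neg_injective h).symm

lemma theta4_add_half (v τ : ℂ) : theta4 (v + 1 / 2) τ = theta3 v τ := by
  rw [← theta3_add_half, add_assoc, add_halves, theta3_add_one]

lemma theta1_add_one (v τ : ℂ) : theta1 (v + 1) τ = -theta1 v τ := by
  rw [show v + 1 = v + 1 / 2 + 1 / 2 by ring, theta1_add_half, theta2_add_half]

lemma theta4_add_one (v τ : ℂ) : theta4 (v + 1) τ = theta4 v τ := by
  rw [← theta3_add_half, ← theta3_add_half, ← theta3_add_one (v + 1 / 2)]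
  ring_nf

/-- The quasi-period factor `exp(-πiτ/4 - πiv)`. -/
def halfPeriodFactor (v τ : ℂ) : ℂ := exp (-(Real.pi * I * τ / 4) - Real.pi * I * v)

lemma halfPeriodFactor_ne_zero (v τ : ℂ) : halfPeriodFactor v τ ≠ 0 := exp_ne_zero _

lemma halfPeriodFactor_add_half (v τ : ℂ) :
    halfPeriodFactor (v + 1 / 2) τ = -I * halfPeriodFactor v τ := by
  have h : -I = exp (-(Real.pi * I / 2)) := by
    rw [exp_neg, exp_pi_mul_I_div_two, inv_I]
  rw [h, halfPeriodFactor, halfPeriodFactor, ← exp_add]; ring_nf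

lemma theta3_add_half_period (v τ : ℂ) :
    theta3 (v + τ / 2) τ = halfPeriodFactor v τ * theta2 v τ := by
  rw [theta3, theta2, ← tsum_mul_left]
  refine tsum_congr fun k => ?_
  rw [halfPeriodFactor, ← exp_add, ← exp_add, ← exp_add]; ring_nf

lemma theta2_add_half_period (v τ : ℂ) :
    theta2 (v + τ / 2) τ = halfPeriodFactor v τ * theta3 v τ := by
  -- Since (k+1/2)² + (k+1/2) = (k+1)² - 1/4, the k-th term on the left matches the term of index
  -- k+1 on the right.
  rw [theta3, theta2, ← tsum_mul_left, ← (Equiv.addRight (1 : ℤ)).tsum_eq (fun k : ℤ =>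
    halfPeriodFactor v τ * _)]
  refine tsum_congr fun k => ?_
  rw [halfPeriodFactor, ← exp_add, ← exp_add, ← exp_add, Equiv.coe_addRight]; push_cast; ring_nf

lemma theta4_add_half_period (v τ : ℂ) :
    theta4 (v + τ / 2) τ = I * halfPeriodFactor v τ * theta1 v τ := by
  rw [← theta3_add_half, show v + τ / 2 + 1 / 2 = v + 1 / 2 + τ / 2 by ring,
    theta3_add_half_period, halfPeriodFactor_add_half, theta2_add_half]; ring

lemma theta1_add_half_period (v τ : ℂ) :
    theta1 (v + τ / 2) τ = I * halfPeriodFactor v τ * theta4 v τ := by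
  rw [← neg_eq_iff_eq_neg.2 (theta2_add_half _ τ), show v + τ / 2 + 1 / 2 = v + 1 / 2 + τ / 2 by ring,
    theta2_add_half_period, halfPeriodFactor_add_half, theta3_add_half]; ring

lemma theta3_neg (v τ : ℂ) : theta3 (-v) τ = theta3 v τ := by
  rw [theta3_eq_thetaDeriv, theta3_eq_thetaDeriv, thetaDeriv_neg 0 0 0 (by simp)]; simp

lemma theta2_neg (v τ : ℂ) : theta2 (-v) τ = theta2 v τ := by
  rw [theta2_eq_thetaDeriv, theta2_eq_thetaDeriv, thetaDeriv_neg 0 (1 / 2) 1 (by simp)]; simp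

lemma theta4_neg (v τ : ℂ) : theta4 (-v) τ = theta4 v τ := by
  rw [← theta3_add_half, ← theta3_neg, ← theta3_add_half, ← theta3_add_one]; ring_nf

lemma theta1_neg (v τ : ℂ) : theta1 (-v) τ = -theta1 v τ := by
  rw [← theta2_add_half, ← neg_eq_iff_eq_neg.2 (theta2_add_half (-v) τ), ← theta2_neg,
    ← theta2_add_one]; ring_nf

lemma theta1_zero (τ : ℂ) : theta1 0 τ = 0 := by
  have h := theta1_neg 0 τ
  rw [neg_zero] at h
  linear_combination h / 2

/-- The quasi-period factor of the full period `τ`. -/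
def periodFactor (v τ : ℂ) : ℂ := exp (-(Real.pi * I * τ) - 2 * Real.pi * I * v)

lemma periodFactor_ne_zero (v τ : ℂ) : periodFactor v τ ≠ 0 := exp_ne_zero _

lemma halfPeriodFactor_mul (v τ : ℂ) :
    halfPeriodFactor (v + τ / 2) τ * halfPeriodFactor v τ = periodFactor v τ := by
  rw [halfPeriodFactor, halfPeriodFactor, periodFactor, ← exp_add]; ring_nf

lemma theta3_add_period (v τ : ℂ) : theta3 (v + τ) τ = periodFactor v τ * theta3 v τ := by
  rw [← halfPeriodFactor_mul, mul_assoc, ← theta2_add_half_period, ← theta3_add_half_period]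
  ring_nf

lemma theta2_add_period (v τ : ℂ) : theta2 (v + τ) τ = periodFactor v τ * theta2 v τ := by
  rw [← halfPeriodFactor_mul, mul_assoc, ← theta3_add_half_period, ← theta2_add_half_period]
  ring_nf

lemma theta4_add_period (v τ : ℂ) : theta4 (v + τ) τ = -periodFactor v τ * theta4 v τ := by
  rw [show v + τ = v + τ / 2 + τ / 2 by ring, theta4_add_half_period, theta1_add_half_period,
    ← halfPeriodFactor_mul]
  linear_combination (halfPeriodFactor (v + τ / 2) τ * halfPeriodFactor v τ * theta4 v τ) * I_mul_I

lemma theta1_add_period (v τ : ℂ) : theta1 (v + τ) τ = -periodFactor v τ * theta1 v τ := by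
  rw [show v + τ = v + τ / 2 + τ / 2 by ring, theta1_add_half_period, theta4_add_half_period,
    ← halfPeriodFactor_mul]
  linear_combination (halfPeriodFactor (v + τ / 2) τ * halfPeriodFactor v τ * theta1 v τ) * I_mul_I

lemma differentiable_theta3 {τ : ℂ} (hτ : 0 < τ.im) : Differentiable ℂ fun v => theta3 v τ := by
  simp only [theta3_eq_thetaDeriv]
  exact fun v => (hasDerivAt_thetaDeriv_fst 0 0 v hτ).differentiableAt

lemma differentiable_theta2 {τ : ℂ} (hτ : 0 < τ.im) : Differentiable ℂ fun v => theta2 v τ := by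
  simp only [theta2_eq_thetaDeriv]
  exact fun v => (hasDerivAt_thetaDeriv_fst 0 _ v hτ).differentiableAt

lemma differentiable_theta4 {τ : ℂ} (hτ : 0 < τ.im) : Differentiable ℂ fun v => theta4 v τ := by
  simp only [← theta3_add_half]
  exact (differentiable_theta3 hτ).comp (differentiable_id.add_const _)

lemma differentiable_theta1 {τ : ℂ} (hτ : 0 < τ.im) : Differentiable ℂ fun v => theta1 v τ := by
  simp only [← neg_eq_iff_eq_neg.2 (theta2_add_half _ τ)]
  exact ((differentiable_theta2 hτ).comp (differentiable_id.add_const _)).neg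

/-! ### Quasi-periodic entire functions and their Fourier coefficients -/

/-- The `n`-th Fourier coefficient of a `1`-periodic function of a complex variable. -/
def periodCoeff (f : ℂ → ℂ) (n : ℤ) : ℂ :=
  ∫ x in (0 : ℝ)..1, exp (-(2 * Real.pi * I * n * x)) * f x

/-- Moving the contour: for a primitive G, the integral over the translated segment is G(1+w) -
G(w), and its w-derivative f(1+w) - f(w) vanishes by periodicity. -/
lemma intervalIntegral_add_eq_of_periodic {f : ℂ → ℂ} (hf : Differentiable ℂ f)
    (h1 : ∀ v, f (v + 1) = f v) (w : ℂ) :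
    ∫ x in (0 : ℝ)..1, f (x + w) = ∫ x in (0 : ℝ)..1, f x := by
  obtain ⟨G, hG⟩ := hf.isExactOn_univ
  have hG' : ∀ z, HasDerivAt G (f z) z := fun z => hG z (Set.mem_univ z)
  have key : ∀ w : ℂ, ∫ x in (0 : ℝ)..1, f (x + w) = G (1 + w) - G w := by
    intro w
    have hd : ∀ x ∈ Set.uIcc (0 : ℝ) 1, HasDerivAt (fun x : ℝ => G (x + w)) (f (x + w)) x := by
      intro x _
      have := (hG' (x + w)).comp_add_const (x : ℂ) w
      exact this.comp_ofReal
    rw [intervalIntegral.integral_eq_sub_of_hasDerivAt hd]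
    · simp
    · exact (hf.continuous.comp (by fun_prop)).intervalIntegrable _ _
  have hconst : ∀ w, G (1 + w) - G w = G (1 + 0) - G 0 := by
    intro w
    have hd : ∀ w, HasDerivAt (fun w => G (1 + w) - G w) 0 w := by
      intro w
      have := ((hG' (1 + w)).comp_const_add 1 w).sub (hG' w)
      rw [add_comm 1 w, h1, sub_self] at this
      exact this
    exact is_const_of_deriv_eq_zero (fun w => (hd w).differentiableAt) (fun w => (hd w).deriv) w 0
  have h0 := key 0
  simp only [add_zero] at h0
  rw [key, hconst, h0]; simp

/-- The zero Fourier series is summable, so it represents f on the real line; the identity theorem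
then gives f = 0 on the plane. -/
lemma eq_zero_of_periodCoeff_eq_zero {f : ℂ → ℂ} (hf : Differentiable ℂ f)
    (h1 : ∀ v, f (v + 1) = f v) (hc : ∀ n, periodCoeff f n = 0) : f = 0 := by
  have hper : Function.Periodic (fun x : ℝ => f x) 1 := fun x => by simp [h1]
  have hcont : Continuous (fun x : ℝ => f x) := hf.continuous.comp continuous_ofReal
  let F : C(AddCircle (1 : ℝ), ℂ) :=
    ⟨hper.lift, by
      exact continuous_quot_lift _ hcont⟩
  have : Fact ((0 : ℝ) < 1) := ⟨one_pos⟩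
  have hF : ∀ n, fourierCoeff F n = 0 := by
    intro n
    rw [fourierCoeff_eq_intervalIntegral _ n 0, ← hc n, periodCoeff, zero_add, div_one, one_smul]
    refine intervalIntegral.integral_congr fun x _ => ?_
    simp only [fourier_coe_apply, smul_eq_mul]
    congr 1
    push_cast
    ring_nf
  have hsum : Summable (fourierCoeff F) := by
    rw [show fourierCoeff F = fun _ => 0 from funext hF]; exact summable_zero
  have hx : ∀ x : ℝ, f x = 0 := by
    intro x
    have h := has_pointwise_sum_fourier_series_of_summable hsum (x : AddCircle (1 : ℝ))
    simp only [hF, zero_smul] at h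
    exact (h.unique hasSum_zero)
  have hA : AnalyticOnNhd ℂ f Set.univ := fun z _ => hf.analyticAt z
  have hfreq : ∃ᶠ z in 𝓝[≠] (0 : ℂ), f z = 0 := by
    have ht : Filter.Tendsto (fun x : ℝ => (x : ℂ)) (𝓝[≠] 0) (𝓝[≠] 0) := by
      refine tendsto_nhdsWithin_of_tendsto_nhds_of_eventually_within _ ?_ ?_
      · exact (continuous_ofReal.tendsto' 0 0 (by simp)).mono_left nhdsWithin_le_nhds
      · filter_upwards [self_mem_nhdsWithin] with x hx
        simpa using hx
    exact ht.frequently (Filter.Eventually.frequently (.of_forall hx))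
  funext z
  exact hA.eqOn_zero_of_preconnected_of_frequently_eq_zero isPreconnected_univ (Set.mem_univ 0)
    hfreq (Set.mem_univ z)

/-- Entire functions `f` with `f(v + 1) = ε f(v)` and `f(v + τ) = C exp(-2πikv) f(v)`. -/
structure IsThetaFunction (k : ℕ) (ε C τ : ℂ) (f : ℂ → ℂ) : Prop where
  differentiable : Differentiable ℂ f
  add_one : ∀ v, f (v + 1) = ε * f v
  add_period : ∀ v, f (v + τ) = C * exp (-(2 * Real.pi * I * k * v)) * f v

namespace IsThetaFunction

variable {k : ℕ} {ε C τ : ℂ} {f g : ℂ → ℂ}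

lemma add (hf : IsThetaFunction k ε C τ f) (hg : IsThetaFunction k ε C τ g) :
    IsThetaFunction k ε C τ fun v => f v + g v :=
  ⟨hf.1.add hg.1, fun v => by rw [hf.2, hg.2]; ring, fun v => by rw [hf.3, hg.3]; ring⟩

lemma const_mul (c : ℂ) (hf : IsThetaFunction k ε C τ f) :
    IsThetaFunction k ε C τ fun v => c * f v :=
  ⟨hf.1.const_mul c, fun v => by rw [hf.2]; ring, fun v => by rw [hf.3]; ring⟩

/-- Normalises the multiplier of v ↦ v + 1 to 1, so that Fourier coefficients become available. -/
lemma twist (hf : IsThetaFunction k ε C τ f) (hε : ε ≠ 0) :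
    IsThetaFunction k 1 (exp (-(log ε * τ)) * C) τ fun v => exp (-(log ε * v)) * f v := by
  refine ⟨?_, fun v => ?_, fun v => ?_⟩
  · have := hf.1
    fun_prop
  · rw [hf.2, mul_add, mul_one, neg_add, exp_add, exp_neg (log ε), exp_log hε]
    field_simp
  · rw [hf.3, mul_add, neg_add, exp_add]; ring

/-- Moving the contour by τ and using the quasi-period gives a recursion of step k between Fourier
coefficients. -/
lemma periodCoeff_eq (hf : IsThetaFunction k 1 C τ f) (n : ℤ) :
    periodCoeff f n = C * exp (-(2 * Real.pi * I * n * τ)) * periodCoeff f (n + k) := by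
  have hd := hf.1
  have h := intervalIntegral_add_eq_of_periodic (f := fun v => exp (-(2 * Real.pi * I * n * v)) * f v)
    (by fun_prop) (fun v => by
      rw [hf.2, one_mul, show -(2 * (Real.pi : ℂ) * I * n * (v + 1))
        = -(2 * Real.pi * I * n * v) + (-n : ℤ) * (2 * Real.pi * I) by push_cast; ring, exp_add,
        exp_int_mul, exp_two_pi_mul_I, one_zpow, mul_one]) τ
  rw [periodCoeff, ← h, periodCoeff, ← intervalIntegral.integral_const_mul]
  refine intervalIntegral.integral_congr fun x _ => ?_
  rw [hf.3, show -(2 * (Real.pi : ℂ) * I * n * (x + τ)) = -(2 * Real.pi * I * n * x) +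
    -(2 * Real.pi * I * n * τ) by ring, exp_add]
  push_cast
  rw [show -(2 * (Real.pi : ℂ) * I * (n + k) * x) = -(2 * Real.pi * I * n * x) +
    -(2 * Real.pi * I * k * x) by ring, exp_add]
  ring

/-- The recursion factor never vanishes when C ≠ 0, so a zero coefficient propagates in both
directions through its residue class modulo k. -/
lemma eq_zero_of_periodCoeff (hk : 0 < k) (hf : IsThetaFunction k 1 C τ f) (hC : C ≠ 0)
    (h : ∀ j : ℤ, 0 ≤ j → j < k → periodCoeff f j = 0) : f = 0 := by
  refine eq_zero_of_periodCoeff_eq_zero hf.1 (fun v => by rw [hf.2, one_mul]) fun n => ?_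
  have hstep : ∀ n : ℤ, periodCoeff f n = 0 ↔ periodCoeff f (n + k) = 0 := by
    intro n
    rw [hf.periodCoeff_eq n]
    simp [hC, exp_ne_zero]
  have hmul : ∀ (m n : ℤ), periodCoeff f n = 0 ↔ periodCoeff f (n + k * m) = 0 := by
    intro m n
    induction m using Int.induction_on with
    | zero => simp
    | succ i ih => rw [ih, hstep]; ring_nf
    | pred i ih => rw [ih, hstep (n + k * (-i - 1))]; ring_nf
  have hk' : (0 : ℤ) < k := by exact_mod_cast hk
  rw [← Int.emod_add_mul_ediv n k, ← hmul]
  exact h _ (Int.emod_nonneg n hk'.ne') (Int.emod_lt_of_pos n hk')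

lemma _root_.periodCoeff_add_mul (hf : Differentiable ℂ f) (hg : Differentiable ℂ g) (a b : ℂ)
    (n : ℤ) : periodCoeff (fun v => a * f v + b * g v) n
      = a * periodCoeff f n + b * periodCoeff g n := by
  have hfc := hf.continuous
  have hgc := hg.continuous
  rw [periodCoeff, periodCoeff, periodCoeff, ← intervalIntegral.integral_const_mul,
    ← intervalIntegral.integral_const_mul, ← intervalIntegral.integral_add]
  · refine intervalIntegral.integral_congr fun x _ => ?_
    ring
  · exact Continuous.intervalIntegrable (by fun_prop) _ _
  · exact Continuous.intervalIntegrable (by fun_prop) _ _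

/-- Theta functions of degree one are proportional. -/
lemma proportional (hf : IsThetaFunction 1 1 C τ f) (hg : IsThetaFunction 1 1 C τ g) (hC : C ≠ 0)
    (hg0 : g ≠ 0) : ∃ c, ∀ v, f v = c * g v := by
  have hne : periodCoeff g 0 ≠ 0 := by
    intro h
    refine hg0 (hg.eq_zero_of_periodCoeff one_pos hC fun j h0 h1 => ?_)
    obtain rfl : j = 0 := by push_cast at h1; omega
    exact h
  have h := ((hf.const_mul (periodCoeff g 0)).add
    (hg.const_mul (-periodCoeff f 0))).eq_zero_of_periodCoeff one_pos hC fun j h0 h1 => by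
      obtain rfl : j = 0 := by push_cast at h1; omega
      rw [periodCoeff_add_mul hf.1 hg.1]; ring
  refine ⟨periodCoeff f 0 / periodCoeff g 0, fun v => ?_⟩
  have hv := congrFun h v
  simp only [Pi.zero_apply] at hv
  field_simp
  linear_combination hv

/-- The pair of coefficients with indices 0 and 1 determines a function of degree two, so f, f₁, f₂
satisfy the linear relation given by Cramer's rule. Evaluating it at a and b, where the determinant
of f₁, f₂ is nonzero, leaves only the multiple of f. -/
lemma eq_zero_of_two_zeros_aux {f₁ f₂ : ℂ → ℂ} (hf : IsThetaFunction 2 1 C τ f)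
    (hf₁ : IsThetaFunction 2 1 C τ f₁) (hf₂ : IsThetaFunction 2 1 C τ f₂) (hC : C ≠ 0) {a b : ℂ}
    (hdet : f₁ a * f₂ b - f₁ b * f₂ a ≠ 0) (ha : f a = 0) (hb : f b = 0) : f = 0 := by
  have hj : ∀ j : ℤ, 0 ≤ j → j < (2 : ℕ) → j = 0 ∨ j = 1 := fun j h0 h1 => by
    push_cast at h1; omega
  have hindep : ∀ x y : ℂ, (∀ v, x * f₁ v + y * f₂ v = 0) → x = 0 ∧ y = 0 := by
    intro x y h
    have e1 := h a
    have e2 := h b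
    constructor
    · refine (mul_eq_zero.1 ?_).resolve_right hdet
      linear_combination f₂ b * e1 - f₂ a * e2
    · refine (mul_eq_zero.1 ?_).resolve_right hdet
      linear_combination f₁ a * e2 - f₁ b * e1
  have hcomb : ∀ x y : ℂ, (x * periodCoeff f₁ 0 + y * periodCoeff f₂ 0 = 0) →
      (x * periodCoeff f₁ 1 + y * periodCoeff f₂ 1 = 0) → x = 0 ∧ y = 0 := by
    intro x y h0 h1
    refine hindep x y fun v => ?_
    have h := ((hf₁.const_mul x).add (hf₂.const_mul y)).eq_zero_of_periodCoeff two_pos hC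
      fun j h0' h1' => by
        rw [periodCoeff_add_mul hf₁.1 hf₂.1]
        rcases hj j h0' h1' with rfl | rfl
        · exact h0
        · exact h1
    exact congrFun h v
  set x := periodCoeff f₁ 0 * periodCoeff f₂ 1 - periodCoeff f₁ 1 * periodCoeff f₂ 0 with hx
  -- If the coefficient determinant vanished, the combinations in `A` and `B` would be zero, forcing
  -- all four coefficients to vanish. Then f₁ itself would be zero, against `hindep`.
  have hxne : x ≠ 0 := by
    intro h0
    have A := hcomb (periodCoeff f₂ 0) (-periodCoeff f₁ 0) (by ring) (by linear_combination -h0)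
    have B := hcomb (periodCoeff f₂ 1) (-periodCoeff f₁ 1) (by linear_combination h0) (by ring)
    have D := hcomb 1 0 (by linear_combination -A.2) (by linear_combination -B.2)
    exact one_ne_zero D.1
  set y := periodCoeff f₂ 0 * periodCoeff f 1 - periodCoeff f₂ 1 * periodCoeff f 0 with hy
  set z := periodCoeff f 0 * periodCoeff f₁ 1 - periodCoeff f 1 * periodCoeff f₁ 0 with hz
  have h := ((hf.const_mul x).add (((hf₁.const_mul y).add (hf₂.const_mul z)).const_mul 1)
    ).eq_zero_of_periodCoeff two_pos hC fun j h0' h1' => by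
      rw [periodCoeff_add_mul hf.1 ((hf₁.const_mul y).add (hf₂.const_mul z)).1,
        periodCoeff_add_mul hf₁.1 hf₂.1]
      rcases hj j h0' h1' with rfl | rfl
      · simp only [hx, hy, hz]; ring
      · simp only [hx, hy, hz]; ring
  have hv : ∀ v, x * f v + (y * f₁ v + z * f₂ v) = 0 := fun v => by
    have := congrFun h v
    simpa using this
  have e1 := hv a
  have e2 := hv b
  rw [ha] at e1
  rw [hb] at e2
  have hy0 : y = 0 := by
    refine (mul_eq_zero.1 ?_).resolve_right hdet
    linear_combination f₂ b * e1 - f₂ a * e2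
  have hz0 : z = 0 := by
    refine (mul_eq_zero.1 ?_).resolve_right hdet
    linear_combination f₁ a * e2 - f₁ b * e1
  funext v
  have := hv v
  rw [hy0, hz0] at this
  simpa [hxne] using this

/-- A theta function of degree two is determined by its values at two points which separate the
space of such functions. -/
lemma eq_zero_of_two_zeros {f₁ f₂ : ℂ → ℂ} (hε : ε ≠ 0) (hC : C ≠ 0)
    (hf : IsThetaFunction 2 ε C τ f) (hf₁ : IsThetaFunction 2 ε C τ f₁)
    (hf₂ : IsThetaFunction 2 ε C τ f₂) (a b : ℂ)
    (hdet : f₁ a * f₂ b - f₁ b * f₂ a ≠ 0) (ha : f a = 0) (hb : f b = 0) (v : ℂ) : f v = 0 := by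
  have h := eq_zero_of_two_zeros_aux (hf.twist hε) (hf₁.twist hε) (hf₂.twist hε)
    (mul_ne_zero (exp_ne_zero _) hC) (a := a) (b := b) (by
      have : exp (-(log ε * a)) * exp (-(log ε * b)) * (f₁ a * f₂ b - f₁ b * f₂ a) ≠ 0 :=
        mul_ne_zero (mul_ne_zero (exp_ne_zero _) (exp_ne_zero _)) hdet
      intro h0
      exact this (by linear_combination h0)) (by simp [ha]) (by simp [hb])
  simpa [exp_ne_zero] using congrFun h v

end IsThetaFunction

/-! ### Jacobi's product and the zeros of the theta functions -/

/-- The product `∏ (1 + q^(2n+1) w)`. -/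
def oddProduct (q w : ℂ) : ℂ := ∏' n : ℕ, (1 + q ^ (2 * n + 1) * w)

lemma summable_norm_odd_pow {q : ℂ} (hq : ‖q‖ < 1) (w : ℂ) :
    Summable fun n : ℕ => ‖q ^ (2 * n + 1) * w‖ := by
  have h := (summable_geometric_of_lt_one (norm_nonneg q) hq).comp_injective
    (i := fun n : ℕ => 2 * n + 1) (fun a b h => by simpa using h)
  refine (h.mul_right ‖w‖).congr fun n => ?_
  simp

lemma oddProduct_ne_zero {q w : ℂ} (hq : ‖q‖ < 1) (h : ∀ n : ℕ, 1 + q ^ (2 * n + 1) * w ≠ 0) :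
    oddProduct q w ≠ 0 :=
  tprod_one_add_ne_zero_of_summable h (summable_norm_odd_pow hq w)

lemma oddProduct_eq {q : ℂ} (hq : ‖q‖ < 1) (w : ℂ) :
    oddProduct q w = (1 + q * w) * oddProduct q (q ^ 2 * w) := by
  have hm : ∀ n : ℕ, 1 + q ^ (2 * (n + 1) + 1) * w = 1 + q ^ (2 * n + 1) * (q ^ 2 * w) := by
    intro n; ring
  rw [oddProduct, tprod_eq_zero_mul' (f := fun n : ℕ => 1 + q ^ (2 * n + 1) * w)]
  · simp only [hm]; simp [oddProduct]
  · simp only [hm]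
    exact multipliable_one_add_of_summable (summable_norm_odd_pow hq _)

lemma differentiable_oddProduct {q : ℂ} (hq : ‖q‖ < 1) : Differentiable ℂ (oddProduct q) := by
  have h : HasProdLocallyUniformlyOn (fun (n : ℕ) (w : ℂ) => 1 + q ^ (2 * n + 1) * w)
      (oddProduct q) Set.univ := by
    refine hasProdLocallyUniformlyOn_of_forall_compact isOpen_univ fun K _ hK => ?_
    obtain ⟨R, hR⟩ := hK.isBounded.exists_norm_le
    refine (summable_norm_odd_pow hq (R : ℂ)).hasProdUniformlyOn_nat_one_add hK
      (.of_forall fun n w hw => ?_) (fun _ => by fun_prop)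
    have : ‖w‖ ≤ ‖(R : ℂ)‖ := (hR w hw).trans (by simpa using le_abs_self R)
    rw [norm_mul, norm_mul]
    gcongr
  have hd := h.differentiableOn (.of_forall fun s => by
    simpa [Finset.prod_fn] using DifferentiableOn.finsetProd (fun _ _ => by fun_prop)) isOpen_univ
  exact differentiableOn_univ.1 hd

/-- Jacobi's product, up to a factor independent of `v`. -/
def jacobiProduct (τ v : ℂ) : ℂ :=
  oddProduct (exp (Real.pi * I * τ)) (exp (2 * Real.pi * I * v)) *
    oddProduct (exp (Real.pi * I * τ)) (exp (-(2 * Real.pi * I * v)))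

lemma norm_exp_pi_mul_I_lt_one {τ : ℂ} (hτ : 0 < τ.im) : ‖exp (Real.pi * I * τ)‖ < 1 := by
  rw [norm_exp, Real.exp_lt_one_iff]
  simp
  positivity

/-- Under v ↦ v + τ one of the two infinite products loses its first factor and the other gains one.
The quotient of these two factors is the multiplier of θ₃. -/
lemma isThetaFunction_jacobiProduct {τ : ℂ} (hτ : 0 < τ.im) :
    IsThetaFunction 1 1 (exp (-(Real.pi * I * τ))) τ (jacobiProduct τ) := by
  have hq := norm_exp_pi_mul_I_lt_one hτ
  have hd := differentiable_oddProduct hq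
  refine ⟨?_, fun v => ?_, fun v => ?_⟩
  · unfold jacobiProduct
    fun_prop
  · have h1 : exp (2 * Real.pi * I * (v + 1)) = exp (2 * Real.pi * I * v) := by
      rw [mul_add, mul_one, exp_add, exp_two_pi_mul_I, mul_one]
    rw [jacobiProduct, jacobiProduct, exp_neg, exp_neg, h1, one_mul]
  · rw [jacobiProduct, jacobiProduct]
    set q := exp (Real.pi * I * τ) with hqdef
    set z := exp (2 * Real.pi * I * v) with hz
    have h1 : exp (2 * Real.pi * I * (v + τ)) = q ^ 2 * z := by
      rw [hqdef, hz, ← exp_nat_mul, ← exp_add]; push_cast; ring_nf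
    have h2 : exp (-(2 * Real.pi * I * v)) = q ^ 2 * exp (-(2 * Real.pi * I * (v + τ))) := by
      rw [hqdef, ← exp_nat_mul, ← exp_add]; push_cast; ring_nf
    have h3 : exp (-(Real.pi * I * τ)) * exp (-(2 * Real.pi * I * (1 : ℕ) * v)) *
        (1 + q * z) = 1 + q * exp (-(2 * Real.pi * I * (v + τ))) := by
      have e1 : exp (-(Real.pi * I * τ)) * exp (-(2 * Real.pi * I * (1 : ℕ) * v)) * (q * z) = 1 := by
        rw [hqdef, hz, ← exp_add, ← exp_add, ← exp_add, ← exp_zero]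
        congr 1
        push_cast
        ring
      have e2 : exp (-(Real.pi * I * τ)) * exp (-(2 * Real.pi * I * (1 : ℕ) * v))
          = q * exp (-(2 * Real.pi * I * (v + τ))) := by
        rw [hqdef, ← exp_add, ← exp_add]
        push_cast
        ring_nf
      rw [mul_add, e1, mul_one, e2, add_comm]
    rw [oddProduct_eq hq z, oddProduct_eq hq (exp (-(2 * Real.pi * I * (v + τ)))), h1, ← h2, ← h3]
    ring

lemma isThetaFunction_theta3 {τ : ℂ} (hτ : 0 < τ.im) :
    IsThetaFunction 1 1 (exp (-(Real.pi * I * τ))) τ fun v => theta3 v τ := by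
  refine ⟨differentiable_theta3 hτ, fun v => by rw [theta3_add_one, one_mul], fun v => ?_⟩
  rw [theta3_add_period, periodFactor, ← exp_add]
  push_cast
  ring_nf

/-- Termwise integration leaves only the summand k = 0. Its purpose is to show that θ₃ is not
identically zero. -/
lemma periodCoeff_theta3 {τ : ℂ} (hτ : 0 < τ.im) : periodCoeff (fun v => theta3 v τ) 0 = 1 := by
  have hval : ∀ k : ℤ, ∫ x in (0 : ℝ)..1, thetaDerivTerm 0 0 k x τ = if k = 0 then 1 else 0 := by
    intro k
    split_ifs with hk
    · simp [hk, thetaDerivTerm]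
    · have hk' : 2 * (Real.pi : ℂ) * I * k ≠ 0 := by
        simp [hk, Real.pi_ne_zero, I_ne_zero]
      have : ∀ x : ℝ, thetaDerivTerm 0 0 k x τ
          = exp (Real.pi * I * k ^ 2 * τ) * exp (2 * Real.pi * I * k * x) := by
        intro x; simp [thetaDerivTerm, exp_add]
      simp only [this]
      rw [intervalIntegral.integral_const_mul, integral_exp_mul_complex hk']
      rw [ofReal_one, mul_one, ofReal_zero, mul_zero, exp_zero,
        show 2 * (Real.pi : ℂ) * I * k = k * (2 * Real.pi * I) by ring, exp_int_mul,
        exp_two_pi_mul_I, one_zpow]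
      simp
  have hnorm : ∀ (k : ℤ) (x : ℝ), ‖thetaDerivTerm 0 0 k x τ‖ = ‖thetaDerivTerm 0 0 k 0 τ‖ := by
    intro k x
    simp [thetaDerivTerm, norm_exp]
  have h := intervalIntegral.hasSum_integral_of_dominated_convergence
    (μ := MeasureTheory.volume) (a := 0) (b := 1)
    (F := fun (k : ℤ) (x : ℝ) => thetaDerivTerm 0 0 k x τ)
    (f := fun x : ℝ => theta3 x τ) (fun k _ => ‖thetaDerivTerm 0 0 k 0 τ‖)
    (fun k => Continuous.aestronglyMeasurable (by unfold thetaDerivTerm; fun_prop))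
    (fun k => .of_forall fun x _ => (hnorm k x).le)
    (.of_forall fun _ _ => summable_norm_thetaDerivTerm 0 0 0 hτ)
    (by simp)
    (.of_forall fun x _ => by
      rw [theta3_eq_thetaDeriv]; exact (summable_thetaDerivTerm 0 0 x hτ).hasSum)
  simp only [hval] at h
  rw [periodCoeff]
  simp only [Int.cast_zero, mul_zero, zero_mul, neg_zero, exp_zero, one_mul]
  exact h.unique (hasSum_ite_eq 0 1)

/-- The product is a constant multiple of θ₃, so it vanishes wherever θ₃ does. A convergent product
vanishes only if a factor 1 + q^(2n+1)e^(±2πiv) does. The constant need not be known to be nonzero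
for this direction. -/
lemma theta3_eq_zero_exists {τ v : ℂ} (hτ : 0 < τ.im) (h : theta3 v τ = 0) :
    ∃ m n : ℤ, v = (1 + τ) / 2 + m + n * τ := by
  have hq := norm_exp_pi_mul_I_lt_one hτ
  obtain ⟨c, hc⟩ := (isThetaFunction_jacobiProduct hτ).proportional (isThetaFunction_theta3 hτ)
    (exp_ne_zero _) (fun h0 => by
      have := periodCoeff_theta3 hτ
      rw [h0] at this
      simp [periodCoeff] at this)
  have hpi : (Real.pi : ℂ) * I ≠ 0 := mul_ne_zero (by exact_mod_cast Real.pi_ne_zero) I_ne_zero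
  have hP := hc v
  rw [h, mul_zero, jacobiProduct] at hP
  have hfac : ∀ w : ℂ, oddProduct (exp (Real.pi * I * τ)) (exp (2 * Real.pi * I * w)) = 0 →
      ∃ (n : ℕ) (m : ℤ), (2 * n + 1) * τ + 2 * w = 1 + 2 * m := by
    intro w hw
    by_contra! hne
    refine oddProduct_ne_zero hq (fun n h0 => ?_) hw
    have h1 : exp (Real.pi * I * ((2 * n + 1) * τ + 2 * w)) = exp (Real.pi * I) := by
      rw [exp_pi_mul_I, eq_neg_iff_add_eq_zero, add_comm, ← h0, ← exp_nat_mul, ← exp_add]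
      push_cast
      ring_nf
    obtain ⟨m, hm⟩ := exp_eq_exp_iff_exists_int.1 h1
    refine hne n m (mul_left_cancel₀ hpi ?_)
    rw [hm]; ring
  rcases mul_eq_zero.1 hP with h | h
  · obtain ⟨n, m, hnm⟩ := hfac v h
    -- From (2n+1)τ + 2v = 1 + 2m, measured from the centre (1+τ)/2 rather than from 1/2; hence the
    -- shift by one in n.
    refine ⟨m, -n - 1, ?_⟩
    push_cast
    linear_combination hnm / 2
  · rw [← mul_neg] at h
    obtain ⟨n, m, hnm⟩ := hfac (-v) h
    refine ⟨-m - 1, n, ?_⟩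
    push_cast
    linear_combination -hnm / 2

lemma theta3_add_lattice_eq_zero {τ v : ℂ} (h : theta3 v τ = 0) (m n : ℤ) :
    theta3 (v + m + n * τ) τ = 0 := by
  have h1 : ∀ v, theta3 v τ = 0 ↔ theta3 (v + 1) τ = 0 := fun v => by rw [theta3_add_one]
  have h2 : ∀ v, theta3 v τ = 0 ↔ theta3 (v + τ) τ = 0 := fun v => by
    rw [theta3_add_period]; simp [periodFactor_ne_zero]
  have h3 : theta3 (v + m) τ = 0 := by
    induction m using Int.induction_on with
    | zero => simpa using h
    | succ i ih => rw [h1] at ih; rw [← ih]; push_cast; ring_nf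
    | pred i ih => rw [h1, ← ih]; push_cast; ring_nf
  induction n using Int.induction_on with
  | zero => simpa using h3
  | succ i ih => rw [h2] at ih; rw [← ih]; push_cast; ring_nf
  | pred i ih => rw [h2, ← ih]; push_cast; ring_nf

lemma theta3_half_add_half_period_eq_zero (τ : ℂ) : theta3 ((1 + τ) / 2) τ = 0 := by
  rw [show (1 + τ) / 2 = (0 + τ / 2) + 1 / 2 by ring, theta3_add_half, theta4_add_half_period,
    theta1_zero, mul_zero]

lemma theta3_eq_zero_iff {τ v : ℂ} (hτ : 0 < τ.im) :
    theta3 v τ = 0 ↔ ∃ m n : ℤ, v = (1 + τ) / 2 + m + n * τ := by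
  refine ⟨theta3_eq_zero_exists hτ, ?_⟩
  rintro ⟨m, n, rfl⟩
  exact theta3_add_lattice_eq_zero (theta3_half_add_half_period_eq_zero τ) m n

lemma theta2_eq_zero_iff {τ v : ℂ} (hτ : 0 < τ.im) :
    theta2 v τ = 0 ↔ ∃ m n : ℤ, v = 1 / 2 + m + n * τ := by
  have : theta2 v τ = 0 ↔ theta3 (v + τ / 2) τ = 0 := by
    rw [theta3_add_half_period]; simp [halfPeriodFactor_ne_zero]
  rw [this, theta3_eq_zero_iff hτ]
  refine exists_congr fun m => exists_congr fun n => ?_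
  constructor <;> intro h <;> linear_combination h

lemma theta4_eq_zero_iff {τ v : ℂ} (hτ : 0 < τ.im) :
    theta4 v τ = 0 ↔ ∃ m n : ℤ, v = τ / 2 + m + n * τ := by
  rw [← theta3_add_half, theta3_eq_zero_iff hτ]
  refine exists_congr fun m => exists_congr fun n => ?_
  constructor <;> intro h <;> linear_combination h

lemma theta1_eq_zero_iff {τ v : ℂ} (hτ : 0 < τ.im) :
    theta1 v τ = 0 ↔ ∃ m n : ℤ, v = m + n * τ := by
  have : theta1 v τ = 0 ↔ theta4 (v + τ / 2) τ = 0 := by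
    rw [theta4_add_half_period]; simp [halfPeriodFactor_ne_zero]
  rw [this, theta4_eq_zero_iff hτ]
  refine exists_congr fun m => exists_congr fun n => ?_
  constructor <;> intro h <;> linear_combination h

lemma int_add_half_ne_zero (n : ℤ) : (n : ℝ) + 1 / 2 ≠ 0 := by
  intro h
  have : (2 * n + 1 : ℤ) = 0 := by
    have : (2 * n + 1 : ℝ) = 0 := by linarith
    exact_mod_cast this
  omega

lemma theta3_zero_ne_zero {τ : ℂ} (hτ : 0 < τ.im) : theta3 0 τ ≠ 0 := by
  rw [Ne, theta3_eq_zero_iff hτ]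
  rintro ⟨m, n, h⟩
  have := congrArg im h
  simp at this
  have h2 : ((n : ℝ) + 1 / 2) * τ.im = 0 := by linarith
  exact (mul_ne_zero (int_add_half_ne_zero n) hτ.ne') h2

lemma theta4_zero_ne_zero {τ : ℂ} (hτ : 0 < τ.im) : theta4 0 τ ≠ 0 := by
  rw [Ne, theta4_eq_zero_iff hτ]
  rintro ⟨m, n, h⟩
  have := congrArg im h
  simp at this
  have h2 : ((n : ℝ) + 1 / 2) * τ.im = 0 := by linarith
  exact (mul_ne_zero (int_add_half_ne_zero n) hτ.ne') h2

lemma theta2_zero_ne_zero {τ : ℂ} (hτ : 0 < τ.im) : theta2 0 τ ≠ 0 := by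
  rw [Ne, theta2_eq_zero_iff hτ]
  rintro ⟨m, n, h⟩
  have h1 := congrArg im h
  simp [hτ.ne'] at h1
  have h2 := congrArg re h
  simp [h1] at h2
  exact int_add_half_ne_zero m (by linarith)

/-! ### Bilinear differential expressions: Hirota form and Wronskian -/

/-- A sequence of functions each of which is the derivative of the preceding one. -/
def IsDerivChain (F : ℕ → ℂ → ℂ) : Prop := ∀ m v, HasDerivAt (F m) (F (m + 1) v) v

lemma IsDerivChain.one_zero_of_even {F : ℕ → ℂ → ℂ} (hF : IsDerivChain F)
    (he : ∀ v, F 0 (-v) = F 0 v) : F 1 0 = 0 := by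
  have h1 : HasDerivAt (F 0) (F 1 0) (-0) := by simpa using hF 0 0
  have h2 : HasDerivAt (F 0) (-F 1 0) 0 := by
    have := h1.scomp (0 : ℂ) (hasDerivAt_neg (0 : ℂ))
    refine (this.congr_deriv (by simp)).congr_of_eventuallyEq (.of_forall fun v => ?_)
    simp [he]
  have := (hF 0 0).unique h2
  linear_combination this / 2

/-- `F'' F - F'²`. -/
def hirota (F : ℕ → ℂ → ℂ) (v : ℂ) : ℂ := F 2 v * F 0 v - F 1 v ^ 2

/-- At v = 0 this turns the quadratic expression of F''F - F'² into a formula for the fourth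
derivative of F, which by the heat equation is a second τ-derivative. -/
lemma IsDerivChain.hirota_second_deriv {F G H : ℕ → ℂ → ℂ} (hF : IsDerivChain F)
    (hG : IsDerivChain G) (hH : IsDerivChain H) {c α β : ℂ}
    (h : ∀ v, hirota F v * c = α * G 0 v ^ 2 + β * H 0 v ^ 2) (v : ℂ) :
    (F 4 v * F 0 v - F 2 v ^ 2) * c =
      α * (2 * G 1 v ^ 2 + 2 * G 0 v * G 2 v) + β * (2 * H 1 v ^ 2 + 2 * H 0 v * H 2 v) := by
  have hsq : ∀ {K : ℕ → ℂ → ℂ}, IsDerivChain K → ∀ v,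
      HasDerivAt (fun v => K 0 v ^ 2) (2 * K 0 v * K 1 v) v := fun hK v =>
    ((hK 0 v).fun_pow 2).congr_deriv (by simp)
  have hsq' : ∀ {K : ℕ → ℂ → ℂ}, IsDerivChain K → ∀ v,
      HasDerivAt (fun v => 2 * K 0 v * K 1 v) (2 * K 1 v ^ 2 + 2 * K 0 v * K 2 v) v :=
    fun hK v => (((hK 0 v).const_mul 2).fun_mul (hK 1 v)).congr_deriv (by
        simp only [Nat.reduceAdd, zero_add]; ring)
  have h1 : ∀ v, (F 3 v * F 0 v - F 1 v * F 2 v) * c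
      = α * (2 * G 0 v * G 1 v) + β * (2 * H 0 v * H 1 v) := by
    intro v
    have hl : HasDerivAt (fun v => hirota F v * c) ((F 3 v * F 0 v - F 1 v * F 2 v) * c) v := by
      have := ((((hF 2 v).fun_mul (hF 0 v)).fun_sub ((hF 1 v).fun_pow 2)).mul_const c)
      exact this.congr_deriv (by
        simp only [Nat.reduceAdd, Nat.reduceSub, Nat.cast_ofNat, pow_one, zero_add]; ring)
    have hr := ((hsq hG v).const_mul α).fun_add ((hsq hH v).const_mul β)
    exact hl.unique (hr.congr_of_eventuallyEq (.of_forall h))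
  have hl : HasDerivAt (fun v => (F 3 v * F 0 v - F 1 v * F 2 v) * c)
      ((F 4 v * F 0 v - F 2 v ^ 2) * c) v := by
    have := ((((hF 3 v).fun_mul (hF 0 v)).fun_sub ((hF 1 v).fun_mul (hF 2 v))).mul_const c)
    exact this.congr_deriv (by
        simp only [Nat.reduceAdd, zero_add]; ring)
  have hr := ((hsq' hG v).const_mul α).fun_add ((hsq' hH v).const_mul β)
  exact hl.unique (hr.congr_of_eventuallyEq (.of_forall h1))

/-- The `m`-th `v`-derivative of `θ₁`. -/
def theta1Deriv (τ : ℂ) (m : ℕ) (v : ℂ) : ℂ := -thetaDeriv m (1 / 2) (v + 1 / 2) τ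

/-- The `m`-th `v`-derivative of `θ₂`. -/
def theta2Deriv (τ : ℂ) (m : ℕ) (v : ℂ) : ℂ := thetaDeriv m (1 / 2) v τ

/-- The `m`-th `v`-derivative of `θ₃`. -/
def theta3Deriv (τ : ℂ) (m : ℕ) (v : ℂ) : ℂ := thetaDeriv m 0 v τ

/-- The `m`-th `v`-derivative of `θ₄`. -/
def theta4Deriv (τ : ℂ) (m : ℕ) (v : ℂ) : ℂ := thetaDeriv m 0 (v + 1 / 2) τ

@[simp] lemma theta1Deriv_zero (τ v : ℂ) : theta1Deriv τ 0 v = theta1 v τ := by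
  rw [theta1Deriv, ← theta2_eq_thetaDeriv, theta2_add_half, neg_neg]

@[simp] lemma theta2Deriv_zero (τ v : ℂ) : theta2Deriv τ 0 v = theta2 v τ := by
  rw [theta2Deriv, theta2_eq_thetaDeriv]

@[simp] lemma theta3Deriv_zero (τ v : ℂ) : theta3Deriv τ 0 v = theta3 v τ := by
  rw [theta3Deriv, theta3_eq_thetaDeriv]

@[simp] lemma theta4Deriv_zero (τ v : ℂ) : theta4Deriv τ 0 v = theta4 v τ := by
  rw [theta4Deriv, ← theta3_eq_thetaDeriv, theta3_add_half]

section

variable {τ : ℂ} (hτ : 0 < τ.im)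
include hτ

lemma isDerivChain_theta1 : IsDerivChain (theta1Deriv τ) := fun m v =>
  ((hasDerivAt_thetaDeriv_fst m (1 / 2) (v + 1 / 2) hτ).comp_add_const v (1 / 2)).neg

lemma isDerivChain_theta2 : IsDerivChain (theta2Deriv τ) := fun m v =>
  hasDerivAt_thetaDeriv_fst m (1 / 2) v hτ

lemma isDerivChain_theta3 : IsDerivChain (theta3Deriv τ) := fun m v =>
  hasDerivAt_thetaDeriv_fst m 0 v hτ

lemma isDerivChain_theta4 : IsDerivChain (theta4Deriv τ) := fun m v =>
  (hasDerivAt_thetaDeriv_fst m 0 (v + 1 / 2) hτ).comp_add_const v (1 / 2)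

lemma theta2Deriv_one_zero : theta2Deriv τ 1 0 = 0 :=
  (isDerivChain_theta2 hτ).one_zero_of_even fun v => by simp [theta2_neg]

lemma theta3Deriv_one_zero : theta3Deriv τ 1 0 = 0 :=
  (isDerivChain_theta3 hτ).one_zero_of_even fun v => by simp [theta3_neg]

lemma theta4Deriv_one_zero : theta4Deriv τ 1 0 = 0 :=
  (isDerivChain_theta4 hτ).one_zero_of_even fun v => by simp [theta4_neg]

end

/-- If `F(v + w) = κ E(v) G(v)` with `E' = c E` then the same holds for `hirota` with `κ² E²`. -/
lemma IsDerivChain.hirota_shift {F G : ℕ → ℂ → ℂ} (hF : IsDerivChain F) (hG : IsDerivChain G)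
    {E : ℂ → ℂ} {c κ w : ℂ} (hE : ∀ v, HasDerivAt E (c * E v) v)
    (h : ∀ v, F 0 (v + w) = κ * E v * G 0 v) (v : ℂ) :
    hirota F (v + w) = κ ^ 2 * E v ^ 2 * hirota G v := by
  have h1 : ∀ v, F 1 (v + w) = κ * E v * (c * G 0 v + G 1 v) := by
    intro v
    have hl := (hF 0 (v + w)).comp_add_const v w
    have hr := ((hE v).const_mul κ).fun_mul (hG 0 v)
    rw [hl.unique (hr.congr_of_eventuallyEq (.of_forall h))]
    ring
  have h2 : F 2 (v + w) = κ * E v * (c ^ 2 * G 0 v + 2 * c * G 1 v + G 2 v) := by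
    have hl := (hF 1 (v + w)).comp_add_const v w
    have hr := ((hE v).const_mul κ).fun_mul (((hG 0 v).const_mul c).fun_add (hG 1 v))
    rw [hl.unique (hr.congr_of_eventuallyEq (.of_forall h1))]
    ring
  rw [hirota, hirota, h, h1, h2]
  ring

lemma hasDerivAt_halfPeriodFactor (τ v : ℂ) :
    HasDerivAt (fun v => halfPeriodFactor v τ) (-(Real.pi * I) * halfPeriodFactor v τ) v := by
  have h : HasDerivAt (fun v : ℂ => -(Real.pi * I * τ / 4) - Real.pi * I * v) (-(Real.pi * I)) v := by
    simpa using ((hasDerivAt_id v).const_mul ((Real.pi : ℂ) * I)).const_sub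
      (-(Real.pi * I * τ / 4))
  exact h.cexp.congr_deriv (by rw [halfPeriodFactor]; ring)

namespace IsThetaFunction

variable {k k' : ℕ} {ε ε' C C' τ : ℂ} {f g : ℂ → ℂ}

lemma mul (hf : IsThetaFunction k ε C τ f) (hg : IsThetaFunction k' ε' C' τ g) :
    IsThetaFunction (k + k') (ε * ε') (C * C') τ fun v => f v * g v := by
  refine ⟨hf.1.mul hg.1, fun v => by rw [hf.2, hg.2]; ring, fun v => ?_⟩
  rw [hf.3, hg.3]
  push_cast
  rw [show -(2 * (Real.pi : ℂ) * I * (k + k') * v)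
    = -(2 * Real.pi * I * k * v) + -(2 * Real.pi * I * k' * v) by ring, exp_add]
  ring

lemma of_eq (hf : IsThetaFunction k ε C τ f) (hk : k = k') (hε : ε = ε') (hC : C = C')
    (hfg : ∀ v, f v = g v) : IsThetaFunction k' ε' C' τ g := by
  obtain rfl : f = g := funext hfg
  subst hk hε hC
  exact hf

/-- The factor `exp(-2πiv)` as a function with its derivative. -/
lemma hasDerivAt_exp_factor (v : ℂ) : HasDerivAt (fun v : ℂ => exp (-(2 * Real.pi * I * (1 : ℕ) * v)))
    (-(2 * Real.pi * I) * exp (-(2 * Real.pi * I * (1 : ℕ) * v))) v := by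
  have h : HasDerivAt (fun v : ℂ => -(2 * Real.pi * I * (1 : ℕ) * v)) (-(2 * Real.pi * I)) v := by
    simpa using ((hasDerivAt_id v).const_mul (2 * (Real.pi : ℂ) * I)).fun_neg
  exact h.cexp.congr_deriv (by ring)

/-- F''F - F'² is F² times the second logarithmic derivative of F. The multipliers are exponentials
of linear functions, invisible to that derivative, so the expression transforms like F². -/
lemma hirota {F : ℕ → ℂ → ℂ} (hF : IsDerivChain F) (hf : IsThetaFunction 1 ε C τ (F 0)) :
    IsThetaFunction 2 (ε ^ 2) (C ^ 2) τ (hirota F) := by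
  refine ⟨?_, fun v => ?_, fun v => ?_⟩
  · intro v
    exact (((hF 2 v).fun_mul (hF 0 v)).fun_sub ((hF 1 v).fun_pow 2)).differentiableAt
  · have h := hF.hirota_shift hF (E := fun _ => 1) (c := 0) (κ := ε) (w := 1)
      (fun v => by simpa using hasDerivAt_const v (1 : ℂ)) (fun v => by rw [hf.2, mul_one]) v
    rw [h]; ring
  · have h := hF.hirota_shift hF (c := -(2 * Real.pi * I)) (κ := C) (w := τ)
      hasDerivAt_exp_factor hf.3 v
    rw [h, ← exp_nat_mul]
    push_cast
    ring_nf

/-- The extra terms -2πiF and -2πiG produced by differentiating the multipliers cancel in the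
antisymmetric combination. -/
lemma wronskian {F G : ℕ → ℂ → ℂ} (hF : IsDerivChain F) (hG : IsDerivChain G)
    (hf : IsThetaFunction 1 ε C τ (F 0)) (hg : IsThetaFunction 1 ε' C' τ (G 0)) :
    IsThetaFunction 2 (ε * ε') (C * C') τ fun v => F 1 v * G 0 v - F 0 v * G 1 v := by
  have key : ∀ {F : ℕ → ℂ → ℂ} {ε C : ℂ}, IsDerivChain F → IsThetaFunction 1 ε C τ (F 0) →
      (∀ v, F 1 (v + 1) = ε * F 1 v) ∧ ∀ v, F 1 (v + τ) =
        C * exp (-(2 * Real.pi * I * (1 : ℕ) * v)) * (F 1 v - 2 * Real.pi * I * F 0 v) := by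
    intro F ε C hF hf
    constructor
    · intro v
      have hl := (hF 0 (v + 1)).comp_add_const v 1
      exact hl.unique (((hF 0 v).const_mul ε).congr_of_eventuallyEq (.of_forall hf.2))
    · intro v
      have hl := (hF 0 (v + τ)).comp_add_const v τ
      have hr := ((hasDerivAt_exp_factor v).const_mul C).fun_mul (hF 0 v)
      rw [hl.unique (hr.congr_of_eventuallyEq (.of_forall hf.3))]
      ring
  refine ⟨?_, fun v => ?_, fun v => ?_⟩
  · intro v
    exact (((hF 1 v).fun_mul (hG 0 v)).fun_sub ((hF 0 v).fun_mul (hG 1 v))).differentiableAt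
  · rw [hf.2, hg.2, (key hF hf).1, (key hG hg).1]; ring
  · rw [hf.3, hg.3, (key hF hf).2, (key hG hg).2,
      show exp (-(2 * Real.pi * I * (2 : ℕ) * v)) = exp (-(2 * Real.pi * I * (1 : ℕ) * v)) ^ 2 by
        rw [← exp_nat_mul]; push_cast; ring_nf]
    ring

end IsThetaFunction

/-! ### Identities of degree two between theta functions -/

section

variable {τ : ℂ} (hτ : 0 < τ.im)
include hτ

lemma isThetaFunction_theta1 :
    IsThetaFunction 1 (-1) (-exp (-(Real.pi * I * τ))) τ fun v => theta1 v τ := by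
  refine ⟨differentiable_theta1 hτ, fun v => by rw [theta1_add_one]; ring, fun v => ?_⟩
  rw [theta1_add_period, periodFactor, neg_mul_comm, neg_mul, ← exp_add]
  push_cast
  ring_nf

lemma isThetaFunction_theta2 :
    IsThetaFunction 1 (-1) (exp (-(Real.pi * I * τ))) τ fun v => theta2 v τ := by
  refine ⟨differentiable_theta2 hτ, fun v => by rw [theta2_add_one]; ring, fun v => ?_⟩
  rw [theta2_add_period, periodFactor, ← exp_add]
  push_cast
  ring_nf

lemma isThetaFunction_theta4 :
    IsThetaFunction 1 1 (-exp (-(Real.pi * I * τ))) τ fun v => theta4 v τ := by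
  refine ⟨differentiable_theta4 hτ, fun v => by rw [theta4_add_one]; ring, fun v => ?_⟩
  rw [theta4_add_period, periodFactor, neg_mul_comm, neg_mul, ← exp_add]
  push_cast
  ring_nf

end

lemma half_add_half_period (τ : ℂ) : (1 + τ) / 2 = 0 + τ / 2 + 1 / 2 := by ring

lemma theta1_at_center (τ : ℂ) :
    theta1 ((1 + τ) / 2) τ = halfPeriodFactor 0 τ * theta3 0 τ := by
  rw [half_add_half_period, theta1_add_half, theta2_add_half_period]

lemma theta2_at_center (τ : ℂ) :
    theta2 ((1 + τ) / 2) τ = -I * halfPeriodFactor 0 τ * theta4 0 τ := by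
  rw [half_add_half_period, theta2_add_half, theta1_add_half_period]; ring

lemma theta4_at_center (τ : ℂ) :
    theta4 ((1 + τ) / 2) τ = halfPeriodFactor 0 τ * theta2 0 τ := by
  rw [half_add_half_period, theta4_add_half, theta3_add_half_period]

section

variable {τ : ℂ} (hτ : 0 < τ.im)
include hτ

/-- Even theta functions of degree two are combinations of `θ₁²` and `θ₃²`. -/
lemma IsThetaFunction.eq_theta1_sq_theta3_sq {f : ℂ → ℂ} {α β : ℂ}
    (hf : IsThetaFunction 2 1 (exp (-(Real.pi * I * τ)) ^ 2) τ f)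
    (h0 : f 0 = α) (hb : f ((1 + τ) / 2) = β * halfPeriodFactor 0 τ ^ 2) (v : ℂ) :
    f v * theta3 0 τ ^ 2 = α * theta3 v τ ^ 2 + β * theta1 v τ ^ 2 := by
  have h1 : IsThetaFunction 2 1 (exp (-(Real.pi * I * τ)) ^ 2) τ fun v => theta1 v τ ^ 2 :=
    ((isThetaFunction_theta1 hτ).mul (isThetaFunction_theta1 hτ)).of_eq rfl (by ring) (by ring)
      fun v => by ring
  have h3 : IsThetaFunction 2 1 (exp (-(Real.pi * I * τ)) ^ 2) τ fun v => theta3 v τ ^ 2 :=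
    ((isThetaFunction_theta3 hτ).mul (isThetaFunction_theta3 hτ)).of_eq rfl (by ring) (by ring)
      fun v => by ring
  have ht3 := theta3_zero_ne_zero hτ
  have h := IsThetaFunction.eq_zero_of_two_zeros one_ne_zero (pow_ne_zero 2 (exp_ne_zero _))
    ((hf.const_mul (theta3 0 τ ^ 2)).add ((h3.const_mul (-α)).add (h1.const_mul (-β)))) h1 h3
    0 ((1 + τ) / 2) (by
      rw [theta1_zero, theta3_half_add_half_period_eq_zero, theta1_at_center]
      have := halfPeriodFactor_ne_zero 0 τ
      simp [this, ht3]) (by rw [h0, theta1_zero]; ring)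
    (by rw [hb, theta3_half_add_half_period_eq_zero, theta1_at_center]; ring) v
  linear_combination h

lemma theta2_sq_eq (v : ℂ) : theta2 v τ ^ 2 * theta3 0 τ ^ 2 =
    theta2 0 τ ^ 2 * theta3 v τ ^ 2 - theta4 0 τ ^ 2 * theta1 v τ ^ 2 := by
  have h : IsThetaFunction 2 1 (exp (-(Real.pi * I * τ)) ^ 2) τ fun v => theta2 v τ ^ 2 :=
    ((isThetaFunction_theta2 hτ).mul (isThetaFunction_theta2 hτ)).of_eq rfl (by ring) (by ring)
      fun v => by ring
  rw [h.eq_theta1_sq_theta3_sq hτ (β := -theta4 0 τ ^ 2) rfl (by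
    rw [theta2_at_center]; linear_combination (halfPeriodFactor 0 τ ^ 2 * theta4 0 τ ^ 2) * I_sq) v]
  ring

lemma theta4_sq_eq (v : ℂ) : theta4 v τ ^ 2 * theta3 0 τ ^ 2 =
    theta4 0 τ ^ 2 * theta3 v τ ^ 2 + theta2 0 τ ^ 2 * theta1 v τ ^ 2 := by
  have h : IsThetaFunction 2 1 (exp (-(Real.pi * I * τ)) ^ 2) τ fun v => theta4 v τ ^ 2 :=
    ((isThetaFunction_theta4 hτ).mul (isThetaFunction_theta4 hτ)).of_eq rfl (by ring) (by ring)
      fun v => by ring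
  rw [h.eq_theta1_sq_theta3_sq hτ (β := theta2 0 τ ^ 2) rfl (by rw [theta4_at_center]; ring) v]

/-- Jacobi's identity. -/
lemma jacobi_identity : theta3 0 τ ^ 4 = theta2 0 τ ^ 4 + theta4 0 τ ^ 4 := by
  have h := theta4_sq_eq hτ (0 + 1 / 2)
  rw [theta4_add_half, theta3_add_half, theta1_add_half] at h
  linear_combination h

/-- The value at the centre (1+τ)/2 comes from shifting θ₃ by it, which gives θ₁ up to an
exponential factor; as θ₁(0) = 0, only θ₁'(0)² remains. For θ₂ and θ₄ the same shift exchanges the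
two functions. -/
lemma hirota_theta3 (v : ℂ) : hirota (theta3Deriv τ) v * theta3 0 τ ^ 2 =
    (theta3Deriv τ 2 0 * theta3 0 τ) * theta3 v τ ^ 2 + theta1Deriv τ 1 0 ^ 2 * theta1 v τ ^ 2 := by
  have h := IsThetaFunction.hirota (isDerivChain_theta3 hτ)
    ((isThetaFunction_theta3 hτ).of_eq rfl rfl rfl fun v => (theta3Deriv_zero τ v).symm)
  refine (h.of_eq rfl (by ring) (by ring) fun _ => rfl).eq_theta1_sq_theta3_sq hτ
    (by simp [hirota, theta3Deriv_one_zero hτ]) ?_ v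
  have hs := (isDerivChain_theta3 hτ).hirota_shift (isDerivChain_theta1 hτ) (κ := I)
    (w := (1 + τ) / 2) (hasDerivAt_halfPeriodFactor τ) (fun v => by
      simp only [theta3Deriv_zero, theta1Deriv_zero]
      rw [show v + (1 + τ) / 2 = v + τ / 2 + 1 / 2 by ring, theta3_add_half,
        theta4_add_half_period]) 0
  rw [zero_add] at hs
  rw [hs, hirota, theta1Deriv_zero, theta1_zero]
  linear_combination (-halfPeriodFactor 0 τ ^ 2 * theta1Deriv τ 1 0 ^ 2) * I_sq

lemma hirota_theta2 (v : ℂ) : hirota (theta2Deriv τ) v * theta3 0 τ ^ 2 =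
    (theta2Deriv τ 2 0 * theta2 0 τ) * theta3 v τ ^ 2 +
      (-(theta4Deriv τ 2 0 * theta4 0 τ)) * theta1 v τ ^ 2 := by
  have h := IsThetaFunction.hirota (isDerivChain_theta2 hτ)
    ((isThetaFunction_theta2 hτ).of_eq rfl rfl rfl fun v => (theta2Deriv_zero τ v).symm)
  refine (h.of_eq rfl (by ring) (by ring) fun _ => rfl).eq_theta1_sq_theta3_sq hτ
    (by simp [hirota, theta2Deriv_one_zero hτ]) ?_ v
  have hs := (isDerivChain_theta2 hτ).hirota_shift (isDerivChain_theta4 hτ) (κ := -I)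
    (w := (1 + τ) / 2) (hasDerivAt_halfPeriodFactor τ) (fun v => by
      simp only [theta2Deriv_zero, theta4Deriv_zero]
      rw [show v + (1 + τ) / 2 = v + τ / 2 + 1 / 2 by ring, theta2_add_half,
        theta1_add_half_period]
      ring) 0
  rw [zero_add] at hs
  rw [hs, hirota, theta4Deriv_one_zero hτ, theta4Deriv_zero]
  linear_combination (halfPeriodFactor 0 τ ^ 2 * theta4Deriv τ 2 0 * theta4 0 τ) * I_sq

lemma hirota_theta4 (v : ℂ) : hirota (theta4Deriv τ) v * theta3 0 τ ^ 2 =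
    (theta4Deriv τ 2 0 * theta4 0 τ) * theta3 v τ ^ 2 +
      (theta2Deriv τ 2 0 * theta2 0 τ) * theta1 v τ ^ 2 := by
  have h := IsThetaFunction.hirota (isDerivChain_theta4 hτ)
    ((isThetaFunction_theta4 hτ).of_eq rfl rfl rfl fun v => (theta4Deriv_zero τ v).symm)
  refine (h.of_eq rfl (by ring) (by ring) fun _ => rfl).eq_theta1_sq_theta3_sq hτ
    (by simp [hirota, theta4Deriv_one_zero hτ]) ?_ v
  have hs := (isDerivChain_theta4 hτ).hirota_shift (isDerivChain_theta2 hτ) (κ := 1)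
    (w := (1 + τ) / 2) (hasDerivAt_halfPeriodFactor τ) (fun v => by
      simp only [theta2Deriv_zero, theta4Deriv_zero]
      rw [show v + (1 + τ) / 2 = v + τ / 2 + 1 / 2 by ring, theta4_add_half,
        theta3_add_half_period]
      ring) 0
  rw [zero_add] at hs
  rw [hs, hirota, theta2Deriv_one_zero hτ, theta2Deriv_zero]
  ring

/-- `(θ₁/θ₃)'` as a theta quotient. -/
lemma wronskian_theta1_theta3 (v : ℂ) :
    (theta1Deriv τ 1 v * theta3 v τ - theta1 v τ * theta3Deriv τ 1 v) * (theta2 0 τ * theta4 0 τ) =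
      theta1Deriv τ 1 0 * theta3 0 τ * (theta2 v τ * theta4 v τ) := by
  have h := IsThetaFunction.wronskian (isDerivChain_theta1 hτ) (isDerivChain_theta3 hτ)
    ((isThetaFunction_theta1 hτ).of_eq rfl rfl rfl fun v => (theta1Deriv_zero τ v).symm) ((isThetaFunction_theta3 hτ).of_eq rfl rfl rfl fun v => (theta3Deriv_zero τ v).symm)
  simp only [theta1Deriv_zero, theta3Deriv_zero] at h
  have h24 : IsThetaFunction 2 (-1 * 1) (-exp (-(Real.pi * I * τ)) * exp (-(Real.pi * I * τ))) τ
      fun v => theta2 v τ * theta4 v τ :=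
    ((isThetaFunction_theta2 hτ).mul (isThetaFunction_theta4 hτ)).of_eq rfl rfl (by ring)
      fun _ => rfl
  have h13 := (isThetaFunction_theta1 hτ).mul (isThetaFunction_theta3 hτ)
  -- At v = 1/2 the functions θ₁ and θ₃ continue as the even functions θ₂ and θ₄, so both
  -- derivatives vanish there. The points 0 and 1/2 therefore serve as the two test points.
  have e1 : theta1Deriv τ 1 (0 + 1 / 2) = 0 := by
    rw [theta1Deriv, zero_add, add_halves]
    have h1 := (hasDerivAt_thetaDeriv_fst 0 (1 / 2) (0 + 1) hτ).comp_add_const 0 1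
    have h2 := (hasDerivAt_thetaDeriv_fst 0 (1 / 2) 0 hτ).neg
    have := h1.unique (h2.congr_of_eventuallyEq (.of_forall fun v => by
      simp only [← theta2_eq_thetaDeriv]; rw [theta2_add_one]; rfl))
    simp only [zero_add] at this
    rw [this, neg_neg]
    exact theta2Deriv_one_zero hτ
  have e3 : theta3Deriv τ 1 (0 + 1 / 2) = 0 := by
    exact theta4Deriv_one_zero hτ
  have e0 : theta2 (0 + 1 / 2) τ = 0 := by rw [theta2_add_half, theta1_zero, neg_zero]
  have h2 := theta2_zero_ne_zero hτ
  have h4 := theta4_zero_ne_zero hτ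
  have hE := exp_ne_zero (-(Real.pi * I * τ))
  have key := IsThetaFunction.eq_zero_of_two_zeros (by norm_num)
    (mul_ne_zero (neg_ne_zero.2 hE) hE)
    ((h.const_mul (theta2 0 τ * theta4 0 τ)).add
      (h24.const_mul (-(theta1Deriv τ 1 0 * theta3 0 τ)))) h24 h13 0 (0 + 1 / 2)
    (by rw [theta1_add_half, theta3_add_half, theta1_zero, e0]; simp [h2, h4])
    (by rw [theta1_zero]; ring) (by rw [e1, e3, e0]; ring) v
  linear_combination key

/-- The derivative `θ₁'(0)` in terms of the second derivatives of `θ₂` and `θ₄`. -/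
lemma theta1Deriv_sq_eq_two_four : -(theta1Deriv τ 1 0 ^ 2 * theta3 0 τ ^ 2) =
    theta2Deriv τ 2 0 * theta2 0 τ * theta4 0 τ ^ 2 -
      theta4Deriv τ 2 0 * theta4 0 τ * theta2 0 τ ^ 2 := by
  have h := hirota_theta2 hτ (0 + 1 / 2)
  have hs := (isDerivChain_theta2 hτ).hirota_shift (isDerivChain_theta1 hτ) (κ := -1)
    (E := fun _ => 1) (c := 0) (w := 1 / 2) (fun v => by simpa using hasDerivAt_const v (1 : ℂ))
    (fun v => by simp only [theta2Deriv_zero, theta1Deriv_zero]; rw [theta2_add_half]; ring) 0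
  rw [hs, theta3_add_half, theta1_add_half, hirota, theta1Deriv_zero, theta1_zero] at h
  linear_combination h

lemma theta1Deriv_sq_eq_four_three : theta1Deriv τ 1 0 ^ 2 * theta2 0 τ ^ 2 =
    theta4Deriv τ 2 0 * theta4 0 τ * theta3 0 τ ^ 2 -
      theta3Deriv τ 2 0 * theta3 0 τ * theta4 0 τ ^ 2 := by
  have h := hirota_theta3 hτ (0 + 1 / 2)
  have hs := (isDerivChain_theta3 hτ).hirota_shift (isDerivChain_theta4 hτ) (κ := 1)
    (E := fun _ => 1) (c := 0) (w := 1 / 2) (fun v => by simpa using hasDerivAt_const v (1 : ℂ))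
    (fun v => by simp only [theta3Deriv_zero, theta4Deriv_zero]; rw [theta3_add_half]; ring) 0
  rw [hs, theta3_add_half, theta1_add_half, hirota, theta4Deriv_zero, theta4Deriv_one_zero hτ] at h
  linear_combination -h

/-- The second v-derivative of the Hirota relation at v = 0, where θ₁ and θ₃' vanish. -/
lemma theta3Deriv_four :
    (theta3Deriv τ 4 0 * theta3 0 τ - theta3Deriv τ 2 0 ^ 2) * theta3 0 τ ^ 2 =
      2 * (theta3Deriv τ 2 0 * theta3 0 τ) ^ 2 + 2 * theta1Deriv τ 1 0 ^ 4 := by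
  have h := (isDerivChain_theta3 hτ).hirota_second_deriv (isDerivChain_theta3 hτ)
    (isDerivChain_theta1 hτ) (c := theta3 0 τ ^ 2) (fun v => by
      simp only [theta3Deriv_zero, theta1Deriv_zero]; exact hirota_theta3 hτ v) 0
  rw [theta3Deriv_one_zero hτ, theta1Deriv_zero, theta1_zero, theta3Deriv_zero] at h
  linear_combination h

lemma theta2Deriv_four :
    (theta2Deriv τ 4 0 * theta2 0 τ - theta2Deriv τ 2 0 ^ 2) * theta3 0 τ ^ 2 =
      2 * (theta2Deriv τ 2 0 * theta2 0 τ) * (theta3Deriv τ 2 0 * theta3 0 τ) -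
        2 * (theta4Deriv τ 2 0 * theta4 0 τ) * theta1Deriv τ 1 0 ^ 2 := by
  have h := (isDerivChain_theta2 hτ).hirota_second_deriv (isDerivChain_theta3 hτ)
    (isDerivChain_theta1 hτ) (c := theta3 0 τ ^ 2) (fun v => by
      simp only [theta3Deriv_zero, theta1Deriv_zero]; exact hirota_theta2 hτ v) 0
  rw [theta3Deriv_one_zero hτ, theta1Deriv_zero, theta1_zero, theta3Deriv_zero,
    theta2Deriv_zero] at h
  linear_combination h

lemma theta4Deriv_four :
    (theta4Deriv τ 4 0 * theta4 0 τ - theta4Deriv τ 2 0 ^ 2) * theta3 0 τ ^ 2 =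
      2 * (theta4Deriv τ 2 0 * theta4 0 τ) * (theta3Deriv τ 2 0 * theta3 0 τ) +
        2 * (theta2Deriv τ 2 0 * theta2 0 τ) * theta1Deriv τ 1 0 ^ 2 := by
  have h := (isDerivChain_theta4 hτ).hirota_second_deriv (isDerivChain_theta3 hτ)
    (isDerivChain_theta1 hτ) (c := theta3 0 τ ^ 2) (fun v => by
      simp only [theta3Deriv_zero, theta1Deriv_zero]; exact hirota_theta4 hτ v) 0
  rw [theta3Deriv_one_zero hτ, theta1Deriv_zero, theta1_zero, theta3Deriv_zero,
    theta4Deriv_zero] at h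
  linear_combination h

end

/-! ### Logarithmic derivatives of the theta constants and the Halphen system -/

lemma thetaConst2_eq (τ : ℂ) : thetaConst2 τ = theta2 0 τ := by
  refine tsum_congr fun k => ?_
  rw [mul_zero, exp_zero, mul_one]

lemma thetaConst3_eq (τ : ℂ) : thetaConst3 τ = theta3 0 τ := by
  refine tsum_congr fun k => ?_
  rw [mul_zero, exp_zero, mul_one]
  ring_nf

/-- `4πi`, the coefficient in the heat equation of the theta functions. -/
def heatConst : ℂ := 4 * Real.pi * I

lemma heatConst_ne_zero : heatConst ≠ 0 := by
  simp [heatConst, Real.pi_ne_zero, I_ne_zero]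

/-- The logarithmic derivative of `ϑ₂`. -/
def logDeriv2 (τ : ℂ) : ℂ := theta2Deriv τ 2 0 / heatConst / theta2 0 τ

/-- The logarithmic derivative of `ϑ₃`. -/
def logDeriv3 (τ : ℂ) : ℂ := theta3Deriv τ 2 0 / heatConst / theta3 0 τ

/-- The logarithmic derivative of `ϑ₄`. -/
def logDeriv4 (τ : ℂ) : ℂ := theta4Deriv τ 2 0 / heatConst / theta4 0 τ

section

variable {τ : ℂ} (hτ : 0 < τ.im)
include hτ

lemma hasDerivAt_theta2 :
    HasDerivAt (fun τ => theta2 0 τ) (logDeriv2 τ * theta2 0 τ) τ := by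
  have h := hasDerivAt_thetaDeriv_snd 0 (1 / 2) 0 hτ
  simp only [← theta2_eq_thetaDeriv] at h
  refine h.congr_deriv ?_
  rw [logDeriv2, div_mul_cancel₀ _ (theta2_zero_ne_zero hτ)]; rfl

lemma hasDerivAt_theta3 :
    HasDerivAt (fun τ => theta3 0 τ) (logDeriv3 τ * theta3 0 τ) τ := by
  have h := hasDerivAt_thetaDeriv_snd 0 0 0 hτ
  simp only [← theta3_eq_thetaDeriv] at h
  refine h.congr_deriv ?_
  rw [logDeriv3, div_mul_cancel₀ _ (theta3_zero_ne_zero hτ)]; rfl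

lemma hasDerivAt_theta4 :
    HasDerivAt (fun τ => theta4 0 τ) (logDeriv4 τ * theta4 0 τ) τ := by
  have h := hasDerivAt_thetaDeriv_snd 0 0 (0 + 1 / 2) hτ
  simp only [← theta3_eq_thetaDeriv, theta3_add_half] at h
  refine h.congr_deriv ?_
  rw [logDeriv4, div_mul_cancel₀ _ (theta4_zero_ne_zero hτ)]; rfl

lemma hasDerivAt_logDeriv2_aux : HasDerivAt logDeriv2
    (theta2Deriv τ 4 0 / heatConst ^ 2 / theta2 0 τ - logDeriv2 τ ^ 2) τ := by
  have h2 := theta2_zero_ne_zero hτ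
  have h : HasDerivAt (fun τ => theta2Deriv τ 2 0) (theta2Deriv τ 4 0 / heatConst) τ :=
    hasDerivAt_thetaDeriv_snd 2 (1 / 2) 0 hτ
  refine ((h.div_const heatConst).fun_div (hasDerivAt_theta2 hτ) h2).congr_deriv ?_
  rw [logDeriv2]
  have := heatConst_ne_zero
  field_simp

lemma hasDerivAt_logDeriv3_aux : HasDerivAt logDeriv3
    (theta3Deriv τ 4 0 / heatConst ^ 2 / theta3 0 τ - logDeriv3 τ ^ 2) τ := by
  have h2 := theta3_zero_ne_zero hτ
  have h : HasDerivAt (fun τ => theta3Deriv τ 2 0) (theta3Deriv τ 4 0 / heatConst) τ :=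
    hasDerivAt_thetaDeriv_snd 2 0 0 hτ
  refine ((h.div_const heatConst).fun_div (hasDerivAt_theta3 hτ) h2).congr_deriv ?_
  rw [logDeriv3]
  have := heatConst_ne_zero
  field_simp

lemma hasDerivAt_logDeriv4_aux : HasDerivAt logDeriv4
    (theta4Deriv τ 4 0 / heatConst ^ 2 / theta4 0 τ - logDeriv4 τ ^ 2) τ := by
  have h2 := theta4_zero_ne_zero hτ
  have h : HasDerivAt (fun τ => theta4Deriv τ 2 0) (theta4Deriv τ 4 0 / heatConst) τ :=
    hasDerivAt_thetaDeriv_snd 2 0 (0 + 1 / 2) hτ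
  refine ((h.div_const heatConst).fun_div (hasDerivAt_theta4 hτ) h2).congr_deriv ?_
  rw [logDeriv4]
  have := heatConst_ne_zero
  field_simp

lemma theta2Deriv_two : theta2Deriv τ 2 0 = heatConst * (logDeriv2 τ * theta2 0 τ) := by
  have := heatConst_ne_zero
  have := theta2_zero_ne_zero hτ
  rw [logDeriv2]; field_simp

lemma theta3Deriv_two : theta3Deriv τ 2 0 = heatConst * (logDeriv3 τ * theta3 0 τ) := by
  have := heatConst_ne_zero
  have := theta3_zero_ne_zero hτ
  rw [logDeriv3]; field_simp

lemma theta4Deriv_two : theta4Deriv τ 2 0 = heatConst * (logDeriv4 τ * theta4 0 τ) := by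
  have := heatConst_ne_zero
  have := theta4_zero_ne_zero hτ
  rw [logDeriv4]; field_simp

/-- By the heat equation second v-derivatives at 0 are 4πi times τ-derivatives, so the Hirota
relations at v = 1/2 become formulas for differences of logarithmic derivatives. -/
lemma logDeriv4_sub_logDeriv2 : logDeriv4 τ - logDeriv2 τ =
    theta1Deriv τ 1 0 ^ 2 / heatConst * theta3 0 τ ^ 2 / (theta2 0 τ ^ 2 * theta4 0 τ ^ 2) := by
  have h := theta1Deriv_sq_eq_two_four hτ
  rw [theta2Deriv_two hτ, theta4Deriv_two hτ] at h
  have := heatConst_ne_zero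
  have := theta2_zero_ne_zero hτ
  have := theta4_zero_ne_zero hτ
  field_simp
  linear_combination h

lemma logDeriv4_sub_logDeriv3 : logDeriv4 τ - logDeriv3 τ =
    theta1Deriv τ 1 0 ^ 2 / heatConst * theta2 0 τ ^ 2 / (theta3 0 τ ^ 2 * theta4 0 τ ^ 2) := by
  have h := theta1Deriv_sq_eq_four_three hτ
  rw [theta3Deriv_two hτ, theta4Deriv_two hτ] at h
  have := heatConst_ne_zero
  have := theta3_zero_ne_zero hτ
  have := theta4_zero_ne_zero hτ
  field_simp
  linear_combination -h

lemma logDeriv3_sub_logDeriv2 : logDeriv3 τ - logDeriv2 τ =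
    theta1Deriv τ 1 0 ^ 2 / heatConst * theta4 0 τ ^ 2 / (theta2 0 τ ^ 2 * theta3 0 τ ^ 2) := by
  have h1 := logDeriv4_sub_logDeriv2 hτ
  have h2 := logDeriv4_sub_logDeriv3 hτ
  have h3 := jacobi_identity hτ
  have : logDeriv3 τ - logDeriv2 τ = (logDeriv4 τ - logDeriv2 τ) - (logDeriv4 τ - logDeriv3 τ) := by
    ring
  rw [this, h1, h2]
  have := heatConst_ne_zero
  have := theta2_zero_ne_zero hτ
  have := theta3_zero_ne_zero hτ
  have := theta4_zero_ne_zero hτ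
  field_simp
  linear_combination theta1Deriv τ 1 0 ^ 2 * h3

/-- The Halphen system for the logarithmic derivatives of the theta constants. -/
lemma hasDerivAt_logDeriv3 : HasDerivAt logDeriv3 (2 * (logDeriv3 τ * logDeriv2 τ +
    logDeriv3 τ * logDeriv4 τ - logDeriv2 τ * logDeriv4 τ)) τ := by
  refine (hasDerivAt_logDeriv3_aux hτ).congr_deriv ?_
  have h := theta3Deriv_four hτ
  rw [theta3Deriv_two hτ] at h
  have h32 := logDeriv3_sub_logDeriv2 hτ
  have h43 := logDeriv4_sub_logDeriv3 hτ
  have n0 := heatConst_ne_zero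
  have n2 := theta2_zero_ne_zero hτ
  have n3 := theta3_zero_ne_zero hτ
  have n4 := theta4_zero_ne_zero hτ
  have e1 : theta3Deriv τ 4 0 / heatConst ^ 2 / theta3 0 τ = 3 * logDeriv3 τ ^ 2 +
      2 * (theta1Deriv τ 1 0 ^ 4 / heatConst ^ 2 / theta3 0 τ ^ 4) := by
    field_simp
    linear_combination h
  -- In the product of the two differences ϑ₂² and ϑ₄² cancel, so θ₁'(0)⁴ is eliminated in favour of
  -- the logarithmic derivatives.
  have e2 : theta1Deriv τ 1 0 ^ 4 / heatConst ^ 2 / theta3 0 τ ^ 4 =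
      (logDeriv3 τ - logDeriv2 τ) * (logDeriv4 τ - logDeriv3 τ) := by
    rw [h32, h43]; field_simp
  rw [e1, e2]; ring

lemma hasDerivAt_logDeriv2 : HasDerivAt logDeriv2 (2 * (logDeriv2 τ * logDeriv3 τ +
    logDeriv2 τ * logDeriv4 τ - logDeriv3 τ * logDeriv4 τ)) τ := by
  refine (hasDerivAt_logDeriv2_aux hτ).congr_deriv ?_
  have h := theta2Deriv_four hτ
  rw [theta3Deriv_two hτ, theta2Deriv_two hτ, theta4Deriv_two hτ] at h
  have h32 := logDeriv3_sub_logDeriv2 hτ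
  have n0 := heatConst_ne_zero
  have n2 := theta2_zero_ne_zero hτ
  have n3 := theta3_zero_ne_zero hτ
  have e1 : theta2Deriv τ 4 0 / heatConst ^ 2 / theta2 0 τ = logDeriv2 τ ^ 2 +
      2 * logDeriv2 τ * logDeriv3 τ - 2 * logDeriv4 τ * (theta1Deriv τ 1 0 ^ 2 / heatConst *
        theta4 0 τ ^ 2 / (theta2 0 τ ^ 2 * theta3 0 τ ^ 2)) := by
    field_simp
    linear_combination h
  rw [e1, ← h32]; ring

lemma hasDerivAt_logDeriv4 : HasDerivAt logDeriv4 (2 * (logDeriv4 τ * logDeriv2 τ +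
    logDeriv4 τ * logDeriv3 τ - logDeriv2 τ * logDeriv3 τ)) τ := by
  refine (hasDerivAt_logDeriv4_aux hτ).congr_deriv ?_
  have h := theta4Deriv_four hτ
  rw [theta3Deriv_two hτ, theta2Deriv_two hτ, theta4Deriv_two hτ] at h
  have h43 := logDeriv4_sub_logDeriv3 hτ
  have n0 := heatConst_ne_zero
  have n4 := theta4_zero_ne_zero hτ
  have n3 := theta3_zero_ne_zero hτ
  have e1 : theta4Deriv τ 4 0 / heatConst ^ 2 / theta4 0 τ = logDeriv4 τ ^ 2 +
      2 * logDeriv4 τ * logDeriv3 τ + 2 * logDeriv2 τ * (theta1Deriv τ 1 0 ^ 2 / heatConst *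
        theta2 0 τ ^ 2 / (theta3 0 τ ^ 2 * theta4 0 τ ^ 2)) := by
    field_simp
    linear_combination h
  rw [e1, ← h43]; ring

end

/-! ### Jacobi's derivative formula by the limit at i∞ -/

lemma isOpen_upperHalf : IsOpen upperHalf := isOpen_lt continuous_const continuous_im

lemma convex_upperHalf : Convex ℝ upperHalf := convex_halfSpace_im_gt 0

lemma isPreconnected_upperHalf : IsPreconnected upperHalf := convex_upperHalf.isPreconnected

/-- By the Halphen system the difference L₃ - L₂ has logarithmic derivative 4L₄, as has ϑ₄⁴. -/
lemma exists_logDeriv_const : ∃ M : ℂ, ∀ τ ∈ upperHalf,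
    logDeriv3 τ - logDeriv2 τ = M * theta4 0 τ ^ 4 := by
  have hd : ∀ τ ∈ upperHalf, HasDerivAt
      (fun τ => (logDeriv3 τ - logDeriv2 τ) / theta4 0 τ ^ 4) 0 τ := by
    intro τ hτ
    have h4 := theta4_zero_ne_zero hτ
    have h := ((hasDerivAt_logDeriv3 hτ).fun_sub (hasDerivAt_logDeriv2 hτ)).fun_div
      ((hasDerivAt_theta4 hτ).fun_pow 4) (pow_ne_zero 4 h4)
    refine h.congr_deriv ?_
    push_cast
    rw [div_eq_zero_iff]
    left
    ring
  obtain ⟨M, hM⟩ := isOpen_upperHalf.exists_is_const_of_deriv_eq_zero isPreconnected_upperHalf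
    (fun τ hτ => (hd τ hτ).differentiableAt.differentiableWithinAt) (fun τ hτ => (hd τ hτ).deriv)
  refine ⟨M, fun τ hτ => ?_⟩
  rw [← hM τ hτ, div_mul_cancel₀ _ (pow_ne_zero 4 (theta4_zero_ne_zero hτ))]

/-- The leading behaviour of theta series at `i∞`. -/
lemma tendsto_thetaDeriv_atTop (m : ℕ) (a : ℝ) {n : ℤ} (ha : 2 * a = n) (hn : n = 0 ∨ n = 1)
    (v : ℂ) :
    Filter.Tendsto (fun t : ℝ => exp (Real.pi * a ^ 2 * t) * thetaDeriv m a v (I * t)) Filter.atTop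
      (𝓝 (∑ k ∈ ({0, -n} : Finset ℤ), (2 * Real.pi * I * (k + a)) ^ m *
        exp (2 * Real.pi * I * (k + a) * v))) := by
  have ha' : 2 * (a : ℂ) = n := by exact_mod_cast ha
  -- Since n = 2a, (k+a)² - a² = k(k+n). This is a nonnegative integer for n = 0 or 1, and is zero
  -- only at k = 0 and k = -n: these are the leading terms.
  have hterm : ∀ (k : ℤ) (t : ℝ), exp (Real.pi * a ^ 2 * t) * thetaDerivTerm m a k v (I * t) =
      (2 * Real.pi * I * (k + a)) ^ m * exp (2 * Real.pi * I * (k + a) * v) *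
        (Real.exp (-(Real.pi * t * ((k * (k + n) : ℤ) : ℝ))) : ℂ) := by
    intro k t
    have e : exp (Real.pi * a ^ 2 * t) *
        exp (Real.pi * I * (k + a) ^ 2 * (I * t) + 2 * Real.pi * I * (k + a) * v) =
        exp (2 * Real.pi * I * (k + a) * v) * exp (-(Real.pi * t * ((k * (k + n) : ℤ) : ℝ)) : ℝ) := by
      rw [← exp_add, ← exp_add]
      congr 1
      push_cast
      rw [← ha']
      linear_combination (Real.pi * t * (k + a) ^ 2 : ℂ) * I_sq
    rw [thetaDerivTerm, ofReal_exp]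
    linear_combination (2 * (Real.pi : ℂ) * I * (k + a)) ^ m * e
  have hpos : ∀ k : ℤ, 0 ≤ k * (k + n) := by
    intro k
    rcases hn with rfl | rfl
    · nlinarith [sq_nonneg k]
    · rcases le_or_gt 0 k with h | h
      · positivity
      · exact mul_nonneg_of_nonpos_of_nonpos h.le (by omega)
  have hzero : ∀ k : ℤ, k * (k + n) = 0 ↔ k ∈ ({0, -n} : Finset ℤ) := by
    intro k
    rw [mul_eq_zero, Finset.mem_insert, Finset.mem_singleton]
    exact or_congr_right ⟨fun h => by omega, fun h => by omega⟩
  have hlim : ∀ k : ℤ, Filter.Tendsto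
      (fun t : ℝ => exp (Real.pi * a ^ 2 * t) * thetaDerivTerm m a k v (I * t)) Filter.atTop
      (𝓝 (if k ∈ ({0, -n} : Finset ℤ) then (2 * Real.pi * I * (k + a)) ^ m *
        exp (2 * Real.pi * I * (k + a) * v) else 0)) := by
    intro k
    simp only [hterm]
    split_ifs with hk
    · rw [← hzero] at hk
      simp only [hk]
      simp
    · rw [← hzero] at hk
      have hk' : (0 : ℝ) < ((k * (k + n) : ℤ) : ℝ) := by
        exact_mod_cast lt_of_le_of_ne (hpos k) (Ne.symm hk)
      rw [← mul_zero ((2 * (Real.pi : ℂ) * I * (k + a)) ^ m * exp (2 * Real.pi * I * (k + a) * v)),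
        ← ofReal_zero]
      refine Filter.Tendsto.const_mul _ ((continuous_ofReal.tendsto _).comp ?_)
      refine Real.tendsto_exp_neg_atTop_nhds_zero.comp ?_
      exact (Filter.tendsto_id.const_mul_atTop Real.pi_pos).atTop_mul_const hk'
  have hI : (0 : ℝ) < (I * (1 : ℝ)).im := by simp
  have hbound : Summable fun k : ℤ =>
      ‖exp (Real.pi * a ^ 2 * (1 : ℝ)) * thetaDerivTerm m a k v (I * (1 : ℝ))‖ :=
    ((summable_thetaDerivTerm m a v hI).mul_left _).norm
  -- The exponents are nonnegative, so each term decreases in t and is dominated by its value at t =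
  -- 1.
  have h := tendsto_tsum_of_dominated_convergence hbound hlim (by
    filter_upwards [Filter.eventually_ge_atTop 1] with t ht k
    rw [hterm, hterm, norm_mul, norm_mul _ ((Real.exp _ : ℝ) : ℂ), norm_real, norm_real,
      Real.norm_of_nonneg (Real.exp_pos _).le, Real.norm_of_nonneg (Real.exp_pos _).le]
    have hk : (0 : ℝ) ≤ ((k * (k + n) : ℤ) : ℝ) := by exact_mod_cast hpos k
    gcongr)
  rw [tsum_eq_sum (s := {0, -n}) (fun k hk => by rw [if_neg hk]),
    Finset.sum_congr rfl (fun k hk => if_pos hk)] at h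
  refine h.congr fun t => ?_
  rw [tsum_mul_left, thetaDeriv]

lemma tendsto_theta3 : Filter.Tendsto (fun t : ℝ => theta3 0 (I * t)) Filter.atTop (𝓝 1) := by
  have h := tendsto_thetaDeriv_atTop 0 0 (n := 0) (by simp) (Or.inl rfl) 0
  simpa [← theta3_eq_thetaDeriv] using h

lemma tendsto_theta4 : Filter.Tendsto (fun t : ℝ => theta4 0 (I * t)) Filter.atTop (𝓝 1) := by
  have h := tendsto_thetaDeriv_atTop 0 0 (n := 0) (by simp) (Or.inl rfl) (0 + 1 / 2)
  simp only [← theta3_eq_thetaDeriv, theta3_add_half] at h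
  simpa using h

lemma tendsto_theta2 : Filter.Tendsto
    (fun t : ℝ => exp (Real.pi / 4 * t) * theta2 0 (I * t)) Filter.atTop (𝓝 2) := by
  have h := tendsto_thetaDeriv_atTop 0 (1 / 2) (n := 1) (by simp) (Or.inr rfl) 0
  simp only [← theta2_eq_thetaDeriv] at h
  convert! h using 2
  · push_cast; ring_nf
  · simp

lemma tendsto_theta1Deriv : Filter.Tendsto
    (fun t : ℝ => exp (Real.pi / 4 * t) * theta1Deriv (I * t) 1 0) Filter.atTop
    (𝓝 (2 * Real.pi)) := by
  have h := (tendsto_thetaDeriv_atTop 1 (1 / 2) (n := 1) (by simp) (Or.inr rfl) (0 + 1 / 2)).neg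
  convert! h using 2
  · rw [theta1Deriv]; push_cast; ring_nf
  · have e1 : exp (2 * Real.pi * I * (1 / 2) * (1 / 2)) = I := by
      rw [show 2 * (Real.pi : ℂ) * I * (1 / 2) * (1 / 2) = Real.pi * I / 2 by ring,
        exp_pi_mul_I_div_two]
    have e2 : exp (2 * Real.pi * I * (-1 + 1 / 2) * (1 / 2)) = -I := by
      rw [show 2 * (Real.pi : ℂ) * I * (-1 + 1 / 2) * (1 / 2) = -(Real.pi * I / 2) by ring,
        exp_neg, exp_pi_mul_I_div_two, inv_I]
    rw [Finset.sum_insert (by simp), Finset.sum_singleton]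
    push_cast
    simp only [zero_add]
    rw [e1, e2]
    linear_combination (2 * Real.pi : ℂ) * I_sq

/-- Jacobi's derivative formula, squared. -/
lemma theta1Deriv_one_zero_sq {τ : ℂ} (hτ : 0 < τ.im) :
    theta1Deriv τ 1 0 ^ 2 = Real.pi ^ 2 * (theta2 0 τ * theta3 0 τ * theta4 0 τ) ^ 2 := by
  obtain ⟨M, hM⟩ := exists_logDeriv_const
  have hD : ∀ τ ∈ upperHalf, theta1Deriv τ 1 0 ^ 2 =
      heatConst * M * (theta2 0 τ * theta3 0 τ * theta4 0 τ) ^ 2 := by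
    intro τ hτ
    have h := hM τ hτ
    rw [logDeriv3_sub_logDeriv2 hτ] at h
    have := heatConst_ne_zero
    have := theta2_zero_ne_zero hτ
    have := theta3_zero_ne_zero hτ
    have h4 := theta4_zero_ne_zero hτ
    field_simp at h
    rw [mul_pow, mul_pow]
    linear_combination h
  have hl := tendsto_theta1Deriv.pow 2
  have hr := (((tendsto_theta2.mul tendsto_theta3).mul tendsto_theta4).pow 2).const_mul
    (heatConst * M)
  have he := tendsto_nhds_unique_of_eventuallyEq hl hr (by
    filter_upwards [Filter.eventually_gt_atTop 0] with t ht
    have := hD (I * t) (by simpa [upperHalf] using ht)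
    linear_combination (exp (Real.pi / 4 * t)) ^ 2 * this)
  -- The limits, after multiplication by exp(πt/4)², are (2π)² and `heatConst * M` times 2².
  have hc : heatConst * M = Real.pi ^ 2 := by linear_combination -he / 4
  rw [hD τ hτ, hc]

lemma logDeriv3_sub_logDeriv2_eq {τ : ℂ} (hτ : 0 < τ.im) :
    logDeriv3 τ - logDeriv2 τ = -(Real.pi * I / 4) * theta4 0 τ ^ 4 := by
  rw [logDeriv3_sub_logDeriv2 hτ, theta1Deriv_one_zero_sq hτ, heatConst]
  have := theta2_zero_ne_zero hτ
  have := theta3_zero_ne_zero hτ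
  have hpi : (Real.pi : ℂ) ≠ 0 := by exact_mod_cast Real.pi_ne_zero
  have := I_ne_zero
  field_simp
  linear_combination theta4 0 τ ^ 4 * I_sq

lemma logDeriv4_sub_logDeriv2_eq {τ : ℂ} (hτ : 0 < τ.im) :
    logDeriv4 τ - logDeriv2 τ = -(Real.pi * I / 4) * theta3 0 τ ^ 4 := by
  rw [logDeriv4_sub_logDeriv2 hτ, theta1Deriv_one_zero_sq hτ, heatConst]
  have := theta2_zero_ne_zero hτ
  have := theta4_zero_ne_zero hτ
  have hpi : (Real.pi : ℂ) ≠ 0 := by exact_mod_cast Real.pi_ne_zero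
  have := I_ne_zero
  field_simp
  linear_combination theta3 0 τ ^ 4 * I_sq

/-! ### Modular transformations of the theta constants -/

lemma jacobiTheta₂_eq_theta3 (v τ : ℂ) : jacobiTheta₂ v τ = theta3 v τ := by
  refine tsum_congr fun k => ?_
  rw [jacobiTheta₂_term, ← exp_add]
  ring_nf

/-- The multiplier of weight `1/2` in the inversion formula. -/
def inversionFactor (τ : ℂ) : ℂ := 1 / (-I * τ) ^ (1 / 2 : ℂ)

lemma inversionFactor_ne_zero {τ : ℂ} (hτ : τ ≠ 0) : inversionFactor τ ≠ 0 := by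
  simp [inversionFactor, cpow_eq_zero_iff, hτ, I_ne_zero]

lemma theta3_inversion (τ : ℂ) : theta3 0 τ = inversionFactor τ * theta3 0 (-1 / τ) := by
  have h := jacobiTheta₂_functional_equation 0 τ
  rw [jacobiTheta₂_eq_theta3, jacobiTheta₂_eq_theta3] at h
  simpa [inversionFactor] using h

/-- The functional equation of θ₃ at v = 1/2: its Gaussian factor cancels the quasi-period factor
that turns θ₃ into θ₂. Inversion of ϑ₂ uses v = τ/2 in the same way. -/
lemma theta4_inversion {τ : ℂ} (hτ : τ ≠ 0) :
    theta4 0 τ = inversionFactor τ * theta2 0 (-1 / τ) := by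
  have h := jacobiTheta₂_functional_equation (0 + 1 / 2) τ
  have h2 : (0 + 1 / 2) / τ = -(0 + (-1 / τ) / 2) := by field_simp; ring
  rw [jacobiTheta₂_eq_theta3, jacobiTheta₂_eq_theta3, theta3_add_half, h2, theta3_neg,
    theta3_add_half_period, mul_assoc, ← mul_assoc (exp _), halfPeriodFactor, ← exp_add] at h
  have h3 : -(Real.pi : ℂ) * I * (0 + 1 / 2) ^ 2 / τ +
      (-(Real.pi * I * (-1 / τ) / 4) - Real.pi * I * 0) = 0 := by field_simp; ring
  rwa [h3, exp_zero, one_mul] at h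

lemma theta2_inversion {τ : ℂ} (hτ : τ ≠ 0) :
    theta2 0 τ = inversionFactor τ * theta4 0 (-1 / τ) := by
  have h := jacobiTheta₂_functional_equation (0 + τ / 2) τ
  have h2 : (0 + τ / 2) / τ = 0 + 1 / 2 := by field_simp; ring
  have h3 : -(Real.pi : ℂ) * I * (0 + τ / 2) ^ 2 / τ
      = -(Real.pi * I * τ / 4) - Real.pi * I * 0 := by field_simp; ring
  rw [jacobiTheta₂_eq_theta3, jacobiTheta₂_eq_theta3, h2, theta3_add_half,
    theta3_add_half_period, h3, ← halfPeriodFactor] at h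
  refine mul_left_cancel₀ (halfPeriodFactor_ne_zero 0 τ) ?_
  rw [h, inversionFactor]; ring

lemma neg_one_zpow_sq (k : ℤ) : ((-1 : ℂ) ^ k) = exp ((k : ℂ) ^ 2 * (Real.pi * I)) := by
  have : ((k : ℂ) ^ 2) = ((k ^ 2 : ℤ) : ℂ) := by push_cast; ring
  rw [this, exp_int_mul_pi_mul_I]
  rcases Int.even_or_odd k with h | h
  · rw [h.neg_one_zpow, Even.neg_one_zpow (by simpa [Int.even_pow] using h)]
  · rw [h.neg_one_zpow, Odd.neg_one_zpow (by simpa [Int.odd_pow] using h)]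

lemma theta3_tau_add_one (τ : ℂ) : theta3 0 (τ + 1) = theta4 0 τ := by
  refine tsum_congr fun k => ?_
  rw [neg_one_zpow_sq, ← exp_add, ← exp_add, ← exp_add]
  ring_nf

lemma theta4_tau_add_one (τ : ℂ) : theta4 0 (τ + 1) = theta3 0 τ := by
  refine tsum_congr fun k => ?_
  have h : exp ((k : ℂ) ^ 2 * (Real.pi * I)) * exp ((k : ℂ) ^ 2 * (Real.pi * I)) = 1 := by
    rw [← neg_one_zpow_sq, ← mul_zpow]; norm_num
  rw [neg_one_zpow_sq, show (k : ℂ) ^ 2 * Real.pi * I * (τ + 1)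
    = (k : ℂ) ^ 2 * (Real.pi * I) + (k : ℂ) ^ 2 * Real.pi * I * τ by ring, exp_add, ← mul_assoc, h,
    one_mul]

lemma theta2_tau_add_one (τ : ℂ) :
    theta2 0 (τ + 1) = exp (Real.pi * I / 4) * theta2 0 τ := by
  rw [theta2, theta2, ← tsum_mul_left]
  refine tsum_congr fun k => ?_
  have h : exp ((k : ℂ) ^ 2 * (Real.pi * I)) * exp ((k : ℂ) * (Real.pi * I)) = 1 := by
    rw [← neg_one_zpow_sq, exp_int_mul_pi_mul_I, ← mul_zpow]; norm_num
  rw [show ((k : ℂ) + 1 / 2) ^ 2 * Real.pi * I * (τ + 1) = (k : ℂ) ^ 2 * (Real.pi * I) +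
    k * (Real.pi * I) + (Real.pi * I / 4 + ((k : ℂ) + 1 / 2) ^ 2 * Real.pi * I * τ) by ring,
    exp_add, exp_add ((k : ℂ) ^ 2 * _), h, one_mul, exp_add, mul_assoc]

/-! ### Theta ratios and invariance under subgroups of finite index -/

/-- The three theta constants `ϑ₂, ϑ₃, ϑ₄`. -/
def thetaNull : Fin 3 → ℂ → ℂ
  | 0, τ => theta2 0 τ
  | 1, τ => theta3 0 τ
  | 2, τ => theta4 0 τ

/-- An eighth root of unity times a quotient of theta constants. -/
def IsThetaRatio (g : ℂ → ℂ) : Prop :=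
  ∃ (ζ : ℂ) (j k : Fin 3), ζ ^ 8 = 1 ∧ g = fun τ => ζ * (thetaNull j τ / thetaNull k τ)

lemma finite_isThetaRatio : {g | IsThetaRatio g}.Finite := by
  have h8 : {ζ : ℂ | ζ ^ 8 = 1}.Finite := by
    refine (Polynomial.nthRootsFinset 8 (1 : ℂ)).finite_toSet.subset fun ζ hζ => ?_
    simpa [Polynomial.mem_nthRootsFinset] using hζ
  refine ((h8.prod (Set.finite_univ (α := Fin 3 × Fin 3))).image
    (fun p τ => p.1 * (thetaNull p.2.1 τ / thetaNull p.2.2 τ))).subset ?_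
  rintro g ⟨ζ, j, k, hζ, rfl⟩
  exact ⟨(ζ, j, k), ⟨hζ, Set.mem_univ _⟩, rfl⟩

/-- The common weight factor κ cancels in a quotient; only the permutation and the eighth roots of
unity survive. The new ratio is chosen before τ, τ' and κ, so it serves all points at once. -/
lemma IsThetaRatio.of_null_relation {g : ℂ → ℂ} (hg : IsThetaRatio g) (c : Fin 3 → ℂ)
    (σ : Fin 3 → Fin 3) (hc : ∀ j, c j ^ 8 = 1) :
    ∃ g', IsThetaRatio g' ∧ ∀ τ τ' κ : ℂ, κ ≠ 0 →
      (∀ j, thetaNull j τ = κ * (c j * thetaNull (σ j) τ')) → g τ = g' τ' := by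
  obtain ⟨ζ, j, k, hζ, rfl⟩ := hg
  refine ⟨_, ⟨ζ * (c j / c k), σ j, σ k, by rw [mul_pow, div_pow, hc, hc, hζ]; norm_num, rfl⟩,
    fun τ τ' κ hκ h => ?_⟩
  simp only
  rw [h, h, mul_div_mul_left _ _ hκ, mul_div_mul_comm, mul_assoc]

lemma exp_pi_div_four_pow_four : exp (Real.pi * I / 4) ^ 4 = -1 := by
  rw [← exp_nat_mul, ← exp_pi_mul_I]
  congr 1
  push_cast
  ring

lemma exp_pi_div_four_pow : exp (Real.pi * I / 4) ^ 8 = 1 := by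
  linear_combination (exp (Real.pi * I / 4) ^ 4 - 1) * exp_pi_div_four_pow_four

lemma IsThetaRatio.add_one {g : ℂ → ℂ} (hg : IsThetaRatio g) :
    ∃ g', IsThetaRatio g' ∧ ∀ τ : ℂ, g (τ + 1) = g' τ := by
  obtain ⟨g', hg', h⟩ := hg.of_null_relation ![exp (Real.pi * I / 4), 1, 1] ![0, 2, 1]
    (fun j => by fin_cases j <;> simp [exp_pi_div_four_pow])
  refine ⟨g', hg', fun τ => h _ _ 1 one_ne_zero fun j => ?_⟩
  fin_cases j
  · simpa [thetaNull] using theta2_tau_add_one τ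
  · simpa [thetaNull] using theta3_tau_add_one τ
  · simpa [thetaNull] using theta4_tau_add_one τ

lemma IsThetaRatio.sub_one {g : ℂ → ℂ} (hg : IsThetaRatio g) :
    ∃ g', IsThetaRatio g' ∧ ∀ τ : ℂ, g τ = g' (τ + 1) := by
  obtain ⟨g', hg', h⟩ := hg.of_null_relation ![(exp (Real.pi * I / 4))⁻¹, 1, 1] ![0, 2, 1]
    (fun j => by fin_cases j <;> simp [exp_pi_div_four_pow])
  refine ⟨g', hg', fun τ => h _ _ 1 one_ne_zero fun j => ?_⟩
  fin_cases j
  · simp [thetaNull, theta2_tau_add_one]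
  · simpa [thetaNull] using (theta4_tau_add_one τ).symm
  · simpa [thetaNull] using (theta3_tau_add_one τ).symm

lemma IsThetaRatio.inversion {g : ℂ → ℂ} (hg : IsThetaRatio g) :
    ∃ g', IsThetaRatio g' ∧ ∀ τ : ℂ, τ ≠ 0 → g τ = g' (-1 / τ) := by
  obtain ⟨g', hg', h⟩ := hg.of_null_relation ![1, 1, 1] ![2, 1, 0]
    (fun j => by fin_cases j <;> simp)
  refine ⟨g', hg', fun τ hτ => h _ _ (inversionFactor τ) (inversionFactor_ne_zero hτ) fun j => ?_⟩
  fin_cases j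
  · simpa [thetaNull] using theta2_inversion hτ
  · simpa [thetaNull] using theta3_inversion τ
  · simpa [thetaNull] using theta4_inversion hτ

lemma IsThetaRatio.inversion' {g : ℂ → ℂ} (hg : IsThetaRatio g) :
    ∃ g', IsThetaRatio g' ∧ ∀ τ : ℂ, τ ≠ 0 → g (-1 / τ) = g' τ := by
  obtain ⟨g', hg', h⟩ := hg.inversion
  refine ⟨g', hg', fun τ hτ => ?_⟩
  rw [h _ (by simp [hτ]), neg_div, neg_div, div_neg, neg_neg, one_div_one_div]

open UpperHalfPlane in
/-- A function in a finite set of functions on `ℍ` stable under the generators of `SL(2, ℤ)` is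
invariant under a subgroup of finite index. -/
lemma exists_finiteIndex_invariant {A : Set (ℍ → ℂ)} (hA : A.Finite)
    (hS : ∀ F ∈ A, (fun τ => F (ModularGroup.S • τ)) ∈ A)
    (hT : ∀ F ∈ A, (fun τ => F (ModularGroup.T • τ)) ∈ A) {F : ℍ → ℂ} (hF : F ∈ A) :
    ∃ Γ : Subgroup (Matrix.SpecialLinearGroup (Fin 2) ℤ), Γ.FiniteIndex ∧
      ∀ γ ∈ Γ, ∀ τ : ℍ, F (γ • τ) = F τ := by
  have hall : ∀ g : Matrix.SpecialLinearGroup (Fin 2) ℤ, ∀ F ∈ A, (fun τ => F (g • τ)) ∈ A := by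
    intro g
    have hg : g ∈ Subgroup.closure {ModularGroup.S, ModularGroup.T} := by
      rw [SpecialLinearGroup.SL2Z_generators]; trivial
    induction hg using Subgroup.closure_induction with
    | mem x hx =>
      rcases hx with rfl | rfl
      · exact hS
      · exact hT
    | one => simp
    | mul x y _ _ hx hy =>
      intro F hF
      have := hy _ (hx F hF)
      simpa only [mul_smul] using this
    | inv x _ hx =>
      intro F hF
      -- Translation by x is an injective map of the finite set to itself, hence surjective; thus
      -- stability under x gives stability under its inverse.
      have hmaps : Set.MapsTo (fun (F : ℍ → ℂ) τ => F (x • τ)) A A := fun F hF => hx F hF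
      have hinj : Set.InjOn (fun (F : ℍ → ℂ) τ => F (x • τ)) A := fun F _ G _ h => by
        funext τ
        have := congrFun h (x⁻¹ • τ)
        simpa using this
      obtain ⟨G, hG, hGF⟩ := (hA.injOn_iff_bijOn_of_mapsTo hmaps).1 hinj |>.surjOn hF
      have : (fun τ => F (x⁻¹ • τ)) = G := by
        rw [← hGF]; simp
      rwa [this]
  let _ : MulAction (Matrix.SpecialLinearGroup (Fin 2) ℤ) (ℍ → ℂ) := arrowAction
  refine ⟨MulAction.stabilizer _ F, ⟨?_⟩, fun γ hγ τ => ?_⟩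
  · rw [MulAction.index_stabilizer]
    -- The index of the stabiliser is the size of the orbit, which lies in the finite set.
    have hsub : MulAction.orbit (Matrix.SpecialLinearGroup (Fin 2) ℤ) F ⊆ A := by
      rintro _ ⟨g, rfl⟩
      exact hall g⁻¹ F hF
    exact (Set.ncard_pos (hA.subset hsub)).2 (MulAction.nonempty_orbit F) |>.ne'
  · have h : γ • F = F := hγ
    have h2 := congrFun h (γ • τ)
    have h3 : (γ • F) (γ • τ) = F (γ⁻¹ • γ • τ) := rfl
    rw [h3, inv_smul_smul] at h2
    exact h2.symm

open UpperHalfPlane in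
/-- Quotients of theta constants with argument `τ`, `2τ`, `τ/2` or `(τ + 1)/2`. -/
def thetaRatiosLevelTwo : Set (ℍ → ℂ) :=
  {F | ∃ g, IsThetaRatio g ∧ ((F = fun τ : ℍ => g τ) ∨ (F = fun τ : ℍ => g (2 * τ)) ∨
    (F = fun τ : ℍ => g (τ / 2)) ∨ F = fun τ : ℍ => g ((τ + 1) / 2))}

lemma finite_thetaRatiosLevelTwo : thetaRatiosLevelTwo.Finite := by
  have h := finite_isThetaRatio
  refine ((((h.image fun g (τ : UpperHalfPlane) => g τ).union
    (h.image fun g (τ : UpperHalfPlane) => g (2 * τ))).union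
    (h.image fun g (τ : UpperHalfPlane) => g (τ / 2))).union
    (h.image fun g (τ : UpperHalfPlane) => g ((τ + 1) / 2))).subset ?_
  rintro F ⟨g, hg, rfl | rfl | rfl | rfl⟩
  · exact Or.inl (Or.inl (Or.inl ⟨g, hg, rfl⟩))
  · exact Or.inl (Or.inl (Or.inr ⟨g, hg, rfl⟩))
  · exact Or.inl (Or.inr ⟨g, hg, rfl⟩)
  · exact Or.inr ⟨g, hg, rfl⟩

lemma coe_T_smul (τ : UpperHalfPlane) : ((ModularGroup.T • τ : UpperHalfPlane) : ℂ) = τ + 1 := by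
  rw [UpperHalfPlane.modular_T_smul, UpperHalfPlane.coe_vadd]; push_cast; ring

lemma coe_S_smul (τ : UpperHalfPlane) : ((ModularGroup.S • τ : UpperHalfPlane) : ℂ) = -1 / τ := by
  rw [UpperHalfPlane.modular_S_smul]
  simp [neg_div, inv_neg]

lemma thetaRatiosLevelTwo_T (F : UpperHalfPlane → ℂ) (hF : F ∈ thetaRatiosLevelTwo) :
    (fun τ => F (ModularGroup.T • τ)) ∈ thetaRatiosLevelTwo := by
  obtain ⟨g, hg, rfl | rfl | rfl | rfl⟩ := hF <;> simp only [coe_T_smul]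
  · obtain ⟨g', hg', h⟩ := hg.add_one
    exact ⟨g', hg', Or.inl (funext fun τ => h _)⟩
  · obtain ⟨g', hg', h⟩ := hg.add_one
    obtain ⟨g'', hg'', h'⟩ := hg'.add_one
    refine ⟨g'', hg'', Or.inr (Or.inl (funext fun τ => ?_))⟩
    rw [← h', ← h]; ring_nf
  · exact ⟨g, hg, Or.inr (Or.inr (Or.inr rfl))⟩
  · obtain ⟨g', hg', h⟩ := hg.add_one
    refine ⟨g', hg', Or.inr (Or.inr (Or.inl (funext fun τ => ?_)))⟩
    rw [← h]; ring_nf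

lemma ne_zero_of_im_ne_zero {z : ℂ} (h : z.im ≠ 0) : z ≠ 0 := fun h0 => h (by simp [h0])

/-- Inversion preserves the argument τ, exchanges 2τ with τ/2, and preserves (τ+1)/2 after a further
modular substitution. -/
lemma thetaRatiosLevelTwo_S (F : UpperHalfPlane → ℂ) (hF : F ∈ thetaRatiosLevelTwo) :
    (fun τ => F (ModularGroup.S • τ)) ∈ thetaRatiosLevelTwo := by
  have hne : ∀ τ : UpperHalfPlane, (τ : ℂ) ≠ 0 := fun τ => τ.ne_zero
  obtain ⟨g, hg, rfl | rfl | rfl | rfl⟩ := hF <;> simp only [coe_S_smul]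
  · obtain ⟨g', hg', h⟩ := hg.inversion'
    exact ⟨g', hg', Or.inl (funext fun τ => h _ (hne τ))⟩
  · obtain ⟨g', hg', h⟩ := hg.inversion'
    refine ⟨g', hg', Or.inr (Or.inr (Or.inl (funext fun τ => ?_)))⟩
    have := hne τ
    rw [← h _ (by simp [this])]
    congr 1
    field_simp
  · obtain ⟨g', hg', h⟩ := hg.inversion'
    refine ⟨g', hg', Or.inr (Or.inl (funext fun τ => ?_))⟩
    have := hne τ
    rw [← h _ (by simp [this])]
    congr 1
    field_simp
  -- With w = (τ-1)/(2τ), -1/w + 2 = -1/((τ-1)/2). A second inversion gives (τ-1)/2, and adding 1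
  -- gives (τ+1)/2.
  · obtain ⟨g₁, hg₁, h₁⟩ := hg.inversion
    obtain ⟨g₂, hg₂, h₂⟩ := hg₁.sub_one
    obtain ⟨g₃, hg₃, h₃⟩ := hg₂.sub_one
    obtain ⟨g₄, hg₄, h₄⟩ := hg₃.inversion'
    obtain ⟨g₅, hg₅, h₅⟩ := hg₄.sub_one
    refine ⟨g₅, hg₅, Or.inr (Or.inr (Or.inr (funext fun τ => ?_)))⟩
    have h0 := hne τ
    have h1 : (τ : ℂ) - 1 ≠ 0 := ne_zero_of_im_ne_zero (by simpa using τ.im_ne_zero)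
    have e1 : (-1 / (τ : ℂ) + 1) / 2 ≠ 0 := by
      rw [show (-1 / (τ : ℂ) + 1) / 2 = (τ - 1) / (2 * τ) by field_simp; ring]
      exact div_ne_zero h1 (by simp [h0])
    have e2 : -1 / ((-1 / (τ : ℂ) + 1) / 2) + 1 + 1 = -1 / (((τ : ℂ) - 1) / 2) := by
      rw [show (-1 / (τ : ℂ) + 1) / 2 = (τ - 1) / (2 * τ) by field_simp; ring]
      field_simp
      ring
    rw [h₁ _ e1, h₂, h₃, e2, h₄ _ (by simpa using h1), h₅]
    ring_nf

/-- The involution-like map `(τ - 1)/(τ + 1)` in terms of the generators. -/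
lemma sub_div_add_eq {τ : ℂ} (hτ : 0 < τ.im) :
    (τ - 1) / (τ + 1) = -1 / ((τ + 1) / 2) + 1 := by
  have : τ + 1 ≠ 0 := ne_zero_of_im_ne_zero (by simpa using hτ.ne')
  field_simp
  ring

lemma IsThetaRatio.mem_levelTwo {g : ℂ → ℂ} (hg : IsThetaRatio g) :
    (fun τ : UpperHalfPlane => g τ) ∈ thetaRatiosLevelTwo := ⟨g, hg, Or.inl rfl⟩

lemma IsThetaRatio.comp_mem_levelTwo {g : ℂ → ℂ} (hg : IsThetaRatio g) :
    (fun τ : UpperHalfPlane => g ((τ - 1) / (τ + 1))) ∈ thetaRatiosLevelTwo := by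
  obtain ⟨g', hg', h⟩ := hg.add_one
  obtain ⟨g'', hg'', h'⟩ := hg'.inversion'
  refine ⟨g'', hg'', Or.inr (Or.inr (Or.inr (funext fun τ => ?_)))⟩
  have h1 : (τ : ℂ) + 1 ≠ 0 := ne_zero_of_im_ne_zero (by simpa using τ.im_ne_zero)
  rw [sub_div_add_eq τ.im_pos, h, h' _ (by simpa using h1)]

lemma exists_finiteIndex_of_mem_levelTwo {F G : UpperHalfPlane → ℂ} (hF : F ∈ thetaRatiosLevelTwo)
    (hG : G ∈ thetaRatiosLevelTwo) :
    ∃ Γ : Subgroup (Matrix.SpecialLinearGroup (Fin 2) ℤ), Γ.FiniteIndex ∧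
      ∀ γ ∈ Γ, ∀ τ : UpperHalfPlane, F (γ • τ) = F τ ∧ G (γ • τ) = G τ := by
  obtain ⟨Γ₁, h₁, hΓ₁⟩ := exists_finiteIndex_invariant finite_thetaRatiosLevelTwo
    thetaRatiosLevelTwo_S thetaRatiosLevelTwo_T hF
  obtain ⟨Γ₂, h₂, hΓ₂⟩ := exists_finiteIndex_invariant finite_thetaRatiosLevelTwo
    thetaRatiosLevelTwo_S thetaRatiosLevelTwo_T hG
  exact ⟨Γ₁ ⊓ Γ₂, inferInstance, fun γ hγ τ => ⟨hΓ₁ γ hγ.1 τ, hΓ₂ γ hγ.2 τ⟩⟩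

/-! ### Doubling formulas and the Möbius image of λ -/

/-- Pairs of integers with even, respectively odd, coordinate sum. -/
lemma hasSum_int_prod_of_parity {f : ℤ × ℤ → ℂ} {a b : ℂ}
    (h0 : HasSum (fun p : ℤ × ℤ => f (p.1 + p.2, p.1 - p.2)) a)
    (h1 : HasSum (fun p : ℤ × ℤ => f (p.1 + p.2 + 1, p.1 - p.2)) b) : HasSum f (a + b) := by
  have i0 : Function.Injective fun p : ℤ × ℤ => (p.1 + p.2, p.1 - p.2) := by
    rintro ⟨s, t⟩ ⟨s', t'⟩ h
    simp only [Prod.mk.injEq] at h ⊢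
    omega
  have i1 : Function.Injective fun p : ℤ × ℤ => (p.1 + p.2 + 1, p.1 - p.2) := by
    rintro ⟨s, t⟩ ⟨s', t'⟩ h
    simp only [Prod.mk.injEq] at h ⊢
    omega
  refine (i0.hasSum_range_iff.2 h0).add_isCompl ?_ (i1.hasSum_range_iff.2 h1)
  refine ⟨Set.disjoint_left.2 ?_, codisjoint_iff.2 (Set.eq_univ_of_forall ?_)⟩
  · rintro _ ⟨⟨s, t⟩, rfl⟩ ⟨⟨s', t'⟩, h⟩
    simp only [Prod.mk.injEq] at h
    omega
  · rintro ⟨m, n⟩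
    rcases Int.even_or_odd (m + n) with ⟨k, hk⟩ | ⟨k, hk⟩
    · exact Or.inl ⟨(k, m - k), by simp only [Prod.mk.injEq]; omega⟩
    · exact Or.inr ⟨(k, m - 1 - k), by simp only [Prod.mk.injEq]; omega⟩

lemma hasSum_thetaDeriv_mul_self (a : ℝ) {τ : ℂ} (hτ : 0 < τ.im) :
    HasSum (fun p : ℤ × ℤ => thetaDerivTerm 0 a p.1 0 τ * thetaDerivTerm 0 a p.2 0 τ)
      (thetaDeriv 0 a 0 τ ^ 2) := by
  have h := summable_norm_thetaDerivTerm 0 a 0 hτ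
  rw [sq, thetaDeriv, tsum_mul_tsum_of_summable_norm h h]
  exact (summable_mul_of_summable_norm h h).hasSum

/-- In the double series over (m, n), pairs (s+t, s-t) have m² + n² = 2(s² + t²), while pairs
(s+t+1, s-t) give 2((s+1/2)² + (t+1/2)²). The two parity classes are ϑ₃² and ϑ₂² at 2τ. -/
lemma theta3_sq_double {τ : ℂ} (hτ : 0 < τ.im) :
    theta3 0 τ ^ 2 = theta3 0 (2 * τ) ^ 2 + theta2 0 (2 * τ) ^ 2 := by
  have h2 : 0 < (2 * τ).im := by simpa using hτ
  simp only [theta3_eq_thetaDeriv, theta2_eq_thetaDeriv]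
  refine (hasSum_thetaDeriv_mul_self 0 hτ).unique (hasSum_int_prod_of_parity ?_ ?_)
  · convert! hasSum_thetaDeriv_mul_self 0 h2 using 2 with p
    simp only [thetaDerivTerm, pow_zero, one_mul, ← exp_add]
    push_cast
    ring_nf
  · convert! hasSum_thetaDeriv_mul_self (1 / 2) h2 using 2 with p
    simp only [thetaDerivTerm, pow_zero, one_mul, ← exp_add]
    push_cast
    ring_nf

lemma theta4_sq_double {τ : ℂ} (hτ : 0 < τ.im) :
    theta4 0 τ ^ 2 = theta3 0 (2 * τ) ^ 2 - theta2 0 (2 * τ) ^ 2 := by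
  have h := theta3_sq_double (τ := τ + 1) (by simpa using hτ)
  have e := exp_pi_div_four_pow_four
  rw [theta3_tau_add_one, show 2 * (τ + 1) = 2 * τ + 1 + 1 by ring, theta3_tau_add_one,
    theta4_tau_add_one, theta2_tau_add_one, theta2_tau_add_one] at h
  linear_combination h + theta2 0 (2 * τ) ^ 2 * e

/-- The modular function `λ = ϑ₂⁴/ϑ₃⁴`. -/
def modularLambda (τ : ℂ) : ℂ := theta2 0 τ ^ 4 / theta3 0 τ ^ 4

lemma modularLambda_mul_sub_one {τ : ℂ} (hτ : 0 < τ.im) :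
    modularLambda τ * (modularLambda τ - 1) =
      -(theta2 0 τ ^ 4 * theta4 0 τ ^ 4 / theta3 0 τ ^ 8) := by
  have h3 := theta3_zero_ne_zero hτ
  have h := jacobi_identity hτ
  rw [modularLambda]
  field_simp
  linear_combination -theta2 0 τ ^ 4 * h

/-- With w = (τ+1)/2 the Möbius image is -1/w + 1, so its theta constants are those of w permuted,
up to a common factor and a root of unity. The doubling formulas with 2w = τ + 1 lead from w back to
τ. -/
lemma modularLambda_mobius {τ : ℂ} (hτ : 0 < τ.im) :
    (modularLambda τ * (modularLambda τ - 1)) * (modularLambda ((τ - 1) / (τ + 1)) *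
      (modularLambda ((τ - 1) / (τ + 1)) - 1)) = 1 / 16 := by
  set w := (τ + 1) / 2 with hw
  have hwim : 0 < w.im := by simpa [hw] using hτ
  have hw0 : w ≠ 0 := ne_zero_of_im_ne_zero hwim.ne'
  have hm : 0 < ((τ - 1) / (τ + 1)).im := by
    rw [sub_div_add_eq hτ, ← hw, add_im, one_im, add_zero, neg_div, neg_im, one_div, inv_im,
      neg_div, neg_neg]
    exact div_pos hwim (normSq_pos.2 hw0)
  have e := exp_pi_div_four_pow_four
  have k0 := inversionFactor_ne_zero hw0
  have a2 : theta2 0 ((τ - 1) / (τ + 1)) ^ 4 = -(theta4 0 w / inversionFactor w) ^ 4 := by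
    rw [theta4_inversion hw0, sub_div_add_eq hτ, ← hw, theta2_tau_add_one, mul_pow, e]
    field_simp
  have a3 : theta3 0 ((τ - 1) / (τ + 1)) ^ 4 = (theta2 0 w / inversionFactor w) ^ 4 := by
    rw [theta2_inversion hw0, sub_div_add_eq hτ, ← hw, theta3_tau_add_one]
    field_simp
  have a4 : theta4 0 ((τ - 1) / (τ + 1)) ^ 4 = (theta3 0 w / inversionFactor w) ^ 4 := by
    rw [theta3_inversion w, sub_div_add_eq hτ, ← hw, theta4_tau_add_one]
    field_simp
  have d3 := theta3_sq_double hwim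
  have d4 := theta4_sq_double hwim
  have d := jacobi_identity hwim
  have dd := jacobi_identity (τ := 2 * w) (by simpa using hwim)
  have t : 2 * w = τ + 1 := by rw [hw]; ring
  rw [t, theta3_tau_add_one] at d3 d4
  have e2 : (exp (Real.pi * I / 4) * theta2 0 τ) ^ 4 = -theta2 0 τ ^ 4 := by
    rw [mul_pow, e]; ring
  rw [theta2_tau_add_one] at d3 d4
  -- Jacobi's identity and doubling give ϑ₂(w)⁴ = ϑ₃(w)⁴ - ϑ₄(w)⁴ = 4ϑ₃(2w)²ϑ₂(2w)²; its square is
  -- the source of the 16.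
  have f2 : theta2 0 w ^ 8 = -16 * theta2 0 τ ^ 4 * theta4 0 τ ^ 4 := by
    have : theta2 0 w ^ 4 = 4 * theta4 0 τ ^ 2 * (exp (Real.pi * I / 4) * theta2 0 τ) ^ 2 := by
      linear_combination -d + (theta3 0 w ^ 2 + theta4 0 τ ^ 2 + (exp (Real.pi * I / 4) * theta2 0 τ) ^ 2) * d3
        - (theta4 0 w ^ 2 + theta4 0 τ ^ 2 - (exp (Real.pi * I / 4) * theta2 0 τ) ^ 2) * d4
    rw [show theta2 0 w ^ 8 = (theta2 0 w ^ 4) ^ 2 by ring, this]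
    linear_combination 16 * theta4 0 τ ^ 4 * e2
  have f34 : theta3 0 w ^ 2 * theta4 0 w ^ 2 = theta3 0 τ ^ 4 := by
    rw [d3, d4, jacobi_identity hτ]
    linear_combination -e2
  have n2 := theta2_zero_ne_zero hτ
  have n3 := theta3_zero_ne_zero hτ
  have n4 := theta4_zero_ne_zero hτ
  have n2w := theta2_zero_ne_zero hwim
  rw [modularLambda_mul_sub_one hτ, modularLambda_mul_sub_one hm,
    show theta3 0 ((τ - 1) / (τ + 1)) ^ 8 = (theta3 0 ((τ - 1) / (τ + 1)) ^ 4) ^ 2 by ring, a2, a3, a4]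
  have key : -(-(theta4 0 w / inversionFactor w) ^ 4 * (theta3 0 w / inversionFactor w) ^ 4 /
      ((theta2 0 w / inversionFactor w) ^ 4) ^ 2)
      = (theta3 0 w ^ 2 * theta4 0 w ^ 2) ^ 2 / theta2 0 w ^ 8 := by
    field_simp
  rw [key, f34, f2]
  field_simp

/-- The quotient is small near the cusp 1: at τ = 1 + i/t its modulus is that of ϑ₂⁴/ϑ₄⁴ at it,
which tends to 0 as t grows. -/
lemma exists_norm_theta_quotient_lt_one :
    ∃ τ₀ ∈ upperHalf, ‖thetaConst3 τ₀ ^ 4 / thetaConst2 τ₀ ^ 4‖ < 1 := by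
  have h2 : Filter.Tendsto (fun t : ℝ => theta2 0 (I * t)) Filter.atTop (𝓝 0) := by
    have hexp : Filter.Tendsto (fun t : ℝ => exp (-(Real.pi / 4 * t))) Filter.atTop (𝓝 0) := by
      rw [tendsto_exp_nhds_zero_iff]
      have : (fun t : ℝ => (-((Real.pi : ℂ) / 4 * t)).re) = fun t : ℝ => -(Real.pi / 4 * t) := by
        funext t
        rw [show (-((Real.pi : ℂ) / 4 * t)) = ((-(Real.pi / 4 * t) : ℝ) : ℂ) by push_cast; ring,
          ofReal_re]
      rw [this]
      exact Filter.tendsto_neg_atTop_atBot.comp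
        (Filter.tendsto_id.const_mul_atTop (by positivity))
    have := hexp.mul tendsto_theta2
    rw [zero_mul] at this
    refine this.congr fun t => ?_
    rw [← mul_assoc, ← exp_add, neg_add_cancel, exp_zero, one_mul]
  have hlim : Filter.Tendsto (fun t : ℝ => ‖theta2 0 (I * t) ^ 4 / theta4 0 (I * t) ^ 4‖)
      Filter.atTop (𝓝 0) := by
    have := ((h2.pow 4).div (tendsto_theta4.pow 4) (by norm_num)).norm
    simpa using this
  obtain ⟨t, ht, ht0⟩ := ((hlim.eventually_lt_const one_pos).and
    (Filter.eventually_gt_atTop 0)).exists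
  have hI : (I * t : ℂ) ≠ 0 := mul_ne_zero I_ne_zero (by exact_mod_cast ht0.ne')
  have k0 := inversionFactor_ne_zero hI
  have him : 0 < (-1 / (I * t : ℂ)).im := by
    rw [show -1 / (I * t : ℂ) = I * ((1 / t : ℝ) : ℂ) by
      have : (t : ℂ) ≠ 0 := by exact_mod_cast ht0.ne'
      push_cast
      field_simp
      simp]
    simpa using ht0
  refine ⟨-1 / (I * t) + 1, by simpa [upperHalf] using him, ?_⟩
  rw [thetaConst2_eq, thetaConst3_eq, theta3_tau_add_one, theta2_tau_add_one]
  rw [theta2_inversion hI, theta4_inversion hI, mul_pow, mul_pow, mul_div_mul_left _ _ (pow_ne_zero 4 k0)] at ht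
  have hn : ‖exp (Real.pi * I / 4)‖ = 1 := by
    rw [show (Real.pi : ℂ) * I / 4 = ((Real.pi / 4 : ℝ) : ℂ) * I by push_cast; ring,
      norm_exp_ofReal_mul_I]
  rw [mul_pow, norm_div, norm_mul, norm_pow (exp _) 4, hn, one_pow, one_mul, ← norm_div]
  exact ht

/-! ### The modulus i and the lemniscate function -/

lemma I_im_pos : 0 < I.im := by simp

lemma theta4_zero_I : theta4 0 I = theta2 0 I := by
  rw [theta4_inversion I_ne_zero, inversionFactor]
  simp

lemma theta3_zero_I_pow : theta3 0 I ^ 4 = 2 * theta2 0 I ^ 4 := by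
  rw [jacobi_identity I_im_pos, theta4_zero_I]; ring

/-- Since ϑ₂(i) = ϑ₄(i), the expressions of θ₂² and θ₄² through θ₁² and θ₃² are a difference and a
sum with equal coefficients. Their product gives this identity, the sum of their squares the next.
-/
lemma theta2_sq_mul_theta4_sq_I (v : ℂ) : theta2 v I ^ 2 * theta4 v I ^ 2 * theta3 0 I ^ 4 =
    theta2 0 I ^ 4 * (theta3 v I ^ 4 - theta1 v I ^ 4) := by
  have h2 := theta2_sq_eq I_im_pos v
  have h4 := theta4_sq_eq I_im_pos v
  rw [theta4_zero_I] at h2 h4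
  linear_combination (theta4 v I ^ 2 * theta3 0 I ^ 2) * h2 +
    (theta2 0 I ^ 2 * theta3 v I ^ 2 - theta2 0 I ^ 2 * theta1 v I ^ 2) * h4

lemma theta2_pow_add_theta4_pow_I (v : ℂ) : theta2 v I ^ 4 + theta4 v I ^ 4 =
    theta1 v I ^ 4 + theta3 v I ^ 4 := by
  have h2 := theta2_sq_eq I_im_pos v
  have h4 := theta4_sq_eq I_im_pos v
  have h3 := theta3_zero_I_pow
  rw [theta4_zero_I] at h2 h4
  refine mul_right_cancel₀ (pow_ne_zero 4 (theta3_zero_ne_zero I_im_pos)) ?_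
  linear_combination (theta2 v I ^ 2 * theta3 0 I ^ 2 +
    (theta2 0 I ^ 2 * theta3 v I ^ 2 - theta2 0 I ^ 2 * theta1 v I ^ 2)) * h2 +
    (theta4 v I ^ 2 * theta3 0 I ^ 2 +
    (theta2 0 I ^ 2 * theta3 v I ^ 2 + theta2 0 I ^ 2 * theta1 v I ^ 2)) * h4 -
    (theta1 v I ^ 4 + theta3 v I ^ 4) * h3

lemma mem_squarePeriods_lattice {z : ℂ} :
    z ∈ squarePeriods.lattice ↔ ∃ m n : ℤ, z = 2 * m + 2 * n * I := by
  rw [PeriodPair.mem_lattice]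
  refine exists_congr fun m => exists_congr fun n => ?_
  rw [eq_comm]
  simp only [squarePeriods]
  ring_nf

lemma mem_punctures {u : ℂ} : u ∈ punctures ↔ ∃ m n : ℤ, u = m + n * I := by
  simp only [punctures, Set.mem_ofPred_eq, mem_squarePeriods_lattice]
  refine exists_congr fun m => exists_congr fun n => ?_
  exact ⟨fun h => by linear_combination h / 2, fun h => by linear_combination 2 * h⟩

lemma theta_ne_zero_of_notMem_punctures {u : ℂ} (hu : u ∉ punctures) :
    theta1 (u / 2) I ≠ 0 ∧ theta2 (u / 2) I ≠ 0 ∧ theta3 (u / 2) I ≠ 0 ∧ theta4 (u / 2) I ≠ 0 := by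
  refine ⟨fun h => hu ?_, fun h => hu ?_, fun h => hu ?_, fun h => hu ?_⟩
  · obtain ⟨m, n, h⟩ := (theta1_eq_zero_iff I_im_pos).1 h
    exact mem_punctures.2 ⟨2 * m, 2 * n, by push_cast; linear_combination 2 * h⟩
  · obtain ⟨m, n, h⟩ := (theta2_eq_zero_iff I_im_pos).1 h
    exact mem_punctures.2 ⟨2 * m + 1, 2 * n, by push_cast; linear_combination 2 * h⟩
  · obtain ⟨m, n, h⟩ := (theta3_eq_zero_iff I_im_pos).1 h
    exact mem_punctures.2 ⟨2 * m + 1, 2 * n + 1, by push_cast; linear_combination 2 * h⟩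
  · obtain ⟨m, n, h⟩ := (theta4_eq_zero_iff I_im_pos).1 h
    exact mem_punctures.2 ⟨2 * m, 2 * n + 1, by push_cast; linear_combination 2 * h⟩

lemma notMem_punctures_of_theta_ne_zero {u : ℂ} (h1 : theta1 (u / 2) I ≠ 0)
    (h2 : theta2 (u / 2) I ≠ 0) (h3 : theta3 (u / 2) I ≠ 0) (h4 : theta4 (u / 2) I ≠ 0) :
    u ∉ punctures := by
  intro hu
  obtain ⟨m, n, rfl⟩ := mem_punctures.1 hu
  rcases Int.even_or_odd' m with ⟨m, rfl | rfl⟩ <;> rcases Int.even_or_odd' n with ⟨n, rfl | rfl⟩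
  · exact h1 ((theta1_eq_zero_iff I_im_pos).2 ⟨m, n, by push_cast; ring⟩)
  · exact h4 ((theta4_eq_zero_iff I_im_pos).2 ⟨m, n, by push_cast; ring⟩)
  · exact h2 ((theta2_eq_zero_iff I_im_pos).2 ⟨m, n, by push_cast; ring⟩)
  · exact h3 ((theta3_eq_zero_iff I_im_pos).2 ⟨m, n, by push_cast; ring⟩)

lemma isOpen_compl_punctures : IsOpen puncturesᶜ :=
  squarePeriods.isClosed_lattice.isOpen_compl.preimage (continuous_const.mul continuous_id)

/-- The derivative at `0` of the lemniscate function. -/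
def lemniscateConst : ℂ := Real.pi / 2 * theta2 0 I ^ 2

lemma lemniscateConst_ne_zero : lemniscateConst ≠ 0 := by
  simp [lemniscateConst, Real.pi_ne_zero, theta2_zero_ne_zero I_im_pos]

/-- The sign in Jacobi's formula for `θ₁'(0|i)`. -/
def thetaSign : ℂ := theta1Deriv I 1 0 / (Real.pi * (theta2 0 I * theta3 0 I * theta4 0 I))

lemma thetaSign_sq : thetaSign ^ 2 = 1 := by
  have h2 := theta2_zero_ne_zero I_im_pos
  have h3 := theta3_zero_ne_zero I_im_pos
  have h4 := theta4_zero_ne_zero I_im_pos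
  have hp : (Real.pi : ℂ) ≠ 0 := by exact_mod_cast Real.pi_ne_zero
  rw [thetaSign, div_pow, theta1Deriv_one_zero_sq I_im_pos]
  field_simp

lemma theta1Deriv_one_zero_I : theta1Deriv I 1 0 =
    thetaSign * (Real.pi * (theta2 0 I * theta3 0 I * theta4 0 I)) := by
  have h2 := theta2_zero_ne_zero I_im_pos
  have h3 := theta3_zero_ne_zero I_im_pos
  have h4 := theta4_zero_ne_zero I_im_pos
  have hp : (Real.pi : ℂ) ≠ 0 := by exact_mod_cast Real.pi_ne_zero
  rw [thetaSign]
  field_simp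

/-- The lemniscate function `sl`, a solution of `y'² = c² (1 - y⁴)` with `y(0) = 0`. -/
def lemniscate (u : ℂ) : ℂ := thetaSign * (theta1 (u / 2) I / theta3 (u / 2) I)

/-- The derivative of `lemniscate`. -/
def lemniscateDeriv (u : ℂ) : ℂ :=
  Real.pi / 2 * theta3 0 I ^ 2 * (theta2 (u / 2) I * theta4 (u / 2) I / theta3 (u / 2) I ^ 2)

lemma lemniscate_pow_four (u : ℂ) :
    lemniscate u ^ 4 = theta1 (u / 2) I ^ 4 / theta3 (u / 2) I ^ 4 := by
  rw [lemniscate, mul_pow, div_pow, show thetaSign ^ 4 = (thetaSign ^ 2) ^ 2 by ring, thetaSign_sq]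
  ring

/-- The Wronskian formula for θ₁/θ₃ together with Jacobi's value of θ₁'(0|i). Including `thetaSign`
makes the sign in that value irrelevant. -/
lemma hasDerivAt_lemniscate {u : ℂ} (hu : theta3 (u / 2) I ≠ 0) :
    HasDerivAt lemniscate (lemniscateDeriv u) u := by
  have hd : HasDerivAt (fun u : ℂ => u / 2) (1 / 2) u := (hasDerivAt_id u).div_const 2
  have d1 := (isDerivChain_theta1 I_im_pos 0 (u / 2)).comp u hd
  have d3 := (isDerivChain_theta3 I_im_pos 0 (u / 2)).comp u hd
  simp only [Function.comp_def, theta1Deriv_zero, theta3Deriv_zero] at d1 d3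
  refine ((d1.fun_div d3 hu).const_mul thetaSign).congr_deriv ?_
  have h := wronskian_theta1_theta3 I_im_pos (u / 2)
  rw [theta1Deriv_one_zero_I] at h
  have h2 := theta2_zero_ne_zero I_im_pos
  have h4 := theta4_zero_ne_zero I_im_pos
  have hs := thetaSign_sq
  have h' : (theta1Deriv I 1 (u / 2) * theta3 (u / 2) I - theta1 (u / 2) I * theta3Deriv I 1 (u / 2)) =
    thetaSign * Real.pi * theta3 0 I ^ 2 * (theta2 (u / 2) I * theta4 (u / 2) I) := by
    refine mul_right_cancel₀ (mul_ne_zero h2 h4) ?_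
    rw [h]; ring
  rw [lemniscateDeriv]
  field_simp
  linear_combination (thetaSign * h' + Real.pi * theta3 0 I ^ 2 * (theta2 (u / 2) I * theta4 (u / 2) I) * hs)

lemma lemniscateDeriv_sq {u : ℂ} (hu : theta3 (u / 2) I ≠ 0) :
    lemniscateDeriv u ^ 2 = lemniscateConst ^ 2 * (1 - lemniscate u ^ 4) := by
  have h := theta2_sq_mul_theta4_sq_I (u / 2)
  rw [lemniscate_pow_four, lemniscateDeriv, lemniscateConst]
  field_simp
  linear_combination h

/-- Differentiate y'² = c²(1 - y⁴) and cancel 2y', which is nonzero off the punctures. -/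
lemma hasDerivAt_lemniscateDeriv {u : ℂ} (hu : u ∉ punctures) :
    HasDerivAt lemniscateDeriv (-2 * lemniscateConst ^ 2 * lemniscate u ^ 3) u := by
  obtain ⟨h1, h2, h3, h4⟩ := theta_ne_zero_of_notMem_punctures hu
  have hn : lemniscateDeriv u ≠ 0 := by
    simp [lemniscateDeriv, Real.pi_ne_zero, h2, h3, h4, theta3_zero_ne_zero I_im_pos]
  have hd : DifferentiableAt ℂ lemniscateDeriv u := by
    have d2 := (differentiable_theta2 I_im_pos).comp (differentiable_id.div_const (2 : ℂ))
    have d3 := (differentiable_theta3 I_im_pos).comp (differentiable_id.div_const (2 : ℂ))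
    have d4 := (differentiable_theta4 I_im_pos).comp (differentiable_id.div_const (2 : ℂ))
    exact (((d2 u).mul (d4 u)).div ((d3 u).pow 2) (pow_ne_zero 2 h3)).const_mul _
  have e1 := hd.hasDerivAt.fun_pow 2
  have e2 : HasDerivAt (fun u => lemniscateDeriv u ^ 2)
      (lemniscateConst ^ 2 * -(4 * lemniscate u ^ 3 * lemniscateDeriv u)) u := by
    have := (((hasDerivAt_lemniscate h3).fun_pow 4).const_sub 1).const_mul (lemniscateConst ^ 2)
    refine (this.congr_of_eventuallyEq ?_).congr_deriv (by norm_num)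
    filter_upwards [isOpen_compl_punctures.mem_nhds hu] with w hw
    exact lemniscateDeriv_sq (theta_ne_zero_of_notMem_punctures hw).2.2.1
  have h := e1.unique e2
  refine hd.hasDerivAt.congr_deriv (mul_left_cancel₀ hn ?_)
  linear_combination h / 2

lemma lemniscate_ne_zero {u : ℂ} (hu : u ∉ punctures) : lemniscate u ≠ 0 := by
  obtain ⟨h1, h2, h3, h4⟩ := theta_ne_zero_of_notMem_punctures hu
  refine mul_ne_zero (fun h => ?_) (div_ne_zero h1 h3)
  have := thetaSign_sq
  simp [h] at this

lemma lemniscateDeriv_ne_zero {u : ℂ} (hu : u ∉ punctures) : lemniscateDeriv u ≠ 0 := by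
  obtain ⟨h1, h2, h3, h4⟩ := theta_ne_zero_of_notMem_punctures hu
  simp [lemniscateDeriv, Real.pi_ne_zero, h2, h3, h4, theta3_zero_ne_zero I_im_pos]

lemma lemniscate_pow_four_ne_one {u : ℂ} (hu : u ∉ punctures) : 1 - lemniscate u ^ 4 ≠ 0 := by
  intro h
  have := lemniscateDeriv_sq (theta_ne_zero_of_notMem_punctures hu).2.2.1
  rw [h, mul_zero] at this
  exact lemniscateDeriv_ne_zero hu (pow_eq_zero_iff (by norm_num) |>.1 this)

lemma lemniscate_zero : lemniscate 0 = 0 := by simp [lemniscate, theta1_zero]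

lemma lemniscateDeriv_zero : lemniscateDeriv 0 = lemniscateConst := by
  rw [lemniscateDeriv, lemniscateConst, zero_div, theta4_zero_I]
  have := theta3_zero_ne_zero I_im_pos
  field_simp

/-! ### The Weierstrass function as a theta quotient -/

lemma I_mul_mem_lattice {z : ℂ} (hz : z ∈ squarePeriods.lattice) :
    I * z ∈ squarePeriods.lattice := by
  obtain ⟨m, n, rfl⟩ := mem_squarePeriods_lattice.1 hz
  exact mem_squarePeriods_lattice.2 ⟨-n, m, by push_cast; linear_combination 2 * n * I_sq⟩

/-- Multiplication by `i` on the square lattice. -/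
def mulILattice : squarePeriods.lattice ≃ squarePeriods.lattice where
  toFun l := ⟨I * l, I_mul_mem_lattice l.2⟩
  invFun l := ⟨-(I * l), neg_mem (I_mul_mem_lattice l.2)⟩
  left_inv l := Subtype.ext (by linear_combination -(l : ℂ) * I_sq)
  right_inv l := Subtype.ext (by linear_combination -(l : ℂ) * I_sq)

lemma weierstrassP_I_mul (z : ℂ) :
    squarePeriods.weierstrassP (I * z) = -squarePeriods.weierstrassP z := by
  rw [PeriodPair.weierstrassP, PeriodPair.weierstrassP, ← mulILattice.tsum_eq, ← tsum_neg]
  refine tsum_congr fun l => ?_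
  simp only [mulILattice, Equiv.coe_fn_mk]
  rw [← mul_sub, mul_pow, mul_pow, I_sq, neg_one_mul, neg_one_mul, div_neg, div_neg]
  ring

/-- Multiplication by i fixes 1 + i modulo the lattice and reverses the sign of ℘. This zero later
fixes the additive constant. -/
lemma weierstrassP_one_add_I : squarePeriods.weierstrassP (1 + I) = 0 := by
  have h := weierstrassP_I_mul (1 + I)
  have hl : (2 : ℂ) ∈ squarePeriods.lattice := mem_squarePeriods_lattice.2 ⟨1, 0, by simp⟩
  have h2 := squarePeriods.weierstrassP_add_coe (I * (1 + I)) ⟨2, hl⟩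
  rw [show I * (1 + I) + ((⟨2, hl⟩ : squarePeriods.lattice) : ℂ) = 1 + I by
    simp only; linear_combination I_sq, h] at h2
  linear_combination h2 / 2

/-- The product `θ₁θ₂θ₃θ₄(z/4|i)`. -/
def thetaProd (z : ℂ) : ℂ :=
  theta1 (z / 4) I * theta2 (z / 4) I * theta3 (z / 4) I * theta4 (z / 4) I

/-- `θ₁⁴ + θ₃⁴` at `z/4`. -/
def thetaPowSum (z : ℂ) : ℂ := theta1 (z / 4) I ^ 4 + theta3 (z / 4) I ^ 4

/-- The theta quotient representing `℘(z|i)`. -/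
def weierstrassTheta (z : ℂ) : ℂ :=
  Real.pi ^ 2 * theta2 0 I ^ 4 / 32 * (thetaPowSum z / thetaProd z) ^ 2

lemma thetaProd_ne_zero {z : ℂ} (hz : z ∉ squarePeriods.lattice) : thetaProd z ≠ 0 := by
  have hu : z / 2 ∉ punctures := fun h => hz (by simpa [punctures, mul_div_cancel₀] using h)
  obtain ⟨h1, h2, h3, h4⟩ := theta_ne_zero_of_notMem_punctures hu
  rw [show z / 2 / 2 = z / 4 by ring] at h1 h2 h3 h4
  simp [thetaProd, h1, h2, h3, h4]

/-- A quarter of the period 2 is the half-period 1/2, which permutes the theta functions up to sign.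
The power sum survives because θ₂⁴ + θ₄⁴ = θ₁⁴ + θ₃⁴ at modulus i. -/
lemma weierstrassTheta_add_two (z : ℂ) : weierstrassTheta (z + 2) = weierstrassTheta z := by
  have hP : thetaProd (z + 2) = -thetaProd z := by
    simp only [thetaProd, show (z + 2) / 4 = z / 4 + 1 / 2 by ring, theta1_add_half,
      theta2_add_half, theta3_add_half, theta4_add_half]
    ring
  have hS : thetaPowSum (z + 2) = thetaPowSum z := by
    simp only [thetaPowSum, show (z + 2) / 4 = z / 4 + 1 / 2 by ring, theta1_add_half,
      theta3_add_half]
    exact theta2_pow_add_theta4_pow_I _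
  rw [weierstrassTheta, hP, hS, div_neg, neg_sq, weierstrassTheta]

lemma weierstrassTheta_add_two_I (z : ℂ) : weierstrassTheta (z + 2 * I) = weierstrassTheta z := by
  have hk := halfPeriodFactor_ne_zero (z / 4) I
  have hP : thetaProd (z + 2 * I) = -(halfPeriodFactor (z / 4) I ^ 4 * thetaProd z) := by
    simp only [thetaProd, show (z + 2 * I) / 4 = z / 4 + I / 2 by ring, theta1_add_half_period,
      theta2_add_half_period, theta3_add_half_period, theta4_add_half_period]
    linear_combination (halfPeriodFactor (z / 4) I ^ 4 * (theta1 (z / 4) I * theta2 (z / 4) I *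
      theta3 (z / 4) I * theta4 (z / 4) I)) * I_sq
  have hS : thetaPowSum (z + 2 * I) = halfPeriodFactor (z / 4) I ^ 4 * thetaPowSum z := by
    simp only [thetaPowSum, show (z + 2 * I) / 4 = z / 4 + I / 2 by ring, theta1_add_half_period,
      theta3_add_half_period, ← theta2_pow_add_theta4_pow_I (z / 4), mul_pow, I_pow_four]
    ring
  rw [weierstrassTheta, hP, hS, div_neg, neg_sq, mul_div_mul_left _ _ (pow_ne_zero 4 hk),
    weierstrassTheta]

lemma weierstrassTheta_add_coe (z : ℂ) {l : ℂ} (hl : l ∈ squarePeriods.lattice) :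
    weierstrassTheta (z + l) = weierstrassTheta z := by
  obtain ⟨m, n, rfl⟩ := mem_squarePeriods_lattice.1 hl
  have h1 : Function.Periodic weierstrassTheta 2 := weierstrassTheta_add_two
  have h2 : Function.Periodic weierstrassTheta (2 * I) := weierstrassTheta_add_two_I
  have := ((h1.int_mul m).add_period (h2.int_mul n)) z
  rw [← this]
  ring_nf

/-- At (1+i)/4 a half-period shift combined with reflection relates θ₁ to θ₃ by the factor e^(πi/4),
so their fourth powers cancel. -/
lemma weierstrassTheta_one_add_I : weierstrassTheta (1 + I) = 0 := by
  have h : theta1 ((1 + I) / 4) I = exp (Real.pi * I / 4) * theta3 ((1 + I) / 4) I := by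
    rw [show (1 + I) / 4 = -((1 + I) / 4) + I / 2 + 1 / 2 by ring, theta1_add_half,
      theta2_add_half_period, halfPeriodFactor, theta3_neg,
      show -((1 + I) / 4) + I / 2 + 1 / 2 = (1 + I) / 4 by ring]
    congr 2
    ring
  have e := exp_pi_div_four_pow_four
  have : thetaPowSum (1 + I) = 0 := by
    rw [thetaPowSum, h, mul_pow, e]; ring
  rw [weierstrassTheta, this]
  simp

/-- An even entire function has second order contact with its value at `0`. -/
lemma exists_eq_add_sq_mul {R : ℂ → ℂ} {s : Set ℂ} (hs : s ∈ 𝓝 0) (hR : DifferentiableOn ℂ R s)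
    (he : ∀ z, R (-z) = R z) :
    ∃ g : ℂ → ℂ, DifferentiableOn ℂ g s ∧ ∀ z, R z = R 0 + z ^ 2 * g z := by
  have h0 : dslope R 0 0 = 0 := by
    rw [dslope_same]
    have hd : HasDerivAt R (deriv R 0) (-0) := by
      simpa using (hR.differentiableAt hs).hasDerivAt
    have h2 : HasDerivAt R (-deriv R 0) 0 := by
      simpa [Function.comp_def, he] using hd.comp (0 : ℂ) (hasDerivAt_neg 0)
    have h1 : HasDerivAt R (deriv R 0) 0 := by simpa using hd
    have := h1.unique h2
    linear_combination this / 2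
  refine ⟨dslope (dslope R 0) 0, ?_, fun z => ?_⟩
  · rw [Complex.differentiableOn_dslope hs, Complex.differentiableOn_dslope hs]
    exact hR
  · have e1 := sub_smul_dslope R 0 z
    have e2 := sub_smul_dslope (dslope R 0) 0 z
    rw [h0] at e2
    simp only [sub_zero, smul_eq_mul] at e1 e2
    rw [sq, mul_assoc, e2, e1]
    ring

/-- Evenness excludes a 1/z term in the principal part; Jacobi's derivative formula and ϑ₃⁴ = 2ϑ₂⁴
at i make the coefficient of 1/z² equal to 1. -/
lemma weierstrassTheta_eq_near_zero : ∃ g : ℂ → ℂ, ∃ s ∈ 𝓝 (0 : ℂ), DifferentiableOn ℂ g s ∧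
    ∀ z ∈ s, z ≠ 0 → z ∉ squarePeriods.lattice → weierstrassTheta z = 1 / z ^ 2 + g z := by
  have hd : Differentiable ℂ fun z : ℂ => z / 4 := differentiable_id.div_const 4
  have d1 := (differentiable_theta1 I_im_pos).comp hd
  have d2 := (differentiable_theta2 I_im_pos).comp hd
  have d3 := (differentiable_theta3 I_im_pos).comp hd
  have d4 := (differentiable_theta4 I_im_pos).comp hd
  have n2 := theta2_zero_ne_zero I_im_pos
  have n3 := theta3_zero_ne_zero I_im_pos
  have hp : (Real.pi : ℂ) ≠ 0 := by exact_mod_cast Real.pi_ne_zero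
  set T : ℂ → ℂ := fun z => theta1 (z / 4) I with hT
  have hTeven : ∀ z, dslope T 0 (-z) = dslope T 0 z := by
    intro z
    rcases eq_or_ne z 0 with rfl | hz
    · simp
    · rw [dslope_of_ne _ hz, dslope_of_ne _ (neg_ne_zero.2 hz), slope_def_field, slope_def_field]
      simp only [hT, neg_div, theta1_neg, zero_div, theta1_zero]
      field_simp
      simp [hz]
  have hTz : ∀ z, T z = z * dslope T 0 z := fun z => by
    have := sub_smul_dslope T 0 z
    simp only [sub_zero, smul_eq_mul, hT, zero_div, theta1_zero] at this ⊢
    exact this.symm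
  have hT0 : dslope T 0 0 = theta1Deriv I 1 0 / 4 := by
    rw [dslope_same]
    have hd' : HasDerivAt (fun z : ℂ => z / 4) (1 / 4) 0 := (hasDerivAt_id 0).div_const 4
    have := (isDerivChain_theta1 I_im_pos 0 (0 / 4)).comp (0 : ℂ) hd'
    simp only [Function.comp_def, theta1Deriv_zero, zero_div] at this
    rw [this.deriv]; ring
  have hTd : Differentiable ℂ (dslope T 0) := by
    rw [← differentiableOn_univ, Complex.differentiableOn_dslope Filter.univ_mem,
      differentiableOn_univ]
    exact d1
  -- The theta product with its simple zero at the origin divided out.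
  set P : ℂ → ℂ := fun z => dslope T 0 z * theta2 (z / 4) I * theta3 (z / 4) I * theta4 (z / 4) I
    with hP
  have hPd : Differentiable ℂ P := ((hTd.mul d2).mul d3).mul d4
  have hP0 : P 0 ≠ 0 := by
    simp only [hP, hT0, zero_div]
    have : theta1Deriv I 1 0 ≠ 0 := by
      intro h
      have h' := theta1Deriv_one_zero_sq I_im_pos
      rw [h] at h'
      simp [hp, n2, n3, theta4_zero_I] at h'
    simp [this, n2, n3, theta4_zero_I]
  have hSd : Differentiable ℂ thetaPowSum := (d1.pow 4).add (d3.pow 4)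
  set R : ℂ → ℂ := fun z => Real.pi ^ 2 * theta2 0 I ^ 4 / 32 * (thetaPowSum z / P z) ^ 2 with hR
  have hs : {z | P z ≠ 0} ∈ 𝓝 (0 : ℂ) :=
    (isOpen_ne.preimage hPd.continuous).mem_nhds hP0
  have hRd : DifferentiableOn ℂ R {z | P z ≠ 0} := fun z hz =>
    ((((hSd z).div (hPd z) hz).pow 2).const_mul _).differentiableWithinAt
  have hRe : ∀ z, R (-z) = R z := fun z => by
    simp only [hR, hP, thetaPowSum, hTeven, neg_div, theta1_neg, theta2_neg, theta3_neg, theta4_neg]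
    ring
  have hR0 : R 0 = 1 := by
    simp only [hR, hP, thetaPowSum, zero_div, theta1_zero, hT0, div_pow, mul_pow,
      theta1Deriv_one_zero_sq I_im_pos, theta4_zero_I]
    field_simp
    linear_combination 16 * theta3 0 I ^ 4 * theta3_zero_I_pow
  obtain ⟨g, hg, hgR⟩ := exists_eq_add_sq_mul hs hRd hRe
  refine ⟨g, _, hs, hg, fun z _ hz hzl => ?_⟩
  have h := hgR z
  rw [hR0] at h
  have hPz : thetaProd z = z * P z := by
    simp only [thetaProd, hP]
    rw [show theta1 (z / 4) I = T z from rfl, hTz]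
    ring
  have hW : weierstrassTheta z = R z / z ^ 2 := by
    rw [weierstrassTheta, hPz, hR, div_mul_eq_div_div_swap]
    simp only [div_pow]
    ring
  rw [hW, h]
  field_simp

/-- The theta quotient formula for `℘`. -/
lemma weierstrassP_eq_weierstrassTheta {z : ℂ} (hz : z ∉ squarePeriods.lattice) :
    squarePeriods.weierstrassP z = weierstrassTheta z := by
  classical
  obtain ⟨g, s, hs, hg, hgW⟩ := weierstrassTheta_eq_near_zero
  set L := squarePeriods
  set E : ℂ → ℂ := fun z => L.weierstrassPExcept 0 z - g z
  -- The principal parts agree, so the difference extends over the lattice, with the value of its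
  -- regular part at 0.
  set D : ℂ → ℂ := fun z => if z ∈ L.lattice then E 0 else L.weierstrassP z - weierstrassTheta z
    with hD
  have hper : ∀ z, ∀ l ∈ L.lattice, D (z + l) = D z := by
    intro z l hl
    simp only [hD, L.lattice.add_mem_iff_left hl, weierstrassTheta_add_coe z hl]
    rw [L.weierstrassP_add_coe z ⟨l, hl⟩]
  have hW : DifferentiableOn ℂ weierstrassTheta (L.lattice : Set ℂ)ᶜ := by
    intro z hz
    have hd : Differentiable ℂ fun z : ℂ => z / 4 := differentiable_id.div_const 4
    have d1 := (differentiable_theta1 I_im_pos).comp hd z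
    have d2 := (differentiable_theta2 I_im_pos).comp hd z
    have d3 := (differentiable_theta3 I_im_pos).comp hd z
    have d4 := (differentiable_theta4 I_im_pos).comp hd z
    exact (((((d1.pow 4).add (d3.pow 4)).div (((d1.mul d2).mul d3).mul d4)
      (thetaProd_ne_zero hz)).pow 2).const_mul _).differentiableWithinAt
  have hiso : ∀ᶠ z in 𝓝 (0 : ℂ), z = 0 ∨ z ∉ L.lattice := by
    filter_upwards [L.isOpen_compl_lattice_sdiff.mem_nhds
      (show (0 : ℂ) ∈ (L.lattice \ {(0 : ℂ)} : Set ℂ)ᶜ by simp)] with z hz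
    by_contra! h
    exact hz ⟨h.2, h.1⟩
  have hd0 : DifferentiableAt ℂ D 0 := by
    have hE : DifferentiableAt ℂ E 0 :=
      (L.analyticAt_weierstrassPExcept 0).differentiableAt.sub (hg.differentiableAt hs)
    refine hE.congr_of_eventuallyEq ?_
    filter_upwards [hiso, hs] with w hw hws
    rcases hw with rfl | hw
    · simp [hD]
    · have hw0 : w ≠ 0 := fun h => hw (h ▸ zero_mem _)
      simp only [hD, if_neg hw, hgW w hws hw0 hw, E]
      have := L.weierstrassPExcept_def 0 w
      simp only [ZeroMemClass.coe_zero, sub_zero] at this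
      rw [this]
      simp
      ring
  have hdiff : Differentiable ℂ D := by
    intro z
    by_cases hz : z ∈ L.lattice
    · have : D = fun w => D (w - z) := funext fun w => by
        rw [sub_eq_add_neg, hper w _ (neg_mem hz)]
      rw [this]
      have h0 : DifferentiableAt ℂ D ((fun w => w - z) z) := by simpa using hd0
      exact DifferentiableAt.comp (g := D) (f := fun w => w - z) z h0 (by fun_prop)
    · have ho := L.isClosed_lattice.isOpen_compl.mem_nhds hz
      refine (((L.analyticOnNhd_weierstrassP z hz).differentiableAt).sub
        (hW.differentiableAt ho)).congr_of_eventuallyEq ?_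
      filter_upwards [ho] with w hw
      exact if_neg hw
  -- Liouville: the difference is entire and lattice-periodic, hence bounded and constant, and at 1
  -- + i both functions vanish.
  have hconst := hdiff.apply_eq_apply_of_bounded (IsZLattice.isCompact_range_of_periodic L.lattice _
    hdiff.continuous fun z w hw => hper z w hw).isBounded z (1 + I)
  have hnot : (1 + I) ∉ L.lattice := by
    intro h
    obtain ⟨m, n, h⟩ := mem_squarePeriods_lattice.1 h
    have h1 := congrArg re h
    simp at h1
    have h2 : (1 : ℤ) = 2 * m := Int.cast_injective (α := ℝ) (by push_cast; exact h1)
    omega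
  simp only [hD, if_neg hz, if_neg hnot] at hconst
  rw [weierstrassP_one_add_I, weierstrassTheta_one_add_I, sub_zero] at hconst
  linear_combination hconst

/-- At z = 2u the theta arguments become u/2. The product of θ₂² and θ₄² is eliminated by its
lemniscatic expression, leaving only θ₁/θ₃. -/
lemma wpI_two_mul {u : ℂ} (hu : u ∉ punctures) : wpI (2 * u) =
    lemniscateConst ^ 2 * (1 + lemniscate u ^ 4) ^ 2 /
      (4 * lemniscate u ^ 2 * (1 - lemniscate u ^ 4)) := by
  obtain ⟨h1, h2, h3, h4⟩ := theta_ne_zero_of_notMem_punctures hu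
  have n2 := theta2_zero_ne_zero I_im_pos
  have h := theta2_sq_mul_theta4_sq_I (u / 2)
  rw [theta3_zero_I_pow] at h
  have h' : 2 * (theta2 (u / 2) I ^ 2 * theta4 (u / 2) I ^ 2) =
      theta3 (u / 2) I ^ 4 - theta1 (u / 2) I ^ 4 :=
    mul_right_cancel₀ (pow_ne_zero 4 n2) (by linear_combination h)
  have hne : theta3 (u / 2) I ^ 4 - theta1 (u / 2) I ^ 4 ≠ 0 := by
    rw [← h']; simp [h2, h4]
  rw [wpI, weierstrassP_eq_weierstrassTheta hu, weierstrassTheta, thetaPowSum, thetaProd,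
    show 2 * u / 4 = u / 2 by ring, lemniscate_pow_four, lemniscate, mul_pow, thetaSign_sq,
    lemniscateConst]
  have e : 1 - theta1 (u / 2) I ^ 4 / theta3 (u / 2) I ^ 4 =
    2 * (theta2 (u / 2) I ^ 2 * theta4 (u / 2) I ^ 2) / theta3 (u / 2) I ^ 4 := by
    rw [h']; field_simp
  rw [e]
  field_simp
  ring

/-! ### The hypergeometric series as the lemniscate integral -/

/-- The quotient of the rising factorials of 1/4 and 5/4 telescopes to 1/(4n+1), the factor produced
by integrating t^(4n). -/
lemma ascPochhammer_quarter (n : ℕ) :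
    (ascPochhammer ℂ n).eval (1 / 4) * (4 * n + 1) = (ascPochhammer ℂ n).eval (5 / 4) := by
  induction n with
  | zero => simp
  | succ n ih =>
    rw [ascPochhammer_succ_eval, ascPochhammer_succ_eval, ← ih]
    push_cast
    ring

lemma ascPochhammer_five_quarters_ne_zero (n : ℕ) : (ascPochhammer ℂ n).eval (5 / 4) ≠ 0 := by
  induction n with
  | zero => simp
  | succ n ih =>
    rw [ascPochhammer_succ_eval]
    refine mul_ne_zero ih fun h => ?_
    have := congrArg re h
    simp at this
    norm_num at this
    have : (0 : ℝ) ≤ n := n.cast_nonneg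
    linarith

/-- The coefficients of `(1 - x)^(-1/2)`. -/
def invSqrtCoeff (n : ℕ) : ℂ := (n.factorial : ℂ)⁻¹ * (ascPochhammer ℂ n).eval (1 / 2)

lemma invSqrtCoeff_eq (n : ℕ) : Ring.choose ((1 / 2 : ℂ) + n - 1) n = invSqrtCoeff n := by
  have h := Ring.factorial_nsmul_multichoose_eq_ascPochhammer (1 / 2 : ℂ) n
  rw [Polynomial.ascPochhammer_smeval_eq_eval, nsmul_eq_mul] at h
  have hn : (n.factorial : ℂ) ≠ 0 := by exact_mod_cast n.factorial_ne_zero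
  rw [invSqrtCoeff, ← h, inv_mul_cancel_left₀ hn, Ring.choose]
  congr 1
  ring

lemma hasFPowerSeriesOnBall_invSqrt : HasFPowerSeriesOnBall (fun x : ℂ => 1 / (1 - x) ^ (1 / 2 : ℂ))
    (.ofScalars ℂ invSqrtCoeff) 0 1 := by
  have h := one_div_one_sub_cpow_hasFPowerSeriesOnBall_zero (1 / 2)
  simpa only [invSqrtCoeff_eq] using h


lemma hypergeometric_eq_tsum (x : ℂ) : ₂F₁ (1 / 2 : ℂ) (1 / 4 : ℂ) (5 / 4 : ℂ) x =
    ∑' n : ℕ, invSqrtCoeff n / (4 * n + 1) * x ^ n := by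
  rw [ordinaryHypergeometric_eq_tsum]
  refine tsum_congr fun n => ?_
  have h5 := ascPochhammer_five_quarters_ne_zero n
  have h := ascPochhammer_quarter n
  have hn : (4 * n + 1 : ℂ) ≠ 0 := by exact_mod_cast (by omega : 4 * n + 1 ≠ 0)
  rw [← h] at h5
  rw [smul_eq_mul, invSqrtCoeff, ← h]
  have h4 : (ascPochhammer ℂ n).eval (1 / 4) ≠ 0 := left_ne_zero_of_mul h5
  field_simp

/-- The inverse lemniscate function `∫₀ʷ (1 - t⁴)^(-1/2) dt`. -/
def arcLemniscate (w : ℂ) : ℂ := w * ₂F₁ (1 / 2 : ℂ) (1 / 4 : ℂ) (5 / 4 : ℂ) (w ^ 4)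

lemma arcLemniscate_zero : arcLemniscate 0 = 0 := zero_mul _

/-- Termwise differentiation removes the denominators 4n+1 and leaves the binomial series of
(1-x)^(-1/2) at x = w⁴. -/
lemma hasDerivAt_arcLemniscate {w : ℂ} (hw : ‖w‖ < 1) :
    HasDerivAt arcLemniscate (1 / (1 - w ^ 4) ^ (1 / 2 : ℂ)) w := by
  obtain ⟨r, hr, hr1⟩ := exists_between hw
  have hr0 : 0 ≤ r := (norm_nonneg w).trans hr.le
  have hsum : Summable fun n : ℕ => ‖invSqrtCoeff n‖ * (r ^ 4) ^ n := by
    have hlt : ((r ^ 4).toNNReal : ENNReal) <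
        (FormalMultilinearSeries.ofScalars ℂ invSqrtCoeff : FormalMultilinearSeries ℂ ℂ ℂ).radius := by
      refine lt_of_lt_of_le ?_ hasFPowerSeriesOnBall_invSqrt.r_le
      rw [← ENNReal.coe_one, ENNReal.coe_lt_coe, ← NNReal.coe_lt_coe,
        Real.coe_toNNReal _ (pow_nonneg hr0 4)]
      exact pow_lt_one₀ hr0 hr1 (by norm_num)
    have := FormalMultilinearSeries.summable_norm_mul_pow _ hlt
    rw [Real.coe_toNNReal _ (pow_nonneg hr0 4)] at this
    simpa using this
  have key := hasDerivAt_tsum_of_isPreconnected hsum (Metric.isOpen_ball (x := (0 : ℂ)) (ε := r))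
    (convex_ball (0 : ℂ) r).isPreconnected
    (g := fun n z => invSqrtCoeff n / (4 * n + 1) * z ^ (4 * n + 1))
    (g' := fun n z => invSqrtCoeff n * (z ^ 4) ^ n) (y₀ := w) (y := w) ?_ ?_
    (by simpa using hr) ?_ (by simpa using hr)
  · have hs : ∑' n : ℕ, invSqrtCoeff n * (w ^ 4) ^ n = 1 / (1 - w ^ 4) ^ (1 / 2 : ℂ) := by
      have hmem : w ^ 4 ∈ Metric.eball (0 : ℂ) 1 := by
        rw [← ENNReal.coe_one, Metric.eball_coe, mem_ball_zero_iff, norm_pow]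
        exact pow_lt_one₀ (norm_nonneg w) hw (by norm_num)
      have := (hasFPowerSeriesOnBall_invSqrt.hasSum hmem).tsum_eq
      simpa [mul_comm] using this
    rw [hs] at key
    refine key.congr_of_eventuallyEq (.of_forall fun z => ?_)
    rw [arcLemniscate, hypergeometric_eq_tsum, ← tsum_mul_left]
    refine tsum_congr fun n => ?_
    rw [pow_succ _ (4 * n), pow_mul]
    ring
  · intro n z _
    have hn : (4 * n + 1 : ℂ) ≠ 0 := by exact_mod_cast (by omega : 4 * n + 1 ≠ 0)
    refine ((hasDerivAt_pow (4 * n + 1) z).const_mul _).congr_deriv ?_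
    rw [← pow_mul]
    push_cast
    field_simp
    try simp
  · intro n z hz
    rw [norm_mul, norm_pow, norm_pow]
    have hz' : ‖z‖ ≤ r := (mem_ball_zero_iff.1 hz).le
    gcongr
  · refine .of_norm_bounded hsum fun n => ?_
    rw [norm_mul, norm_div, pow_succ, pow_mul, norm_mul, norm_pow, norm_pow]
    have hn : (1 : ℝ) ≤ ‖(4 * n + 1 : ℂ)‖ := by
      rw [show (4 * n + 1 : ℂ) = ((4 * n + 1 : ℕ) : ℂ) by push_cast; ring, Complex.norm_natCast]
      exact_mod_cast (by omega : 1 ≤ 4 * n + 1)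
    calc ‖invSqrtCoeff n‖ / ‖(4 * n + 1 : ℂ)‖ * ((‖w‖ ^ 4) ^ n * ‖w‖)
        ≤ ‖invSqrtCoeff n‖ * ((r ^ 4) ^ n * 1) := by
          gcongr
          exact div_le_self (norm_nonneg _) hn
      _ = _ := by rw [mul_one]

lemma invSqrt_sq {x : ℂ} (hx : x ≠ 0) : (1 / x ^ (1 / 2 : ℂ)) ^ 2 * x = 1 := by
  have : (x ^ (1 / 2 : ℂ)) ^ 2 = x := by
    rw [← cpow_nat_mul]; norm_num
  rw [div_pow, this]
  field_simp

lemma one_sub_pow_four_ne_zero {w : ℂ} (hw : ‖w‖ < 1) : 1 - w ^ 4 ≠ 0 := by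
  intro h
  have h1 : ‖w‖ ^ 4 = 1 := by rw [← norm_pow, ← sub_eq_zero.1 h, norm_one]
  exact absurd h1 (pow_lt_one₀ (norm_nonneg w) hw (by norm_num)).ne

lemma analyticOnNhd_arcLemniscate : AnalyticOnNhd ℂ arcLemniscate (Metric.ball 0 1) :=
  DifferentiableOn.analyticOnNhd (fun _ hw => (hasDerivAt_arcLemniscate
    (mem_ball_zero_iff.1 hw)).differentiableAt.differentiableWithinAt) Metric.isOpen_ball

lemma theta3_half_zero_ne_zero : theta3 (0 / 2) I ≠ 0 := by
  rw [zero_div]; exact theta3_zero_ne_zero I_im_pos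

lemma differentiable_theta3_half : Differentiable ℂ fun u : ℂ => theta3 (u / 2) I :=
  (differentiable_theta3 I_im_pos).comp (differentiable_id.div_const (2 : ℂ))

lemma differentiable_theta1_half : Differentiable ℂ fun u : ℂ => theta1 (u / 2) I :=
  (differentiable_theta1 I_im_pos).comp (differentiable_id.div_const (2 : ℂ))

/-- By the two differential equations the derivative of the composite squares to c². Its value at 0
is c, so continuity excludes -c nearby. -/
lemma arcLemniscate_lemniscate :
    ∀ᶠ u in 𝓝 (0 : ℂ), arcLemniscate (lemniscate u) = lemniscateConst * u := by
  have hc := lemniscateConst_ne_zero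
  have h3 : ∀ᶠ u in 𝓝 (0 : ℂ), theta3 (u / 2) I ≠ 0 :=
    differentiable_theta3_half.continuous.continuousAt.eventually_ne theta3_half_zero_ne_zero
  have hy : ∀ᶠ u in 𝓝 (0 : ℂ), ‖lemniscate u‖ < 1 := by
    have := (hasDerivAt_lemniscate theta3_half_zero_ne_zero).continuousAt.norm
    exact this.eventually_lt continuousAt_const (by simp [lemniscate_zero])
  obtain ⟨r, hr0, hr⟩ := Metric.eventually_nhds_iff_ball.1 (h3.and hy)
  have hd : ∀ u ∈ Metric.ball (0 : ℂ) r, HasDerivAt (fun u => arcLemniscate (lemniscate u))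
      (1 / (1 - lemniscate u ^ 4) ^ (1 / 2 : ℂ) * lemniscateDeriv u) u := fun u hu =>
    (hasDerivAt_arcLemniscate (hr u hu).2).comp u (hasDerivAt_lemniscate (hr u hu).1)
  have hdsq : ∀ u ∈ Metric.ball (0 : ℂ) r,
      (1 / (1 - lemniscate u ^ 4) ^ (1 / 2 : ℂ) * lemniscateDeriv u) ^ 2 = lemniscateConst ^ 2 := by
    intro u hu
    rw [mul_pow, lemniscateDeriv_sq (hr u hu).1]
    linear_combination lemniscateConst ^ 2 * invSqrt_sq (one_sub_pow_four_ne_zero (hr u hu).2)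
  have hdiff : DifferentiableOn ℂ (fun u => arcLemniscate (lemniscate u)) (Metric.ball 0 r) :=
    fun u hu => (hd u hu).differentiableAt.differentiableWithinAt
  have h0 : (0 : ℂ) ∈ Metric.ball (0 : ℂ) r := Metric.mem_ball_self hr0
  have hcont : ContinuousAt (deriv fun u => arcLemniscate (lemniscate u)) 0 :=
    ((hdiff.deriv Metric.isOpen_ball).differentiableAt
      (Metric.isOpen_ball.mem_nhds h0)).continuousAt
  have hd0 : deriv (fun u => arcLemniscate (lemniscate u)) 0 = lemniscateConst := by
    rw [(hd 0 h0).deriv, lemniscate_zero, lemniscateDeriv_zero]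
    simp
  have hne : ∀ᶠ u in 𝓝 (0 : ℂ),
      deriv (fun u => arcLemniscate (lemniscate u)) u + lemniscateConst ≠ 0 := by
    refine (hcont.add continuousAt_const).eventually_ne ?_
    rw [Pi.add_apply, hd0]
    simpa using hc
  obtain ⟨ρ, hρ0, hρ⟩ := Metric.eventually_nhds_iff_ball.1
    (hne.and (Metric.isOpen_ball.mem_nhds h0))
  have hd' : ∀ u ∈ Metric.ball (0 : ℂ) ρ, HasDerivAt
      (fun u => arcLemniscate (lemniscate u) - lemniscateConst * u) 0 u := by
    intro u hu
    have h1 := hd u (hρ u hu).2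
    have h2 := hdsq u (hρ u hu).2
    rw [← h1.deriv] at h2
    have h4 : deriv (fun u => arcLemniscate (lemniscate u)) u = lemniscateConst := by
      refine sub_eq_zero.1 (mul_right_cancel₀ (hρ u hu).1 ?_)
      linear_combination h2
    refine (h1.fun_sub ((hasDerivAt_id u).const_mul lemniscateConst)).congr_deriv ?_
    rw [← h1.deriv, h4]
    simp
  filter_upwards [Metric.ball_mem_nhds (0 : ℂ) hρ0] with u hu
  have := (convex_ball (0 : ℂ) ρ).is_const_of_fderivWithin_eq_zero (𝕜 := ℂ)
    (fun v hv => (hd' v hv).differentiableAt.differentiableWithinAt)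
    (fun v hv => by
      rw [fderivWithin_of_isOpen Metric.isOpen_ball hv, (hd' v hv).hasFDerivAt.fderiv]; simp) hu
    (Metric.mem_ball_self hρ0)
  simp only [lemniscate_zero, arcLemniscate_zero] at this
  linear_combination this

/-- The derivative at 0 is 1, so the inverse function theorem supplies a local left inverse. -/
lemma eventually_injective_arcLemniscate {f g : ℂ → ℂ} (hf : Filter.Tendsto f (𝓝 0) (𝓝 0))
    (hg : Filter.Tendsto g (𝓝 0) (𝓝 0))
    (h : ∀ᶠ w in 𝓝 0, arcLemniscate (f w) = arcLemniscate (g w)) : ∀ᶠ w in 𝓝 0, f w = g w := by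
  have hs : HasStrictDerivAt arcLemniscate 1 0 := by
    have h1 := (analyticOnNhd_arcLemniscate 0 (by simp)).hasStrictDerivAt
    rwa [(hasDerivAt_arcLemniscate (w := 0) (by simp)).deriv,
      show 1 / (1 - (0 : ℂ) ^ 4) ^ (1 / 2 : ℂ) = 1 by simp] at h1
  have hl := (hs.hasStrictFDerivAt_equiv one_ne_zero).eventually_left_inverse
  filter_upwards [h, hf.eventually hl, hg.eventually hl] with w hw h1 h2
  rw [← h1, ← h2, hw]

/-- The inversion of the lemniscate integral, in the form free of denominators. -/
lemma theta1_arcLemniscate {w : ℂ} (hw : ‖w‖ < 1) :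
    thetaSign * theta1 (arcLemniscate w / lemniscateConst / 2) I =
      w * theta3 (arcLemniscate w / lemniscateConst / 2) I := by
  have hc := lemniscateConst_ne_zero
  have hda : DifferentiableOn ℂ (fun w => arcLemniscate w / lemniscateConst) (Metric.ball 0 1) :=
    analyticOnNhd_arcLemniscate.differentiableOn.div_const _
  have ht : Filter.Tendsto (fun w => arcLemniscate w / lemniscateConst) (𝓝 0) (𝓝 0) := by
    have := (hda.differentiableAt (Metric.ball_mem_nhds 0 one_pos)).continuousAt.tendsto
    rwa [arcLemniscate_zero, zero_div] at this
  -- Both sides have the same image under the locally injective `arcLemniscate`. From this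
  -- neighbourhood the identity spreads to the unit disc once the denominator θ₃ is cleared.
  have hcomp : ∀ᶠ w in 𝓝 (0 : ℂ), lemniscate (arcLemniscate w / lemniscateConst) = w := by
    have hl : Filter.Tendsto lemniscate (𝓝 0) (𝓝 0) := by
      have := (hasDerivAt_lemniscate theta3_half_zero_ne_zero).continuousAt.tendsto
      rwa [lemniscate_zero] at this
    refine eventually_injective_arcLemniscate (hl.comp ht) Filter.tendsto_id ?_
    filter_upwards [ht.eventually arcLemniscate_lemniscate] with w hw
    rw [hw]
    field_simp
  have h3 : ∀ᶠ w in 𝓝 (0 : ℂ), theta3 (arcLemniscate w / lemniscateConst / 2) I ≠ 0 :=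
    ht.eventually (differentiable_theta3_half.continuous.continuousAt.eventually_ne
      theta3_half_zero_ne_zero)
  have a1 : AnalyticOnNhd ℂ (fun w => thetaSign * theta1 (arcLemniscate w / lemniscateConst / 2) I)
      (Metric.ball 0 1) :=
    ((differentiable_theta1_half.comp_differentiableOn hda).const_mul _).analyticOnNhd
      Metric.isOpen_ball
  have a3 : AnalyticOnNhd ℂ (fun w => w * theta3 (arcLemniscate w / lemniscateConst / 2) I)
      (Metric.ball 0 1) :=
    (differentiableOn_id.mul (differentiable_theta3_half.comp_differentiableOn hda)).analyticOnNhd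
      Metric.isOpen_ball
  refine a1.eqOn_of_preconnected_of_eventuallyEq a3 (convex_ball 0 1).isPreconnected
    (Metric.mem_ball_self one_pos) ?_ (mem_ball_zero_iff.2 hw)
  filter_upwards [hcomp, h3] with w h1 h2
  rwa [lemniscate, ← mul_div_assoc, div_eq_iff h2] at h1

/-! ### Construction of u on the upper half-plane -/

/-- The Cayley transform moves the problem to the unit disc, where holomorphic functions have
primitives. -/
lemma exists_primitive_upperHalf {f : ℂ → ℂ} (hf : DifferentiableOn ℂ f upperHalf) (τ₀ c : ℂ) :
    ∃ u : ℂ → ℂ, u τ₀ = c ∧ ∀ τ ∈ upperHalf, HasDerivAt u (f τ) τ := by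
  have hball : ∀ w ∈ Metric.ball (0 : ℂ) 1, 1 - w ≠ 0 ∧ I * (1 + w) / (1 - w) ∈ upperHalf := by
    intro w hw
    have hw1 : ‖w‖ < 1 := mem_ball_zero_iff.1 hw
    have h1 : 1 - w ≠ 0 := fun h => by
      rw [← sub_eq_zero.1 h, norm_one] at hw1
      exact lt_irrefl _ hw1
    refine ⟨h1, ?_⟩
    have hn : 0 < normSq (1 - w) := normSq_pos.2 h1
    have hw2 : w.re * w.re + w.im * w.im < 1 := by
      rw [← normSq_apply, normSq_eq_norm_sq]
      exact pow_lt_one₀ (norm_nonneg w) hw1 two_ne_zero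
    change 0 < (I * (1 + w) / (1 - w)).im
    rw [div_im]
    simp only [mul_im, mul_re, I_re, I_im, add_re, add_im, one_re, one_im, sub_re, sub_im]
    rw [div_sub_div_same]
    refine div_pos ?_ hn
    nlinarith
  have hF : DifferentiableOn ℂ
      (fun w => f (I * (1 + w) / (1 - w)) * (2 * I / (1 - w) ^ 2)) (Metric.ball 0 1) := by
    refine DifferentiableOn.mul ?_ ?_
    · refine hf.comp (t := upperHalf) (f := fun w => I * (1 + w) / (1 - w)) ?_
        fun w hw => (hball w hw).2
      exact DifferentiableOn.div (by fun_prop) (by fun_prop) fun w hw => (hball w hw).1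
    · exact DifferentiableOn.div (by fun_prop) (by fun_prop) fun w hw =>
        pow_ne_zero 2 (hball w hw).1
  obtain ⟨G, hG⟩ := hF.isExactOn_ball
  refine ⟨fun τ => G ((τ - I) / (τ + I)) - G ((τ₀ - I) / (τ₀ + I)) + c, by ring, fun τ hτ => ?_⟩
  have hτ' : 0 < τ.im := hτ
  have h1 : τ + I ≠ 0 := ne_zero_of_im_ne_zero (by simp; linarith)
  have hmem : (τ - I) / (τ + I) ∈ Metric.ball (0 : ℂ) 1 := by
    rw [mem_ball_zero_iff, norm_div, div_lt_one (norm_pos_iff.2 h1)]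
    refine lt_of_pow_lt_pow_left₀ 2 (norm_nonneg _) ?_
    rw [← normSq_eq_norm_sq, ← normSq_eq_norm_sq, normSq_apply, normSq_apply]
    simp
    nlinarith
  have hd : HasDerivAt (fun τ : ℂ => (τ - I) / (τ + I)) (2 * I / (τ + I) ^ 2) τ := by
    refine (((hasDerivAt_id τ).sub_const I).fun_div ((hasDerivAt_id τ).add_const I)
      h1).congr_deriv ?_
    simp only [id]
    ring
  refine ((((hG _ hmem).comp τ hd).sub_const _).add_const c).congr_deriv ?_
  have e1 : 1 - (τ - I) / (τ + I) = 2 * I / (τ + I) := by field_simp; ring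
  have e2 : I * (1 + (τ - I) / (τ + I)) / (1 - (τ - I) / (τ + I)) = τ := by
    rw [e1]
    field_simp
    ring
  simp only
  rw [e2, e1]
  field_simp

/-- The cusp form `ϑ₂ϑ₃ϑ₄²` of weight two. -/
def weightTwoForm (τ : ℂ) : ℂ := theta2 0 τ * theta3 0 τ * theta4 0 τ ^ 2

/-- The multiple of `weightTwoForm` in the derivative of the uniformizing function. -/
def uniformizerConst : ℂ := Real.pi / (4 * lemniscateConst)

lemma uniformizerConst_ne_zero : uniformizerConst ≠ 0 := by
  simp [uniformizerConst, lemniscateConst_ne_zero, Real.pi_ne_zero]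

lemma weightTwoForm_ne_zero {τ : ℂ} (hτ : τ ∈ upperHalf) : weightTwoForm τ ≠ 0 := by
  simp [weightTwoForm, theta2_zero_ne_zero hτ, theta3_zero_ne_zero hτ, theta4_zero_ne_zero hτ]

lemma hasDerivAt_weightTwoForm {τ : ℂ} (hτ : τ ∈ upperHalf) : HasDerivAt weightTwoForm
    ((logDeriv2 τ + logDeriv3 τ + 2 * logDeriv4 τ) * weightTwoForm τ) τ := by
  refine (((hasDerivAt_theta2 hτ).fun_mul (hasDerivAt_theta3 hτ)).fun_mul
    ((hasDerivAt_theta4 hτ).fun_pow 2)).congr_deriv ?_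
  rw [weightTwoForm]
  ring

/-- The quotient `ϑ₃/ϑ₂`. -/
def thetaQuot (τ : ℂ) : ℂ := theta3 0 τ / theta2 0 τ

lemma hasDerivAt_thetaQuot {τ : ℂ} (hτ : τ ∈ upperHalf) : HasDerivAt thetaQuot
    (-(Real.pi * I / 4) * theta4 0 τ ^ 4 * thetaQuot τ) τ := by
  have h2 := theta2_zero_ne_zero hτ
  refine ((hasDerivAt_theta3 hτ).fun_div (hasDerivAt_theta2 hτ) h2).congr_deriv ?_
  rw [thetaQuot, ← logDeriv3_sub_logDeriv2_eq hτ]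
  field_simp

lemma one_sub_thetaQuot_pow {τ : ℂ} (hτ : τ ∈ upperHalf) :
    1 - thetaQuot τ ^ 4 = -(theta4 0 τ ^ 4 / theta2 0 τ ^ 4) := by
  have h2 := theta2_zero_ne_zero hτ
  rw [thetaQuot, div_pow, jacobi_identity hτ]
  field_simp
  ring

/-- The prefactor 2/(πϑ₂(i)²) is 1/c. -/
lemma hypergeometricFormula_eq (τ : ℂ) :
    hypergeometricFormula τ = arcLemniscate (thetaQuot τ) / lemniscateConst := by
  have hp : (Real.pi : ℂ) ≠ 0 := by exact_mod_cast Real.pi_ne_zero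
  have n2 := theta2_zero_ne_zero I_im_pos
  rw [hypergeometricFormula, thetaConst2_eq, thetaConst3_eq, thetaConst2_eq, arcLemniscate,
    thetaQuot, lemniscateConst, div_pow]
  field_simp

/-- A function on the upper half-plane inverting the lemniscate function at `ϑ₃/ϑ₂`. -/
structure IsUniformizer (u : ℂ → ℂ) : Prop where
  hasDerivAt : ∃ ρ : ℂ, ρ ^ 2 = 1 ∧ ∀ τ ∈ upperHalf,
    HasDerivAt u (ρ * uniformizerConst * weightTwoForm τ) τ
  theta_eq : ∀ τ ∈ upperHalf, thetaSign * theta1 (u τ / 2) I * theta2 0 τ =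
    theta3 0 τ * theta3 (u τ / 2) I

lemma eqOn_ball_of_hasDerivAt {f g f' : ℂ → ℂ} {c : ℂ} {r : ℝ}
    (hf : ∀ z ∈ Metric.ball c r, HasDerivAt f (f' z) z)
    (hg : ∀ z ∈ Metric.ball c r, HasDerivAt g (f' z) z) (h : f c = g c) {z : ℂ}
    (hz : z ∈ Metric.ball c r) : f z = g z := by
  have hr : 0 < r := Metric.pos_of_mem_ball hz
  have hd : ∀ z ∈ Metric.ball c r, HasDerivAt (fun z => f z - g z) 0 z := fun z hz =>
    ((hf z hz).fun_sub (hg z hz)).congr_deriv (sub_self _)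
  have := (convex_ball c r).is_const_of_fderivWithin_eq_zero (𝕜 := ℂ)
    (fun v hv => (hd v hv).differentiableAt.differentiableWithinAt)
    (fun v hv => by
      rw [fderivWithin_of_isOpen Metric.isOpen_ball hv, (hd v hv).hasFDerivAt.fderiv]; simp) hz
    (Metric.mem_ball_self hr)
  simp only [h, sub_self] at this
  exact sub_eq_zero.1 this

/-- Near τ₀ the square of the derivative of the formula is that of a multiple of ϑ₂ϑ₃ϑ₄², so the
branch of the square root contributes only a constant sign. The primitive with this sign continues
the formula, and the inversion identity continues by the identity theorem. -/
lemma exists_isUniformizer {τ₀ : ℂ} (hτ₀ : τ₀ ∈ upperHalf)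
    (hlt : ‖thetaConst3 τ₀ ^ 4 / thetaConst2 τ₀ ^ 4‖ < 1) :
    ∃ u : ℂ → ℂ, IsUniformizer u ∧ u =ᶠ[𝓝 τ₀] hypergeometricFormula := by
  have hc := lemniscateConst_ne_zero
  have hp : (Real.pi : ℂ) ≠ 0 := by exact_mod_cast Real.pi_ne_zero
  have hk := uniformizerConst_ne_zero
  have hY0 : ‖thetaQuot τ₀‖ < 1 := by
    rw [thetaConst2_eq, thetaConst3_eq, ← div_pow, ← thetaQuot, norm_pow] at hlt
    exact (pow_lt_one_iff_of_nonneg (norm_nonneg _) (by norm_num)).1 hlt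
  have hY : ∀ᶠ τ in 𝓝 τ₀, ‖thetaQuot τ‖ < 1 :=
    (hasDerivAt_thetaQuot hτ₀).continuousAt.norm.eventually_lt continuousAt_const hY0
  obtain ⟨r, hr0, hr⟩ := Metric.eventually_nhds_iff_ball.1
    (hY.and (isOpen_upperHalf.mem_nhds hτ₀))
  set f₀ : ℂ → ℂ := fun τ => arcLemniscate (thetaQuot τ) / lemniscateConst with hf₀
  have hd₀ : ∀ τ ∈ Metric.ball τ₀ r, HasDerivAt f₀ (1 / (1 - thetaQuot τ ^ 4) ^ (1 / 2 : ℂ) *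
      (-(Real.pi * I / 4) * theta4 0 τ ^ 4 * thetaQuot τ) / lemniscateConst) τ := fun τ hτ =>
    ((hasDerivAt_arcLemniscate (hr τ hτ).1).comp τ (hasDerivAt_thetaQuot (hr τ hτ).2)).div_const _
  have hdsq : ∀ τ ∈ Metric.ball τ₀ r, deriv f₀ τ ^ 2 = (uniformizerConst * weightTwoForm τ) ^ 2 := by
    intro τ hτ
    obtain ⟨h1, h2⟩ := hr τ hτ
    have n2 := theta2_zero_ne_zero h2
    have n3 := theta3_zero_ne_zero h2
    have n4 := theta4_zero_ne_zero h2
    have hs := invSqrt_sq (one_sub_pow_four_ne_zero h1)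
    have e := one_sub_thetaQuot_pow h2
    rw [(hd₀ τ hτ).deriv]
    have hs' : (1 / (1 - thetaQuot τ ^ 4) ^ (1 / 2 : ℂ)) ^ 2 =
        -(theta2 0 τ ^ 4 / theta4 0 τ ^ 4) := by
      rw [eq_div_of_mul_eq (one_sub_pow_four_ne_zero h1) hs, e]
      field_simp
    rw [div_pow, mul_pow, hs', thetaQuot, uniformizerConst, weightTwoForm]
    field_simp
    rw [I_sq]
    ring
  have hdiff₀ : DifferentiableOn ℂ f₀ (Metric.ball τ₀ r) := fun τ hτ =>
    (hd₀ τ hτ).differentiableAt.differentiableWithinAt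
  have hwd : DifferentiableOn ℂ weightTwoForm upperHalf := fun τ hτ =>
    (hasDerivAt_weightTwoForm hτ).differentiableAt.differentiableWithinAt
  have hcont : ContinuousOn (fun τ => deriv f₀ τ / (uniformizerConst * weightTwoForm τ))
      (Metric.ball τ₀ r) :=
    (hdiff₀.deriv Metric.isOpen_ball).continuousOn.div
      (continuousOn_const.mul (hwd.continuousOn.mono fun τ hτ => (hr τ hτ).2))
      fun τ hτ => mul_ne_zero hk (weightTwoForm_ne_zero (hr τ hτ).2)
  obtain ⟨ρ, hρ, hρd⟩ : ∃ ρ : ℂ, ρ ^ 2 = 1 ∧ ∀ τ ∈ Metric.ball τ₀ r,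
      deriv f₀ τ = ρ * uniformizerConst * weightTwoForm τ := by
    have hne : ∀ τ ∈ Metric.ball τ₀ r, uniformizerConst * weightTwoForm τ ≠ 0 := fun τ hτ =>
      mul_ne_zero hk (weightTwoForm_ne_zero (hr τ hτ).2)
    rcases (convex_ball τ₀ r).isPreconnected.eq_one_or_eq_neg_one_of_sq_eq hcont (fun τ hτ => by
      rw [Pi.pow_apply, div_pow, hdsq τ hτ, Pi.one_apply,
        div_self (pow_ne_zero 2 (hne τ hτ))]) with h | h
    · refine ⟨1, one_pow 2, fun τ hτ => ?_⟩
      have := h hτ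
      rw [Pi.one_apply, div_eq_iff (hne τ hτ)] at this
      rw [this]; ring
    · refine ⟨-1, by norm_num, fun τ hτ => ?_⟩
      have := h hτ
      rw [Pi.neg_apply, Pi.one_apply, div_eq_iff (hne τ hτ)] at this
      rw [this]; ring
  -- The sign found on the ball is used on the whole half-plane; the normalisation at τ₀ makes the
  -- primitive agree with the formula on the ball.
  obtain ⟨u, hu0, hu⟩ := exists_primitive_upperHalf (hwd.const_mul (ρ * uniformizerConst)) τ₀ (f₀ τ₀)
  have huf : ∀ τ ∈ Metric.ball τ₀ r, u τ = f₀ τ := fun τ hτ =>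
    eqOn_ball_of_hasDerivAt (fun z hz => hu z (hr z hz).2)
      (fun z hz => (hdiff₀.differentiableAt (Metric.isOpen_ball.mem_nhds hz)).hasDerivAt.congr_deriv
        (hρd z hz)) hu0 hτ
  have hev : u =ᶠ[𝓝 τ₀] f₀ := by
    filter_upwards [Metric.ball_mem_nhds τ₀ hr0] with τ hτ using huf τ hτ
  refine ⟨u, ⟨⟨ρ, hρ, hu⟩, fun τ hτ => ?_⟩, ?_⟩
  · have hud : DifferentiableOn ℂ u upperHalf := fun τ hτ =>
      (hu τ hτ).differentiableAt.differentiableWithinAt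
    have d2 : DifferentiableOn ℂ (fun τ => theta2 0 τ) upperHalf := fun τ hτ =>
      (hasDerivAt_theta2 hτ).differentiableAt.differentiableWithinAt
    have d3 : DifferentiableOn ℂ (fun τ => theta3 0 τ) upperHalf := fun τ hτ =>
      (hasDerivAt_theta3 hτ).differentiableAt.differentiableWithinAt
    have a1 : AnalyticOnNhd ℂ (fun τ => thetaSign * theta1 (u τ / 2) I * theta2 0 τ) upperHalf :=
      (((differentiable_theta1_half.comp_differentiableOn hud).const_mul _).mul d2).analyticOnNhd
        isOpen_upperHalf
    have a3 : AnalyticOnNhd ℂ (fun τ => theta3 0 τ * theta3 (u τ / 2) I) upperHalf :=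
      (d3.mul (differentiable_theta3_half.comp_differentiableOn hud)).analyticOnNhd
        isOpen_upperHalf
    refine a1.eqOn_of_preconnected_of_eventuallyEq a3 isPreconnected_upperHalf hτ₀ ?_ hτ
    filter_upwards [Metric.ball_mem_nhds τ₀ hr0] with τ hτ
    have n2 := theta2_zero_ne_zero (hr τ hτ).2
    have h := theta1_arcLemniscate (hr τ hτ).1
    have e : theta3 0 τ = thetaQuot τ * theta2 0 τ := (div_mul_cancel₀ _ n2).symm
    simp only [huf τ hτ, hf₀]
    rw [e]
    linear_combination theta2 0 τ * h
  · filter_upwards [hev] with τ hτ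
    rw [hτ, hypergeometricFormula_eq]

namespace IsUniformizer

variable {u : ℂ → ℂ} (hu : IsUniformizer u)
include hu

lemma differentiableOn : DifferentiableOn ℂ u upperHalf := by
  obtain ⟨ρ, -, h⟩ := hu.hasDerivAt
  exact fun τ hτ => (h τ hτ).differentiableAt.differentiableWithinAt

lemma deriv_ne_zero {τ : ℂ} (hτ : τ ∈ upperHalf) : deriv u τ ≠ 0 := by
  obtain ⟨ρ, hρ, h⟩ := hu.hasDerivAt
  rw [(h τ hτ).deriv]
  refine mul_ne_zero (mul_ne_zero (fun h0 => ?_) uniformizerConst_ne_zero) (weightTwoForm_ne_zero hτ)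
  rw [h0] at hρ
  norm_num at hρ

lemma deriv_sq {τ : ℂ} (hτ : τ ∈ upperHalf) :
    deriv u τ ^ 2 = (uniformizerConst * weightTwoForm τ) ^ 2 := by
  obtain ⟨ρ, hρ, h⟩ := hu.hasDerivAt
  rw [(h τ hτ).deriv, mul_assoc, mul_pow, hρ, one_mul]

/-- At a puncture one of the four θⱼ(u/2|i) vanishes. θ₁ and θ₃ have no common zero, so a zero of
either contradicts ϑ₃ ≠ 0 or ϑ₂ ≠ 0. A zero of θ₂ or θ₄ means θ₁⁴ = θ₃⁴, hence ϑ₃⁴ = ϑ₂⁴, and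
Jacobi's identity contradicts ϑ₄ ≠ 0. -/
lemma notMem_punctures {τ : ℂ} (hτ : τ ∈ upperHalf) : u τ ∉ punctures := by
  have n2 := theta2_zero_ne_zero hτ
  have n3 := theta3_zero_ne_zero hτ
  have n4 := theta4_zero_ne_zero hτ
  have h := hu.theta_eq τ hτ
  have hσ := thetaSign_sq
  have hσ0 : thetaSign ≠ 0 := fun h0 => by simp [h0] at hσ
  have h3 : theta3 (u τ / 2) I ≠ 0 := by
    intro h3
    have h1 : theta1 (u τ / 2) I = 0 := by
      rw [h3, mul_zero] at h
      simpa [hσ0, n2] using h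
    obtain ⟨m, n, e⟩ := (theta1_eq_zero_iff I_im_pos).1 h1
    obtain ⟨m', n', e'⟩ := (theta3_eq_zero_iff I_im_pos).1 h3
    have := congrArg im (e.symm.trans e')
    simp at this
    refine int_add_half_ne_zero (n' - n) ?_
    push_cast
    linarith
  have h1 : theta1 (u τ / 2) I ≠ 0 := by
    intro h1
    rw [h1] at h
    simp [n3, h3] at h
  have key : theta2 (u τ / 2) I ^ 2 * theta4 (u τ / 2) I ^ 2 ≠ 0 := by
    intro h0
    have e := theta2_sq_mul_theta4_sq_I (u τ / 2)
    rw [h0, zero_mul] at e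
    have e2 : theta3 (u τ / 2) I ^ 4 - theta1 (u τ / 2) I ^ 4 = 0 := by
      simpa [theta2_zero_ne_zero I_im_pos] using e.symm
    have e4 : theta1 (u τ / 2) I ^ 4 * theta2 0 τ ^ 4 = theta3 0 τ ^ 4 * theta3 (u τ / 2) I ^ 4 := by
      have : (thetaSign * theta1 (u τ / 2) I * theta2 0 τ) ^ 4 =
        (theta3 0 τ * theta3 (u τ / 2) I) ^ 4 := by rw [h]
      linear_combination this - (thetaSign ^ 2 + 1) * theta1 (u τ / 2) I ^ 4 * theta2 0 τ ^ 4 * hσ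
    have : theta3 (u τ / 2) I ^ 4 * theta4 0 τ ^ 4 = 0 := by
      linear_combination -e4 - theta3 (u τ / 2) I ^ 4 * jacobi_identity hτ
        - theta2 0 τ ^ 4 * e2
    simp [h3, n4] at this
  exact notMem_punctures_of_theta_ne_zero h1 (fun h => key (by simp [h])) h3
    (fun h => key (by simp [h]))

lemma lemniscate_eq {τ : ℂ} (hτ : τ ∈ upperHalf) : lemniscate (u τ) = thetaQuot τ := by
  obtain ⟨h1, h2, h3, h4⟩ := theta_ne_zero_of_notMem_punctures (hu.notMem_punctures hτ)
  have n2 := theta2_zero_ne_zero hτ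
  rw [lemniscate, thetaQuot, ← mul_div_assoc, div_eq_div_iff h3 n2]
  exact hu.theta_eq τ hτ

/-- `lemniscateDeriv ∘ u` is a constant multiple of `(ϑ₄/ϑ₂)²`. -/
lemma exists_lemniscateDeriv_eq : ∃ κ : ℂ, ∀ τ ∈ upperHalf,
    lemniscateDeriv (u τ) = κ * (theta4 0 τ / theta2 0 τ) ^ 2 := by
  obtain ⟨ρ, hρ, h⟩ := hu.hasDerivAt
  refine ⟨-(Real.pi * I / 4) / (ρ * uniformizerConst), fun τ hτ => ?_⟩
  obtain ⟨h1, h2, h3, h4⟩ := theta_ne_zero_of_notMem_punctures (hu.notMem_punctures hτ)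
  have n2 := theta2_zero_ne_zero hτ
  have n3 := theta3_zero_ne_zero hτ
  have n4 := theta4_zero_ne_zero hτ
  have hk := uniformizerConst_ne_zero
  have hρ0 : ρ ≠ 0 := fun h0 => by simp [h0] at hρ
  have e := ((hasDerivAt_lemniscate h3).comp τ (h τ hτ)).unique
    ((hasDerivAt_thetaQuot hτ).congr_of_eventuallyEq (by
      filter_upwards [isOpen_upperHalf.mem_nhds hτ] with z hz using hu.lemniscate_eq hz))
  rw [thetaQuot, weightTwoForm] at e
  field_simp at e ⊢
  exact e

end IsUniformizer

/-! ### The Schwarzian equation for u and s -/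

/-- The Schwarzian derivative in terms of the logarithmic derivative `N` of `f'`. -/
lemma schwarzian_eq {f g N : ℂ → ℂ} {s : Set ℂ} {z n' : ℂ} (hs : IsOpen s)
    (hf : ∀ z ∈ s, HasDerivAt f (g z) z) (hg : ∀ z ∈ s, HasDerivAt g (N z * g z) z)
    (hN : HasDerivAt N n' z) (hz : z ∈ s) (hgz : g z ≠ 0) :
    schwarzian f z = n' - N z ^ 2 / 2 := by
  have h1 : ∀ w ∈ s, deriv f w = g w := fun w hw => (hf w hw).deriv
  have h2 : ∀ w ∈ s, deriv (deriv f) w = N w * g w := fun w hw =>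
    ((hg w hw).congr_of_eventuallyEq (by
      filter_upwards [hs.mem_nhds hw] with v hv using h1 v hv)).deriv
  have h3 : deriv (deriv (deriv f)) z = n' * g z + N z * (N z * g z) :=
    ((hN.fun_mul (hg z hz)).congr_of_eventuallyEq (by
      filter_upwards [hs.mem_nhds hz] with v hv using h2 v hv)).deriv
  have i2 : iteratedDeriv 2 f = deriv (deriv f) := by
    rw [iteratedDeriv_succ, iteratedDeriv_one]
  have i3 : iteratedDeriv 3 f = deriv (deriv (deriv f)) := by
    rw [iteratedDeriv_succ, i2]
  rw [schwarzian, i3, i2, h3, h2 z hz, h1 z hz]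
  field_simp
  ring

lemma mobius_im_pos {τ : ℂ} (hτ : τ ∈ upperHalf) : (τ - 1) / (τ + 1) ∈ upperHalf := by
  have hτ' : 0 < τ.im := hτ
  have h1 : τ + 1 ≠ 0 := ne_zero_of_im_ne_zero (by simpa using hτ'.ne')
  have hn : 0 < normSq (τ + 1) := normSq_pos.2 h1
  change 0 < ((τ - 1) / (τ + 1)).im
  rw [div_im, div_sub_div_same]
  refine div_pos ?_ hn
  simp
  nlinarith

lemma hasDerivAt_mobius {τ : ℂ} (hτ : τ ∈ upperHalf) :
    HasDerivAt (fun τ : ℂ => (τ - 1) / (τ + 1)) (2 / (τ + 1) ^ 2) τ := by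
  have hτ' : 0 < τ.im := hτ
  have h1 : τ + 1 ≠ 0 := ne_zero_of_im_ne_zero (by simpa using hτ'.ne')
  refine (((hasDerivAt_id τ).sub_const 1).fun_div ((hasDerivAt_id τ).add_const 1) h1).congr_deriv ?_
  simp only [id]
  ring

lemma hasDerivAt_mobius_deriv {τ : ℂ} (hτ : τ ∈ upperHalf) :
    HasDerivAt (fun τ : ℂ => 2 / (τ + 1) ^ 2) (-(2 / (τ + 1) ^ 2 * (2 / (τ + 1)))) τ := by
  have hτ' : 0 < τ.im := hτ
  have h1 : τ + 1 ≠ 0 := ne_zero_of_im_ne_zero (by simpa using hτ'.ne')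
  refine ((hasDerivAt_const τ (2 : ℂ)).fun_div (((hasDerivAt_id τ).add_const 1).fun_pow 2)
    (pow_ne_zero 2 h1)).congr_deriv ?_
  simp only [id]
  field_simp
  push_cast
  ring

lemma SatisfiesSchwarzODE.comp_mobius {u : ℂ → ℂ} (hd : DifferentiableOn ℂ u upperHalf)
    (hu : SatisfiesSchwarzODE u) : SatisfiesSchwarzODE fun τ => u ((τ - 1) / (τ + 1)) := by
  have hd1 := hd.deriv isOpen_upperHalf
  have hd2 := hd1.deriv isOpen_upperHalf
  have hu0 : ∀ τ ∈ upperHalf, HasDerivAt u (deriv u τ) τ := fun τ hτ =>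
    (hd.differentiableAt (isOpen_upperHalf.mem_nhds hτ)).hasDerivAt
  have hu1 : ∀ τ ∈ upperHalf, HasDerivAt (deriv u) (deriv (deriv u) τ / deriv u τ * deriv u τ) τ :=
    fun τ hτ => by
      rw [div_mul_cancel₀ _ (hu τ hτ).2.1]
      exact (hd1.differentiableAt (isOpen_upperHalf.mem_nhds hτ)).hasDerivAt
  have hN : ∀ τ ∈ upperHalf, DifferentiableAt ℂ (fun τ => deriv (deriv u) τ / deriv u τ) τ :=
    fun τ hτ => (hd2.differentiableAt (isOpen_upperHalf.mem_nhds hτ)).fun_div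
      (hd1.differentiableAt (isOpen_upperHalf.mem_nhds hτ)) (hu τ hτ).2.1
  have hs0 : ∀ τ ∈ upperHalf, HasDerivAt (fun τ => u ((τ - 1) / (τ + 1)))
      (deriv u ((τ - 1) / (τ + 1)) * (2 / (τ + 1) ^ 2)) τ := fun τ hτ =>
    (hu0 _ (mobius_im_pos hτ)).comp τ (hasDerivAt_mobius hτ)
  have hne : ∀ τ ∈ upperHalf, τ + 1 ≠ 0 := fun τ hτ =>
    ne_zero_of_im_ne_zero (by simpa using (show 0 < τ.im from hτ).ne')
  have hs1 : ∀ τ ∈ upperHalf, HasDerivAt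
      (fun τ => deriv u ((τ - 1) / (τ + 1)) * (2 / (τ + 1) ^ 2))
      ((deriv (deriv u) ((τ - 1) / (τ + 1)) / deriv u ((τ - 1) / (τ + 1)) * (2 / (τ + 1) ^ 2) -
        2 / (τ + 1)) * (deriv u ((τ - 1) / (τ + 1)) * (2 / (τ + 1) ^ 2))) τ := by
    intro τ hτ
    refine (((hu1 _ (mobius_im_pos hτ)).comp τ (hasDerivAt_mobius hτ)).fun_mul
      (hasDerivAt_mobius_deriv hτ)).congr_deriv ?_
    simp only [Function.comp_apply]
    ring
  intro τ hτ
  have hm := mobius_im_pos hτ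
  have h1 := hne τ hτ
  obtain ⟨p1, p2, p3⟩ := hu _ hm
  have hgs : deriv u ((τ - 1) / (τ + 1)) * (2 / (τ + 1) ^ 2) ≠ 0 :=
    mul_ne_zero p2 (div_ne_zero two_ne_zero (pow_ne_zero 2 h1))
  refine ⟨p1, by rw [(hs0 τ hτ).deriv]; exact hgs, ?_⟩
  have e2 : HasDerivAt (fun τ : ℂ => 2 / (τ + 1)) (-2 / (τ + 1) ^ 2) τ := by
    refine ((hasDerivAt_const τ (2 : ℂ)).fun_div ((hasDerivAt_id τ).add_const 1) h1).congr_deriv ?_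
    simp only [id]
    ring
  have hNs := ((((hN _ hm).hasDerivAt.comp τ (hasDerivAt_mobius hτ)).fun_mul
    (hasDerivAt_mobius_deriv hτ)).fun_sub e2)
  rw [schwarzian_eq isOpen_upperHalf hs0 hs1 hNs hτ hgs, (hs0 τ hτ).deriv]
  rw [schwarzian_eq isOpen_upperHalf hu0 hu1 (hN _ hm).hasDerivAt hm p2] at p3
  simp only [Function.comp_apply]
  -- This cancellation is the vanishing of the Schwarzian of a Möbius map; the cross terms cancel
  -- separately.
  have e4 : (-2 : ℂ) / (τ + 1) ^ 2 = -(2 / (τ + 1)) ^ 2 / 2 := by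
    field_simp
  rw [e4]
  linear_combination (2 / (τ + 1) ^ 2) ^ 2 * p3

namespace IsUniformizer

variable {u : ℂ → ℂ} (hu : IsUniformizer u)
include hu

/-- The logarithmic derivative of u' is L₂ + L₃ + 2L₄. By the Halphen system and the differences Lⱼ
- L₂, the Schwarzian equals (π²/32)(ϑ₂⁴ + ϑ₃⁴)², which is also the right side once y(u) = ϑ₃/ϑ₂ is
inserted. -/
lemma satisfiesSchwarzODE : SatisfiesSchwarzODE u := by
  obtain ⟨ρ, hρ, h⟩ := hu.hasDerivAt
  intro τ hτ
  have n2 := theta2_zero_ne_zero hτ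
  have n3 := theta3_zero_ne_zero hτ
  have n4 := theta4_zero_ne_zero hτ
  have hc := lemniscateConst_ne_zero
  have hp := hu.notMem_punctures hτ
  refine ⟨hp, hu.deriv_ne_zero hτ, ?_⟩
  have hg : ∀ τ ∈ upperHalf, HasDerivAt (fun τ => ρ * uniformizerConst * weightTwoForm τ)
      ((logDeriv2 τ + logDeriv3 τ + 2 * logDeriv4 τ) *
        (ρ * uniformizerConst * weightTwoForm τ)) τ := fun τ hτ =>
    ((hasDerivAt_weightTwoForm hτ).const_mul _).congr_deriv (by ring)
  have hN := ((hasDerivAt_logDeriv2 hτ).fun_add (hasDerivAt_logDeriv3 hτ)).fun_add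
    ((hasDerivAt_logDeriv4 hτ).const_mul 2)
  have hgz : ρ * uniformizerConst * weightTwoForm τ ≠ 0 := by
    rw [← (h τ hτ).deriv]; exact hu.deriv_ne_zero hτ
  rw [schwarzian_eq isOpen_upperHalf h hg hN hτ hgz, wpI_two_mul hp, hu.deriv_sq hτ,
    hu.lemniscate_eq hτ, one_sub_thetaQuot_pow hτ]
  have d3 := logDeriv3_sub_logDeriv2_eq hτ
  have d4 := logDeriv4_sub_logDeriv2_eq hτ
  have e3 : logDeriv3 τ = logDeriv2 τ + -(Real.pi * I / 4) * theta4 0 τ ^ 4 := by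
    linear_combination d3
  have e4 : logDeriv4 τ = logDeriv2 τ + -(Real.pi * I / 4) * theta3 0 τ ^ 4 := by
    linear_combination d4
  have hL : 2 * (logDeriv2 τ * logDeriv3 τ + logDeriv2 τ * logDeriv4 τ - logDeriv3 τ * logDeriv4 τ) +
      2 * (logDeriv3 τ * logDeriv2 τ + logDeriv3 τ * logDeriv4 τ - logDeriv2 τ * logDeriv4 τ) +
      2 * (2 * (logDeriv4 τ * logDeriv2 τ + logDeriv4 τ * logDeriv3 τ - logDeriv2 τ * logDeriv3 τ)) -
      (logDeriv2 τ + logDeriv3 τ + 2 * logDeriv4 τ) ^ 2 / 2 =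
      Real.pi ^ 2 / 32 * (theta2 0 τ ^ 4 + theta3 0 τ ^ 4) ^ 2 := by
    have j : theta4 0 τ ^ 4 = theta3 0 τ ^ 4 - theta2 0 τ ^ 4 := by
      linear_combination -jacobi_identity hτ
    rw [e3, e4, j]
    linear_combination -(Real.pi : ℂ) ^ 2 / 32 * (theta2 0 τ ^ 4 + theta3 0 τ ^ 4) ^ 2 * I_sq
  rw [hL, uniformizerConst, weightTwoForm, thetaQuot]
  field_simp
  ring

end IsUniformizer

/-! ### Additive automorphy -/

/-- `f` is additively automorphic if the lemniscate function and its derivative at `f` are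
modular functions. -/
lemma isAdditivelyAutomorphic_of_invariant {f : ℂ → ℂ} (hf : DifferentiableOn ℂ f upperHalf)
    (hp : ∀ τ ∈ upperHalf, f τ ∉ punctures) (hf' : ∀ τ ∈ upperHalf, deriv f τ ≠ 0)
    {Γ : Subgroup (Matrix.SpecialLinearGroup (Fin 2) ℤ)} (hΓ : Γ.FiniteIndex)
    (hinv : ∀ γ ∈ Γ, ∀ τ : UpperHalfPlane,
      lemniscate (f ((γ • τ : UpperHalfPlane) : ℂ)) = lemniscate (f τ) ∧
      lemniscateDeriv (f ((γ • τ : UpperHalfPlane) : ℂ)) = lemniscateDeriv (f τ)) :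
    IsAdditivelyAutomorphic f := by
  refine ⟨hf, Γ, hΓ, fun γ hγ => ?_⟩
  set m : ℂ → ℂ := fun z => (((γ 0 0 : ℤ) : ℂ) * z + ((γ 0 1 : ℤ) : ℂ)) /
    (((γ 1 0 : ℤ) : ℂ) * z + ((γ 1 1 : ℤ) : ℂ)) with hm
  have hmτ : ∀ τ : UpperHalfPlane, ((γ • τ : UpperHalfPlane) : ℂ) = m τ := fun τ => by
    rw [UpperHalfPlane.coe_specialLinearGroup_apply]
    simp [hm]
  have hden : ∀ τ ∈ upperHalf, (((γ 1 0 : ℤ) : ℂ) * τ + ((γ 1 1 : ℤ) : ℂ)) ≠ 0 := by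
    intro τ hτ h
    have h0 := congrArg im h
    have hτ' : 0 < τ.im := hτ
    simp [hτ'.ne'] at h0
    simp [h0] at h
    have hdet := γ.det_coe
    rw [Matrix.det_fin_two, h0, h] at hdet
    simp at hdet
  have hmem : ∀ τ ∈ upperHalf, m τ ∈ upperHalf := fun τ hτ => by
    rw [← hmτ ⟨τ, hτ⟩]
    exact (γ • (⟨τ, hτ⟩ : UpperHalfPlane)).im_pos
  have hmd : ∀ τ ∈ upperHalf, DifferentiableAt ℂ m τ := fun τ hτ =>
    DifferentiableAt.div (by fun_prop) (by fun_prop) (hden τ hτ)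
  have hfd : ∀ τ ∈ upperHalf, DifferentiableAt ℂ f τ := fun τ hτ =>
    hf.differentiableAt (isOpen_upperHalf.mem_nhds hτ)
  have hfm : ∀ τ ∈ upperHalf, DifferentiableAt ℂ (fun τ => f (m τ)) τ := fun τ hτ =>
    (hfd _ (hmem τ hτ)).comp τ (hmd τ hτ)
  have hi : ∀ τ ∈ upperHalf, lemniscate (f (m τ)) = lemniscate (f τ) ∧
      lemniscateDeriv (f (m τ)) = lemniscateDeriv (f τ) := fun τ hτ => by
    rw [← hmτ ⟨τ, hτ⟩]
    exact hinv γ hγ ⟨τ, hτ⟩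
  -- Differentiate y(f∘γ) = y(f): the outer derivatives agree by hypothesis and are nonzero, so the
  -- inner ones agree.
  have hder : ∀ τ ∈ upperHalf, deriv (fun τ => f (m τ)) τ = deriv f τ := by
    intro τ hτ
    have h3 := (theta_ne_zero_of_notMem_punctures (hp _ hτ)).2.2.1
    have h3m := (theta_ne_zero_of_notMem_punctures (hp _ (hmem τ hτ))).2.2.1
    have e1 := (hasDerivAt_lemniscate h3m).comp τ (hfm τ hτ).hasDerivAt
    have e2 := (hasDerivAt_lemniscate h3).comp τ (hfd τ hτ).hasDerivAt
    have e := e1.unique (e2.congr_of_eventuallyEq (by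
      filter_upwards [isOpen_upperHalf.mem_nhds hτ] with z hz using (hi z hz).1))
    rw [(hi τ hτ).2] at e
    exact mul_left_cancel₀ (lemniscateDeriv_ne_zero (hp τ hτ)) e
  have hconst : ∀ τ ∈ upperHalf, f (m τ) - f τ = f (m I) - f I := by
    intro τ hτ
    have hd : ∀ z ∈ upperHalf, HasDerivAt (fun z => f (m z) - f z) 0 z := fun z hz =>
      ((hfm z hz).hasDerivAt.fun_sub (hfd z hz).hasDerivAt).congr_deriv (by rw [hder z hz, sub_self])
    exact convex_upperHalf.is_const_of_fderivWithin_eq_zero (𝕜 := ℂ)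
      (fun v hv => (hd v hv).differentiableAt.differentiableWithinAt)
      (fun v hv => by
        rw [fderivWithin_of_isOpen isOpen_upperHalf hv, (hd v hv).hasFDerivAt.fderiv]; simp) hτ
      I_im_pos
  set c := f (m I) - f I with hc
  refine ⟨c, ?_, fun τ => ?_⟩
  -- The equation y(v + c) = y(v) without denominators. It holds on values of f, which fill a
  -- neighbourhood of f(i) because f' ≠ 0, hence everywhere. At v = 0 it gives θ₁(c/2) = 0, so c is
  -- a lattice point.
  · set G : ℂ → ℂ := fun v => theta1 ((v + c) / 2) I * theta3 (v / 2) I -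
      theta1 (v / 2) I * theta3 ((v + c) / 2) I with hG
    have hGd : Differentiable ℂ G := by
      have ha : Differentiable ℂ fun v : ℂ => v + c := by fun_prop
      exact ((differentiable_theta1_half.comp ha).mul differentiable_theta3_half).sub
        (differentiable_theta1_half.mul (differentiable_theta3_half.comp ha))
    have hGf : ∀ τ ∈ upperHalf, G (f τ) = 0 := by
      intro τ hτ
      have h3 := (theta_ne_zero_of_notMem_punctures (hp _ hτ)).2.2.1
      have h3m := (theta_ne_zero_of_notMem_punctures (hp _ (hmem τ hτ))).2.2.1
      have e : f τ + c = f (m τ) := by rw [← hconst τ hτ]; ring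
      have h := (hi τ hτ).1
      have hσ0 : thetaSign ≠ 0 := fun h0 => by simpa [h0] using thetaSign_sq
      rw [lemniscate, lemniscate, mul_right_inj' hσ0, div_eq_div_iff h3m h3] at h
      simp only [hG, e]
      linear_combination h
    have hanal : AnalyticAt ℂ f I := hf.analyticOnNhd isOpen_upperHalf I I_im_pos
    have hmap := hanal.hasStrictDerivAt.map_nhds_eq (hf' I I_im_pos)
    have hev : ∀ᶠ v in 𝓝 (f I), G v = 0 := by
      rw [← hmap, Filter.eventually_map]
      filter_upwards [isOpen_upperHalf.mem_nhds (show I ∈ upperHalf from I_im_pos)] with z hz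
        using hGf z hz
    have hG0 : G 0 = 0 := by
      have := (hGd.differentiableOn.analyticOnNhd isOpen_univ).eqOn_zero_of_preconnected_of_eventuallyEq_zero
        isPreconnected_univ (Set.mem_univ (f I)) hev
      exact this (Set.mem_univ 0)
    simp only [hG, zero_add, zero_div, theta1_zero, zero_mul, sub_zero] at hG0
    have h1 := (mul_eq_zero.1 hG0).resolve_right (theta3_zero_ne_zero I_im_pos)
    obtain ⟨a, b, h⟩ := (theta1_eq_zero_iff I_im_pos).1 h1
    exact mem_squarePeriods_lattice.2 ⟨a, b, by linear_combination 2 * h⟩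
  · rw [hmτ τ, ← hconst τ τ.im_pos]
    ring

namespace IsUniformizer

variable {u : ℂ → ℂ} (hu : IsUniformizer u)
include hu

/-- y(u) is the theta ratio ϑ₃/ϑ₂, and y'(u) is a constant times the square of the ratio ϑ₄/ϑ₂. -/
lemma isAdditivelyAutomorphic : IsAdditivelyAutomorphic u := by
  obtain ⟨κ, hκ⟩ := hu.exists_lemniscateDeriv_eq
  have hF : IsThetaRatio fun τ => 1 * (thetaNull 1 τ / thetaNull 0 τ) := ⟨1, 1, 0, one_pow 8, rfl⟩
  have hG : IsThetaRatio fun τ => 1 * (thetaNull 2 τ / thetaNull 0 τ) := ⟨1, 2, 0, one_pow 8, rfl⟩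
  obtain ⟨Γ, hΓ, h⟩ := exists_finiteIndex_of_mem_levelTwo hF.mem_levelTwo hG.mem_levelTwo
  simp only [one_mul, thetaNull] at h
  refine isAdditivelyAutomorphic_of_invariant hu.differentiableOn
    (fun τ hτ => hu.notMem_punctures hτ) (fun τ hτ => hu.deriv_ne_zero hτ) hΓ fun γ hγ τ => ?_
  rw [hu.lemniscate_eq τ.im_pos, hu.lemniscate_eq (γ • τ).im_pos, hκ _ τ.im_pos,
    hκ _ (γ • τ).im_pos, (h γ hγ τ).2]
  exact ⟨(h γ hγ τ).1, rfl⟩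

lemma isAdditivelyAutomorphic_comp_mobius :
    IsAdditivelyAutomorphic fun τ => u ((τ - 1) / (τ + 1)) := by
  obtain ⟨κ, hκ⟩ := hu.exists_lemniscateDeriv_eq
  have hF : IsThetaRatio fun τ => 1 * (thetaNull 1 τ / thetaNull 0 τ) := ⟨1, 1, 0, one_pow 8, rfl⟩
  have hG : IsThetaRatio fun τ => 1 * (thetaNull 2 τ / thetaNull 0 τ) := ⟨1, 2, 0, one_pow 8, rfl⟩
  obtain ⟨Γ, hΓ, h⟩ := exists_finiteIndex_of_mem_levelTwo hF.comp_mem_levelTwo hG.comp_mem_levelTwo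
  simp only [one_mul, thetaNull] at h
  refine isAdditivelyAutomorphic_of_invariant
    (fun τ hτ => ((hu.differentiableOn.differentiableAt (isOpen_upperHalf.mem_nhds
      (mobius_im_pos hτ))).comp τ (hasDerivAt_mobius hτ).differentiableAt).differentiableWithinAt)
    (fun τ hτ => hu.notMem_punctures (mobius_im_pos hτ))
    (fun τ hτ => (hu.satisfiesSchwarzODE.comp_mobius hu.differentiableOn τ hτ).2.1) hΓ
    fun γ hγ τ => ?_
  have m1 := mobius_im_pos τ.im_pos
  have m2 := mobius_im_pos (γ • τ).im_pos
  rw [hu.lemniscate_eq m1, hu.lemniscate_eq m2, hκ _ m1, hκ _ m2, (h γ hγ τ).2]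
  exact ⟨(h γ hγ τ).1, rfl⟩

end IsUniformizer

/-! ### The theta relation between u and s -/

/-- The theta quotient `θ₂θ₃²θ₄/θ₁⁴` at `u/2`. -/
def thetaWeight (u : ℂ) : ℂ :=
  theta2 (u / 2) I * theta3 (u / 2) I ^ 2 * theta4 (u / 2) I / theta1 (u / 2) I ^ 4

lemma thetaWeight_sq {u : ℂ} (hu : u ∉ punctures) :
    2 * thetaWeight u ^ 2 = (1 - lemniscate u ^ 4) / lemniscate u ^ 8 := by
  obtain ⟨h1, h2, h3, h4⟩ := theta_ne_zero_of_notMem_punctures hu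
  have n2 := theta2_zero_ne_zero I_im_pos
  have h := theta2_sq_mul_theta4_sq_I (u / 2)
  rw [theta3_zero_I_pow] at h
  have h' : 2 * (theta2 (u / 2) I ^ 2 * theta4 (u / 2) I ^ 2) =
      theta3 (u / 2) I ^ 4 - theta1 (u / 2) I ^ 4 :=
    mul_right_cancel₀ (pow_ne_zero 4 n2) (by linear_combination h)
  rw [show lemniscate u ^ 8 = (lemniscate u ^ 4) ^ 2 by ring, lemniscate_pow_four, thetaWeight]
  field_simp
  linear_combination h'

/-- The right side of the relation is the reciprocal of W(s), so off the punctures the relation is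
symmetric in u and s. -/
lemma thetaRelation_iff {ε u s : ℂ} (hu : u ∉ punctures) (hs : s ∉ punctures) :
    ThetaRelation ε u s ↔ ε * (8 * (thetaWeight u * thetaWeight s)) = 1 := by
  obtain ⟨h1, h2, h3, h4⟩ := theta_ne_zero_of_notMem_punctures hu
  obtain ⟨k1, k2, k3, k4⟩ := theta_ne_zero_of_notMem_punctures hs
  have hk : theta2 (s / 2) I * theta3 (s / 2) I ^ 2 * theta4 (s / 2) I ≠ 0 := by simp [k2, k3, k4]
  rw [ThetaRelation, and_iff_right h1, and_iff_right hk, eq_div_iff hk]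
  have hk1 : theta1 (s / 2) I ^ 4 ≠ 0 := pow_ne_zero 4 k1
  rw [thetaWeight, thetaWeight, ← div_eq_one_iff_eq hk1]
  refine iff_of_eq (congrArg (· = 1) ?_)
  ring

lemma continuousAt_thetaWeight {u : ℂ} (hu : u ∉ punctures) : ContinuousAt thetaWeight u := by
  have hd : Differentiable ℂ fun z : ℂ => z / 2 := differentiable_id.div_const 2
  have d1 := ((differentiable_theta1 I_im_pos).comp hd).continuous.continuousAt (x := u)
  have d2 := ((differentiable_theta2 I_im_pos).comp hd).continuous.continuousAt (x := u)
  have d3 := ((differentiable_theta3 I_im_pos).comp hd).continuous.continuousAt (x := u)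
  have d4 := ((differentiable_theta4 I_im_pos).comp hd).continuous.continuousAt (x := u)
  exact ((d2.mul (d3.pow 2)).mul d4).div (d1.pow 4)
    (pow_ne_zero 4 (theta_ne_zero_of_notMem_punctures hu).1)

/-- Since λ = 1/y(u)⁴, the Möbius formula for λ(λ-1) says that (8W(u)W(s))² = 1; connectedness makes
the sign constant. -/
lemma IsUniformizer.exists_thetaRelation {u : ℂ → ℂ} (hu : IsUniformizer u) :
    ∃ ε : ℂ, (ε = 1 ∨ ε = -1) ∧
      ∀ τ ∈ upperHalf, ThetaRelation ε (u τ) (u ((τ - 1) / (τ + 1))) := by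
  have hW : ∀ τ ∈ upperHalf, 2 * thetaWeight (u τ) ^ 2 =
      modularLambda τ * (modularLambda τ - 1) := by
    intro τ hτ
    have n2 := theta2_zero_ne_zero hτ
    have n3 := theta3_zero_ne_zero hτ
    rw [thetaWeight_sq (hu.notMem_punctures hτ), hu.lemniscate_eq hτ, thetaQuot, modularLambda]
    field_simp
  have hcont : ContinuousOn
      (fun τ => 8 * (thetaWeight (u τ) * thetaWeight (u ((τ - 1) / (τ + 1))))) upperHalf := by
    intro τ hτ
    have hm := mobius_im_pos hτ
    have c1 := (hu.differentiableOn.differentiableAt (isOpen_upperHalf.mem_nhds hτ)).continuousAt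
    have c2 := ((hu.differentiableOn.differentiableAt (isOpen_upperHalf.mem_nhds hm)).comp τ
      (hasDerivAt_mobius hτ).differentiableAt).continuousAt
    have w1 : ContinuousAt (fun τ => thetaWeight (u τ)) τ :=
      ContinuousAt.comp (continuousAt_thetaWeight (hu.notMem_punctures hτ)) c1
    have w2 : ContinuousAt (fun τ => thetaWeight (u ((τ - 1) / (τ + 1)))) τ :=
      ContinuousAt.comp (f := fun τ => u ((τ - 1) / (τ + 1)))
        (continuousAt_thetaWeight (hu.notMem_punctures hm)) c2
    exact (continuousAt_const.mul (w1.mul w2)).continuousWithinAt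
  rcases isPreconnected_upperHalf.eq_one_or_eq_neg_one_of_sq_eq hcont (fun τ hτ => by
    have h := modularLambda_mobius hτ
    rw [← hW τ hτ, ← hW _ (mobius_im_pos hτ)] at h
    simp only [Pi.pow_apply, Pi.one_apply]
    linear_combination 16 * h) with h | h
  · refine ⟨1, Or.inl rfl, fun τ hτ => (thetaRelation_iff (hu.notMem_punctures hτ)
      (hu.notMem_punctures (mobius_im_pos hτ))).2 ?_⟩
    rw [one_mul]
    exact h hτ
  · refine ⟨-1, Or.inr rfl, fun τ hτ => (thetaRelation_iff (hu.notMem_punctures hτ)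
      (hu.notMem_punctures (mobius_im_pos hτ))).2 ?_⟩
    have := h hτ
    simp only [Pi.neg_apply, Pi.one_apply] at this
    rw [this]
    norm_num

/-! ### Automorphisms of the equation on the torus -/

lemma iteratedDeriv_two_eq (f : ℂ → ℂ) : iteratedDeriv 2 f = deriv (deriv f) := by
  rw [iteratedDeriv_succ, iteratedDeriv_one]

/-- Solutions of `ψ'' = -q₁ ψ` are carried to solutions of `φ'' = -q φ` by a change of variable `S`
whose Schwarzian `N' - N²/2` is `2 (q - q₁ S'²)`. -/
lemma solves_of_schwarzian {U V : Set ℂ} {S ψ r N N' q q₁ : ℂ → ℂ} (hU : IsOpen U) (hV : IsOpen V)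
    (hS : DifferentiableOn ℂ S U) (hmaps : Set.MapsTo S U V)
    (hS' : ∀ u ∈ U, HasDerivAt (deriv S) (N u * deriv S u) u)
    (hN : ∀ u ∈ U, HasDerivAt N (N' u) u)
    (hq : ∀ u ∈ U, N' u - N u ^ 2 / 2 = 2 * q u - 2 * q₁ (S u) * deriv S u ^ 2)
    (hψ : DifferentiableOn ℂ ψ V) (hψ2 : ∀ z ∈ V, iteratedDeriv 2 ψ z = -q₁ z * ψ z)
    (hr : DifferentiableOn ℂ r U) (hrS : ∀ u ∈ U, r u ^ 2 * deriv S u = 1) :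
    DifferentiableOn ℂ (fun u => r u * ψ (S u)) U ∧
      ∀ u ∈ U, iteratedDeriv 2 (fun u => r u * ψ (S u)) u = -q u * (r u * ψ (S u)) := by
  have dS : ∀ u ∈ U, HasDerivAt S (deriv S u) u := fun u hu =>
    (hS.differentiableAt (hU.mem_nhds hu)).hasDerivAt
  have dψ : ∀ z ∈ V, HasDerivAt ψ (deriv ψ z) z := fun z hz =>
    (hψ.differentiableAt (hV.mem_nhds hz)).hasDerivAt
  have dψ' : ∀ z ∈ V, HasDerivAt (deriv ψ) (-q₁ z * ψ z) z := fun z hz => by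
    rw [← hψ2 z hz, iteratedDeriv_two_eq]
    exact ((hψ.deriv hV).differentiableAt (hV.mem_nhds hz)).hasDerivAt
  -- Differentiating r²S' = 1 and cancelling 2rS' gives r' = -(N/2)r.
  have dr : ∀ u ∈ U, HasDerivAt r (-(N u / 2) * r u) u := by
    intro u hu
    have h0 := (hr.differentiableAt (hU.mem_nhds hu)).hasDerivAt
    have e := ((h0.fun_pow 2).fun_mul (hS' u hu)).unique
      ((hasDerivAt_const u (1 : ℂ)).congr_of_eventuallyEq (by
        filter_upwards [hU.mem_nhds hu] with v hv using hrS v hv))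
    have hne : r u * deriv S u ≠ 0 := fun h => by
      have := hrS u hu
      rw [sq, mul_assoc, h, mul_zero] at this
      exact zero_ne_one this
    refine h0.congr_deriv (mul_left_cancel₀ hne ?_)
    simp only [Nat.cast_ofNat, Nat.add_one_sub_one, pow_one] at e
    linear_combination e / 2
  have d1 : ∀ u ∈ U, HasDerivAt (fun u => r u * ψ (S u))
      (r u * (-(N u / 2) * ψ (S u) + deriv ψ (S u) * deriv S u)) u := fun u hu =>
    ((dr u hu).fun_mul ((dψ _ (hmaps hu)).comp u (dS u hu))).congr_deriv (by
      simp only [Function.comp_apply]; ring)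
  refine ⟨fun u hu => (d1 u hu).differentiableAt.differentiableWithinAt, fun u hu => ?_⟩
  have d2 := (dr u hu).fun_mul ((((hN u hu).div_const 2).fun_neg.fun_mul
    ((dψ _ (hmaps hu)).comp u (dS u hu))).fun_add
    (((dψ' _ (hmaps hu)).comp u (dS u hu)).fun_mul (hS' u hu)))
  have e : deriv (fun u => r u * ψ (S u)) =ᶠ[𝓝 u] fun u =>
      r u * (-(N u / 2) * ψ (S u) + deriv ψ (S u) * deriv S u) := by
    filter_upwards [hU.mem_nhds hu] with v hv using (d1 v hv).deriv
  rw [iteratedDeriv_two_eq, e.deriv_eq]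
  refine d2.deriv.trans ?_
  simp only [Function.comp_apply]
  linear_combination (-(1 / 2) * r u * ψ (S u)) * hq u hu

/-- The algebraic identity behind the transformation of the potential. -/
lemma potential_identity {c y p Y P s : ℂ} (hc : c ≠ 0) (hy : y ≠ 0) (hp : p ≠ 0) (hY : Y ≠ 0)
    (h1 : 1 - y ^ 4 ≠ 0) (h2 : 1 - Y ^ 4 ≠ 0)
    (hpy : p ^ 2 = c ^ 2 * (1 - y ^ 4)) (hPY : P ^ 2 = c ^ 2 * (1 - Y ^ 4))
    (hs : 4 * s ^ 2 * (1 - y ^ 4) = y ^ 6 * Y ^ 2)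
    (hrel : 16 * (1 - y ^ 4) * (1 - Y ^ 4) = y ^ 8 * Y ^ 8) :
    (((-2 * c ^ 2 * Y ^ 3 * s) * Y - P * (P * s)) / Y ^ 2 * s +
        P / Y * ((P / Y * s + 3 * (p / y) + 2 * c ^ 2 * (y ^ 3 / p)) * s) +
      3 * (((-2 * c ^ 2 * y ^ 3) * y - p * p) / y ^ 2) +
      2 * c ^ 2 * ((3 * y ^ 2 * p * p - y ^ 3 * (-2 * c ^ 2 * y ^ 3)) / p ^ 2)) -
      (P / Y * s + 3 * (p / y) + 2 * c ^ 2 * (y ^ 3 / p)) ^ 2 / 2 =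
    2 * (c ^ 2 * (1 + y ^ 4) ^ 2 / (4 * y ^ 2 * (1 - y ^ 4))) -
      2 * (c ^ 2 * (1 + Y ^ 4) ^ 2 / (4 * Y ^ 2 * (1 - Y ^ 4))) * s ^ 2 := by
  have e1 : s ^ 2 = y ^ 6 * Y ^ 2 / (4 * (1 - y ^ 4)) := by
    rw [eq_div_iff (mul_ne_zero (by norm_num) h1)]
    linear_combination hs
  have e2 : Y ^ 8 / (1 - Y ^ 4) = 16 * (1 - y ^ 4) / y ^ 8 := by
    rw [div_eq_div_iff h2 (pow_ne_zero 8 hy)]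
    linear_combination -hrel
  -- All dependence on Y, weighted by s² = S'², collapses to 8c²/y² by the two relations between y
  -- and Y.
  have hYpart : s ^ 2 * (c ^ 2 * (1 + Y ^ 4) ^ 2 / (2 * Y ^ 2 * (1 - Y ^ 4)) -
      c ^ 2 * (1 - Y ^ 4) / (2 * Y ^ 2) - 2 * c ^ 2 * Y ^ 2) = 8 * c ^ 2 / y ^ 2 := by
    have : c ^ 2 * (1 + Y ^ 4) ^ 2 / (2 * Y ^ 2 * (1 - Y ^ 4)) -
      c ^ 2 * (1 - Y ^ 4) / (2 * Y ^ 2) - 2 * c ^ 2 * Y ^ 2 =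
        2 * c ^ 2 / Y ^ 2 * (Y ^ 8 / (1 - Y ^ 4)) := by
      field_simp
      ring
    rw [this, e1, e2]
    field_simp
    norm_num
  -- The terms containing P to the first power cancel against the cross terms of the square, so only
  -- P² and p² remain.
  have hLHS : (((-2 * c ^ 2 * Y ^ 3 * s) * Y - P * (P * s)) / Y ^ 2 * s +
        P / Y * ((P / Y * s + 3 * (p / y) + 2 * c ^ 2 * (y ^ 3 / p)) * s) +
      3 * (((-2 * c ^ 2 * y ^ 3) * y - p * p) / y ^ 2) +
      2 * c ^ 2 * ((3 * y ^ 2 * p * p - y ^ 3 * (-2 * c ^ 2 * y ^ 3)) / p ^ 2)) -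
      (P / Y * s + 3 * (p / y) + 2 * c ^ 2 * (y ^ 3 / p)) ^ 2 / 2 =
      s ^ 2 * (-(P ^ 2 / (2 * Y ^ 2)) - 2 * c ^ 2 * Y ^ 2) - 15 / 2 * (p ^ 2 / y ^ 2) -
        6 * c ^ 2 * y ^ 2 + 2 * c ^ 4 * y ^ 6 / p ^ 2 := by
    field_simp
    ring
  have hypart : -(15 / 2) * (c ^ 2 * (1 - y ^ 4) / y ^ 2) - 6 * c ^ 2 * y ^ 2 +
      2 * c ^ 4 * y ^ 6 / (c ^ 2 * (1 - y ^ 4)) + 8 * c ^ 2 / y ^ 2 =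
      2 * (c ^ 2 * (1 + y ^ 4) ^ 2 / (4 * y ^ 2 * (1 - y ^ 4))) := by
    field_simp
    ring
  rw [hLHS, hPY, hpy, ← hypart, ← hYpart]
  field_simp
  ring

lemma sq_relation_of_thetaRelation {ε u s : ℂ} (hε : ε = 1 ∨ ε = -1) (hu : u ∉ punctures)
    (hs : s ∉ punctures) (h : ThetaRelation ε u s) :
    16 * (1 - lemniscate u ^ 4) * (1 - lemniscate s ^ 4) = lemniscate u ^ 8 * lemniscate s ^ 8 := by
  have hε2 : ε ^ 2 = 1 := by rcases hε with rfl | rfl <;> norm_num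
  have h1 := (thetaRelation_iff hu hs).1 h
  have hu2 := thetaWeight_sq hu
  have hs2 := thetaWeight_sq hs
  have ny := lemniscate_ne_zero hu
  have nY := lemniscate_ne_zero hs
  have e : 16 * (2 * thetaWeight u ^ 2) * (2 * thetaWeight s ^ 2) = 1 := by
    have : (ε * (8 * (thetaWeight u * thetaWeight s))) ^ 2 = 1 := by rw [h1, one_pow]
    linear_combination this - 64 * thetaWeight u ^ 2 * thetaWeight s ^ 2 * hε2
  rw [hu2, hs2] at e
  field_simp at e
  linear_combination e

section

variable {U : Set ℂ} {S : ℂ → ℂ} (hU : IsOpen U) (hS : DifferentiableOn ℂ S U)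
  (hp : ∀ u ∈ U, u ∉ punctures) (hpS : ∀ u ∈ U, S u ∉ punctures)
  (hrel : ∀ u ∈ U, 16 * (1 - lemniscate u ^ 4) * (1 - lemniscate (S u) ^ 4) =
    lemniscate u ^ 8 * lemniscate (S u) ^ 8)
include hU hS hp hpS hrel

/-- Differentiating the relation and squaring gives an equation for S'² with factors (2-y⁴)² and
(2-Y⁴)². The relation itself says 4(1-y⁴)(2-Y⁴)² = Y⁸(2-y⁴)², which eliminates both when y⁴ ≠ 2. -/
lemma deriv_sq_of_relation {u : ℂ} (hu : u ∈ U) :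
    4 * deriv S u ^ 2 * (1 - lemniscate u ^ 4) = lemniscate u ^ 6 * lemniscate (S u) ^ 2 := by
  have hc := lemniscateConst_ne_zero
  have dS : ∀ u ∈ U, HasDerivAt S (deriv S u) u := fun u hu =>
    (hS.differentiableAt (hU.mem_nhds hu)).hasDerivAt
  have d1 : ∀ u ∈ U, HasDerivAt lemniscate (lemniscateDeriv u) u := fun u hu =>
    hasDerivAt_lemniscate (theta_ne_zero_of_notMem_punctures (hp u hu)).2.2.1
  have d2 : ∀ u ∈ U, HasDerivAt (fun u => lemniscate (S u))
      (lemniscateDeriv (S u) * deriv S u) u := fun u hu =>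
    (hasDerivAt_lemniscate (theta_ne_zero_of_notMem_punctures (hpS u hu)).2.2.1).comp u (dS u hu)
  have hgen : ∀ u ∈ U, lemniscate u ^ 4 ≠ 2 →
      4 * deriv S u ^ 2 * (1 - lemniscate u ^ 4) = lemniscate u ^ 6 * lemniscate (S u) ^ 2 := by
    intro u hu h2
    have e := ((((d1 u hu).fun_pow 4).const_sub 1).const_mul 16).fun_mul
      (((d2 u hu).fun_pow 4).const_sub 1) |>.unique
      ((((d1 u hu).fun_pow 8).fun_mul ((d2 u hu).fun_pow 8)).congr_of_eventuallyEq (by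
        filter_upwards [hU.mem_nhds hu] with v hv using hrel v hv))
    simp only [Nat.cast_ofNat, Nat.reduceSub] at e
    have hr := hrel u hu
    have sy := lemniscateDeriv_sq (theta_ne_zero_of_notMem_punctures (hp u hu)).2.2.1
    have sY := lemniscateDeriv_sq (theta_ne_zero_of_notMem_punctures (hpS u hu)).2.2.1
    have ny := lemniscate_ne_zero (hp u hu)
    have nY := lemniscate_ne_zero (hpS u hu)
    have n1 := lemniscate_pow_four_ne_one (hp u hu)
    have n2 := lemniscate_pow_four_ne_one (hpS u hu)
    generalize lemniscate u = y at *
    generalize lemniscate (S u) = Y at *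
    generalize lemniscateDeriv u = p at *
    generalize lemniscateDeriv (S u) = P at *
    generalize deriv S u = s at *
    have e1 : (2 - y ^ 4) * p * Y * (1 - Y ^ 4) = -((2 - Y ^ 4) * (P * s) * y * (1 - y ^ 4)) := by
      linear_combination -(y * Y) / 64 * e + (p * Y + y * (P * s)) / 8 * hr
    have e2 : (2 - y ^ 4) ^ 2 * Y ^ 2 * (1 - Y ^ 4) = (2 - Y ^ 4) ^ 2 * s ^ 2 * y ^ 2 * (1 - y ^ 4) := by
      refine mul_left_cancel₀ (mul_ne_zero (pow_ne_zero 2 hc) (mul_ne_zero n1 n2)) ?_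
      linear_combination ((2 - y ^ 4) * p * Y * (1 - Y ^ 4) -
        (2 - Y ^ 4) * (P * s) * y * (1 - y ^ 4)) * e1 -
        (2 - y ^ 4) ^ 2 * Y ^ 2 * (1 - Y ^ 4) ^ 2 * sy +
        (2 - Y ^ 4) ^ 2 * s ^ 2 * y ^ 2 * (1 - y ^ 4) ^ 2 * sY
    have e3 : (2 - Y ^ 4) ^ 2 * (4 * (1 - y ^ 4)) = (2 - y ^ 4) ^ 2 * Y ^ 8 := by
      linear_combination hr
    have e4 : 4 * Y ^ 2 * (1 - Y ^ 4) = Y ^ 8 * s ^ 2 * y ^ 2 := by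
      refine mul_left_cancel₀ (pow_ne_zero 2 (sub_ne_zero.2 h2.symm)) ?_
      linear_combination 4 * e2 + s ^ 2 * y ^ 2 * e3
    refine mul_left_cancel₀ (mul_ne_zero (pow_ne_zero 2 ny) (pow_ne_zero 8 nY)) ?_
    linear_combination -4 * (1 - y ^ 4) * e4 + Y ^ 2 * hr
  have hcd : ContinuousAt (deriv S) u :=
    ((hS.deriv hU).differentiableAt (hU.mem_nhds hu)).continuousAt
  have hcy : ContinuousAt lemniscate u := (d1 u hu).continuousAt
  have hcY : ContinuousAt (fun u => lemniscate (S u)) u := (d2 u hu).continuousAt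
  have hcL : ContinuousAt (fun u => 4 * deriv S u ^ 2 * (1 - lemniscate u ^ 4)) u :=
    (continuousAt_const.mul (hcd.pow 2)).mul (continuousAt_const.sub (hcy.pow 4))
  have hcR : ContinuousAt (fun u => lemniscate u ^ 6 * lemniscate (S u) ^ 2) u :=
    (hcy.pow 6).mul (hcY.pow 2)
  -- Points with y⁴ = 2 are isolated since y⁴ has derivative 4y³y' ≠ 0; there the identity follows
  -- by continuity.
  have hne : ∀ᶠ v in 𝓝[≠] u, lemniscate v ^ 4 ≠ 2 := by
    refine ((d1 u hu).fun_pow 4).eventually_ne ?_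
    simp [lemniscate_ne_zero (hp u hu), lemniscateDeriv_ne_zero (hp u hu)]
  refine tendsto_nhds_unique_of_eventuallyEq (hcL.tendsto.mono_left nhdsWithin_le_nhds)
    (hcR.tendsto.mono_left nhdsWithin_le_nhds) (l := 𝓝[≠] u) ?_
  filter_upwards [hne, nhdsWithin_le_nhds (hU.mem_nhds hu)] with v h1 h2 using hgen v h2 h1

lemma deriv_ne_zero_of_relation {u : ℂ} (hu : u ∈ U) : deriv S u ≠ 0 := by
  intro h
  have e := deriv_sq_of_relation hU hS hp hpS hrel hu
  simp [h, lemniscate_ne_zero (hp u hu), lemniscate_ne_zero (hpS u hu)] at e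

/-- Logarithmic differentiation of 4(S'y')² = c²y⁶Y²; the last summand is -y''/y'. -/
lemma hasDerivAt_deriv_of_relation {u : ℂ} (hu : u ∈ U) : HasDerivAt (deriv S)
    ((lemniscateDeriv (S u) / lemniscate (S u) * deriv S u +
      3 * (lemniscateDeriv u / lemniscate u) +
      2 * lemniscateConst ^ 2 * (lemniscate u ^ 3 / lemniscateDeriv u)) * deriv S u) u := by
  have d0 := ((hS.deriv hU).differentiableAt (hU.mem_nhds hu)).hasDerivAt
  have h3 := (theta_ne_zero_of_notMem_punctures (hp u hu)).2.2.1
  have h3S := (theta_ne_zero_of_notMem_punctures (hpS u hu)).2.2.1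
  have d1 := hasDerivAt_lemniscate h3
  have d1' := hasDerivAt_lemniscateDeriv (hp u hu)
  have d2 := (hasDerivAt_lemniscate h3S).comp u (hS.differentiableAt (hU.mem_nhds hu)).hasDerivAt
  have e := (((d0.fun_mul d1').fun_pow 2).const_mul 4).unique
    ((((d1.fun_pow 6).fun_mul (d2.fun_pow 2)).const_mul (lemniscateConst ^ 2)).congr_of_eventuallyEq
      (by
        filter_upwards [hU.mem_nhds hu] with v hv
        have := deriv_sq_of_relation hU hS hp hpS hrel hv
        have sy := lemniscateDeriv_sq (theta_ne_zero_of_notMem_punctures (hp v hv)).2.2.1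
        rw [mul_pow, sy, Function.comp_apply]
        linear_combination lemniscateConst ^ 2 * this))
  simp only [Nat.cast_ofNat, Nat.reduceSub, pow_one, Function.comp_apply] at e
  refine d0.congr_deriv ?_
  have hr := deriv_sq_of_relation hU hS hp hpS hrel hu
  have sy := lemniscateDeriv_sq h3
  have ny := lemniscate_ne_zero (hp u hu)
  have nY := lemniscate_ne_zero (hpS u hu)
  have np := lemniscateDeriv_ne_zero (hp u hu)
  have ns := deriv_ne_zero_of_relation hU hS hp hpS hrel hu
  have hr' : 4 * (deriv S u * lemniscateDeriv u) ^ 2 =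
      lemniscateConst ^ 2 * (lemniscate u ^ 6 * lemniscate (S u) ^ 2) := by
    rw [mul_pow, sy]
    linear_combination lemniscateConst ^ 2 * hr
  generalize deriv (deriv S) u = s' at *
  generalize lemniscate u = y at *
  generalize lemniscate (S u) = Y at *
  generalize lemniscateDeriv u = p at *
  generalize lemniscateDeriv (S u) = P at *
  generalize deriv S u = s at *
  have e' : 4 * (s * p) * (s' * p + s * (-2 * lemniscateConst ^ 2 * y ^ 3)) * (y * Y) =
      4 * (s * p) ^ 2 * (3 * p * Y + P * s * y) := by
    linear_combination (y * Y) / 2 * e - (3 * p * Y + P * s * y) * hr'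
  field_simp
  refine mul_left_cancel₀ (mul_ne_zero ns np) ?_
  linear_combination e' / 4

end

/-- The theta relation is an automorphism of the equation on the torus. -/
lemma isTorusEquationAutomorphism_thetaRelation {ε : ℂ} (hε : ε = 1 ∨ ε = -1) :
    IsTorusEquationAutomorphism (ThetaRelation ε) := by
  intro U S hU hS h
  have hp : ∀ u ∈ U, u ∉ punctures := fun u hu => (h u hu).1
  have hpS : ∀ u ∈ U, S u ∉ punctures := fun u hu => (h u hu).2.1
  have hrel : ∀ u ∈ U, 16 * (1 - lemniscate u ^ 4) * (1 - lemniscate (S u) ^ 4) =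
      lemniscate u ^ 8 * lemniscate (S u) ^ 8 := fun u hu =>
    sq_relation_of_thetaRelation hε (hp u hu) (hpS u hu) (h u hu).2.2
  have hS' := fun u (hu : u ∈ U) => hasDerivAt_deriv_of_relation hU hS hp hpS hrel hu
  refine ⟨fun u hu => deriv_ne_zero_of_relation hU hS hp hpS hrel hu, ?_⟩
  intro V ψ r hV hmaps hψ hr hrS
  refine solves_of_schwarzian (q := fun u => wpI (2 * u)) (q₁ := fun u => wpI (2 * u))
    (N := fun u => lemniscateDeriv (S u) / lemniscate (S u) * deriv S u +
      3 * (lemniscateDeriv u / lemniscate u) +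
      2 * lemniscateConst ^ 2 * (lemniscate u ^ 3 / lemniscateDeriv u))
    (N' := fun u => ((-2 * lemniscateConst ^ 2 * lemniscate (S u) ^ 3 * deriv S u) *
          lemniscate (S u) - lemniscateDeriv (S u) * (lemniscateDeriv (S u) * deriv S u)) /
          lemniscate (S u) ^ 2 * deriv S u +
        lemniscateDeriv (S u) / lemniscate (S u) * ((lemniscateDeriv (S u) / lemniscate (S u) *
          deriv S u + 3 * (lemniscateDeriv u / lemniscate u) +
          2 * lemniscateConst ^ 2 * (lemniscate u ^ 3 / lemniscateDeriv u)) * deriv S u) +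
      3 * (((-2 * lemniscateConst ^ 2 * lemniscate u ^ 3) * lemniscate u -
        lemniscateDeriv u * lemniscateDeriv u) / lemniscate u ^ 2) +
      2 * lemniscateConst ^ 2 * ((3 * lemniscate u ^ 2 * lemniscateDeriv u * lemniscateDeriv u -
        lemniscate u ^ 3 * (-2 * lemniscateConst ^ 2 * lemniscate u ^ 3)) /
          lemniscateDeriv u ^ 2)) hU hV hS hmaps hS'
    (fun u hu => ?_) (fun u hu => ?_) hψ.1 hψ.2 hr hrS
  rotate_left
  · rw [wpI_two_mul (hp u hu), wpI_two_mul (hpS u hu)]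
    exact potential_identity lemniscateConst_ne_zero (lemniscate_ne_zero (hp u hu))
      (lemniscateDeriv_ne_zero (hp u hu)) (lemniscate_ne_zero (hpS u hu))
      (lemniscate_pow_four_ne_one (hp u hu)) (lemniscate_pow_four_ne_one (hpS u hu))
      (lemniscateDeriv_sq (theta_ne_zero_of_notMem_punctures (hp u hu)).2.2.1)
      (lemniscateDeriv_sq (theta_ne_zero_of_notMem_punctures (hpS u hu)).2.2.1)
      (deriv_sq_of_relation hU hS hp hpS hrel hu) (hrel u hu)
  · have dS := (hS.differentiableAt (hU.mem_nhds hu)).hasDerivAt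
    have d1 := hasDerivAt_lemniscate (theta_ne_zero_of_notMem_punctures (hp u hu)).2.2.1
    have d1' := hasDerivAt_lemniscateDeriv (hp u hu)
    have d2 := (hasDerivAt_lemniscate
      (theta_ne_zero_of_notMem_punctures (hpS u hu)).2.2.1).comp u dS
    have d2' := (hasDerivAt_lemniscateDeriv (hpS u hu)).comp u dS
    refine (((((d2'.fun_div d2 (lemniscate_ne_zero (hpS u hu))).fun_mul (hS' u hu)).fun_add
      ((d1'.fun_div d1 (lemniscate_ne_zero (hp u hu))).const_mul 3)).fun_add
      (((d1.fun_pow 3).fun_div d1' (lemniscateDeriv_ne_zero (hp u hu))).const_mul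
        (2 * lemniscateConst ^ 2)))).congr_deriv ?_
    simp only [Nat.cast_ofNat, Nat.reduceSub, Function.comp_apply]

theorem proposition10 :
    (∀ ε : ℂ, ε = 1 ∨ ε = -1 → IsTorusEquationAutomorphism (ThetaRelation ε)) ∧
    (∃ τ₀ ∈ upperHalf, ‖thetaConst3 τ₀ ^ 4 / thetaConst2 τ₀ ^ 4‖ < 1) ∧
    (∀ τ₀ ∈ upperHalf, ‖thetaConst3 τ₀ ^ 4 / thetaConst2 τ₀ ^ 4‖ < 1 →
      ∃ u s : ℂ → ℂ,
        ContinuesFormula τ₀ u ∧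
        (∀ v : ℂ → ℂ, ContinuesFormula τ₀ v → Set.EqOn v u upperHalf) ∧
        (∀ τ : ℂ, s τ = u ((τ - 1) / (τ + 1))) ∧
        IsAdditivelyAutomorphic u ∧ IsAdditivelyAutomorphic s ∧
        SatisfiesSchwarzODE u ∧ SatisfiesSchwarzODE s ∧
        ∃ ε : ℂ, (ε = 1 ∨ ε = -1) ∧
          ∀ τ ∈ upperHalf, ThetaRelation ε (u τ) (s τ)) := by
  refine ⟨fun ε hε => isTorusEquationAutomorphism_thetaRelation hε,
    exists_norm_theta_quotient_lt_one, fun τ₀ hτ₀ hlt => ?_⟩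
  obtain ⟨u, hu, huf⟩ := exists_isUniformizer hτ₀ hlt
  refine ⟨u, fun τ => u ((τ - 1) / (τ + 1)), ⟨hu.differentiableOn, huf⟩, fun v hv => ?_,
    fun τ => rfl, hu.isAdditivelyAutomorphic, hu.isAdditivelyAutomorphic_comp_mobius,
    hu.satisfiesSchwarzODE, hu.satisfiesSchwarzODE.comp_mobius hu.differentiableOn,
    hu.exists_thetaRelation⟩
  exact (hv.1.analyticOnNhd isOpen_upperHalf).eqOn_of_preconnected_of_eventuallyEq
    (hu.differentiableOn.analyticOnNhd isOpen_upperHalf) isPreconnected_upperHalf hτ₀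
    (hv.2.trans huf.symm)

end
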